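/- All graphs are finite and simple, and rigidity is in $\mathbb R^3$. A framework $G(p)$ is a graph $G=(V,E)$ with positions $p:V\to\mathbb R^3$. In its rigidity matrix the row of a pair $\{x,y\}$ has $p(x)-p(y)$ in the columns of $x$, $p(y)-p(x)$ in those of $y$, and $0$ elsewhere. $G(p)$ is generic if the rank of its rigidity matrix is maximum over all frameworks of $G$; this maximum is $\operatorname{rank}(G)$. $G$ is independent if the rows of a generic rigidity matrix of $G$ are linearly independent. A non-edge $\{x,y\}$ of $G$ is implied if its row is a linear combination of the rows of $G$ in every generic framework of $G$. A framework $G(p)$ is rigid if every framework $G(q)$ with $q$ close enough to $p$ and the same edge lengths is congruent to it; a graph is rigid if it has a rigid generic framework, and $G$ is nucleation-free if no subgraph of $G$ with at least five vertices is rigid. A cover of $G$ is a family $\mathcal X$ of pairwise incomparable vertex sets of size at least two such that every edge lies in a member. It is 2-thin if $|X\cap Y|\le 2$ for distinct $X,Y\in\mathcal X$. $S(\mathcal X)$ is the set of pairs $\{x,y\}$ that equal $X\cap Y$ for distinct $X,Y\in\mathcal X$, $d(x,y)$ is the number of members of $\mathcal X$ that contain $\{x,y\}$, and $G^\star=G\cup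 S(\mathcal X)$. A shared non-edge is a non-edge of $G$ in $S(\mathcal X)$. The cover is tight if it is 2-thin, $(V,S(\mathcal X))$ is independent, and $$\operatorname{rank}(G)=\sum_{X\in\mathcal X}\operatorname{rank}(G^\star[X])-\sum_{\{x,y\}\in S(\mathcal X)}(d(x,y)-1).$$ Cutting $H$ along a non-edge $\{a,b\}$ replaces $a$ by $a_1,a_2$ and $b$ by $b_1,b_2$ and assigns every edge at $a$ to $a_1$ or $a_2$ and every edge at $b$ to $b_1$ or $b_2$. The cutting is admissible for a tight cover $\mathcal X$ of $H$ if $\{a,b\}$ is a shared non-edge and 1. for every $X\in\mathcal X$ that contains a shared non-edge, all edges of $H[X]$ incident to $a$ or $b$ go to the same side (side $1$: $a_1,b_1$; side $2$: $a_2,b_2$), and $\{a,b\}$ is the only shared non-edge that is split; that is, the shared non-edges other than $\{a,b\}$ incident to $a$ or $b$ can also be assigned to sides so that, for every such $X$, all edges of $H^\star[X]$ other than $\{a,b\}$ incident to $a$ or $b$ are on the same side; 2. the graph after cutting is nucleation-free. $H$ is a starting graph if it is independent and has a tight cover with an admissible cutting. A roof is $K_5$ minus two non-adjacent edges, its hinge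 non-edges. Roof-addition on $H$ performs an admissible cutting and then pastes two roofs with a common hinge non-edge $\{u,v\}$ and otherwise disjoint, the other hinge non-edges being identified with $\{a_1,b_1\}$ and $\{a_2,b_2\}$; it adds the new vertices $u,v$ and one apex for each roof. **Theorem.** Let $H$ be a starting graph. * Suppose $H$ is nucleation-free, and let $G$ be a $k$-sum ($1\le k\le 3$) of $H$ with a nucleation-free independent graph $G_1$, i.e. $G$ arises by identifying a proper subgraph $K_k$ of $H$ with a proper subgraph $K_k$ of $G_1$, where for $k=3$ the common $K_3$ is not part of a $K_4$ in $H$ or is not part of a $K_4$ in $G_1$. Then $G$ is a starting graph and is nucleation-free and independent with implied non-edges. * Suppose $H$ is nucleation-free, and let $G$ arise by a Henneberg-I construction, i.e. by adding a new vertex joined to three vertices of $H$ that are not part of a $K_4$ in $H$. Then $G$ is a starting graph and is nucleation-free and independent with implied non-edges. * Let $G$ arise from $H$ by roof-addition. Then $G$ is a starting graph and is nucleation-free and independent with implied non-edges. * Consequently, if $H$ is nucleation-free, every graph obtained from $H$ by any finite sequence of these moves is a starting graph and is nucleation-free and independent with implied non-edges. For every starting graph $H$ and every $N$, some graph with at least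 $N$ vertices obtained from $H$ by a finite sequence of these moves is a starting graph and is nucleation-free and independent with implied non-edges. -/

import Mathlib

open scoped Topology

universe u v w

noncomputable section

/-! ### Frameworks in three-space and generic rank -/

/-- Points of three-dimensional Euclidean space. -/
abbrev Space : Type := EuclideanSpace ℝ (Fin 3)

open scoped Classical in
/-- The row of the rigidity matrix of the framework with positions `p` that belongs to the pair
`{x, y}`: it is `p x - p y` in the three columns of `x`, `p y - p x` in those of `y`, and `0` in
all the others. -/
def rigidityRow {V : Type u} (p : V → Space) : Sym2 V → (V → Space) :=
  Sym2.lift ⟨fun x y => Pi.single x (p x - p y) + Pi.single y (p y - p x),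
    fun _ _ => add_comm _ _⟩

/-- The rank of the rigidity matrix of the framework `G(p)`. -/
def frameworkRank {V : Type u} (G : SimpleGraph V) (p : V → Space) : ℕ :=
  Module.finrank ℝ (Submodule.span ℝ (rigidityRow p '' G.edgeSet))

/-- `G(p)` is generic: its rigidity matrix has maximum rank over all frameworks of `G`. -/
def IsGeneric {V : Type u} (G : SimpleGraph V) (p : V → Space) : Prop :=
  ∀ q : V → Space, frameworkRank G q ≤ frameworkRank G p

/-- The rank of `G` in the generic three-dimensional rigidity matroid. -/
def genericRank {V : Type u} (G : SimpleGraph V) : ℕ :=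
  ⨆ p : V → Space, frameworkRank G p

/-- `G` is independent: the rows of a generic rigidity matrix of `G` are linearly independent. -/
def IsIndependent {V : Type u} (G : SimpleGraph V) : Prop :=
  ∃ p : V → Space, IsGeneric G p ∧
    LinearIndependent ℝ (fun e : G.edgeSet => rigidityRow p (e : Sym2 V))

/-- `{x, y}` is an implied non-edge of `G`: it is a non-edge, and its row depends linearly on the
rows of the generic rigidity matrix of `G`. -/
def IsImpliedNonedge {V : Type u} (G : SimpleGraph V) (x y : V) : Prop :=
  x ≠ y ∧ ¬ G.Adj x y ∧ ∀ p : V → Space, IsGeneric G p →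
    rigidityRow p s(x, y) ∈ Submodule.span ℝ (rigidityRow p '' G.edgeSet)

/-! ### Rigidity and nuclei -/

/-- The framework `G(p)` is rigid: every framework `G(q)` with `q` near `p` and with the same edge
lengths is congruent to `G(p)`. -/
def IsRigidFramework {V : Type u} (G : SimpleGraph V) (p : V → Space) : Prop :=
  ∀ᶠ q in 𝓝 p, (∀ x y, G.Adj x y → dist (q x) (q y) = dist (p x) (p y)) →
    ∀ x y, dist (q x) (q y) = dist (p x) (p y)

/-- A graph is rigid if it has a generic framework that is rigid. -/
def IsRigid {V : Type u} (G : SimpleGraph V) : Prop :=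
  ∃ p : V → Space, IsGeneric G p ∧ IsRigidFramework G p

/-- `G` is nucleation-free: no subgraph with more than four vertices is rigid in isolation. -/
def IsNucleationFree {V : Type u} (G : SimpleGraph V) : Prop :=
  ∀ K : G.Subgraph, 5 ≤ K.verts.ncard → ¬ IsRigid K.coe

/-! ### Thin covers -/

/-- A cover of `G`: pairwise incomparable sets of at least two vertices such that every edge lies
in one of them. -/
structure IsCover {V : Type u} (G : SimpleGraph V) (𝒳 : Finset (Finset V)) : Prop where
  two_le_card : ∀ X ∈ 𝒳, 2 ≤ X.card
  incomparable : ∀ X ∈ 𝒳, ∀ Y ∈ 𝒳, X ⊆ Y → X = Y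
  covers : ∀ x y, G.Adj x y → ∃ X ∈ 𝒳, x ∈ X ∧ y ∈ X

open scoped Classical in
/-- A family is 2-thin if two distinct members have at most two common elements. -/
def IsTwoThin {V : Type u} (𝒳 : Finset (Finset V)) : Prop :=
  ∀ X ∈ 𝒳, ∀ Y ∈ 𝒳, X ≠ Y → (X ∩ Y).card ≤ 2

open scoped Classical in
/-- The shared part `S(𝒳)`: the two-element sets that are the intersection of two distinct members
of `𝒳`. -/
def sharedPairs {V : Type u} (𝒳 : Finset (Finset V)) : Finset (Finset V) :=
  (𝒳.offDiag.image (fun q => q.1 ∩ q.2)).filter (fun P => P.card = 2)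

open scoped Classical in
/-- `d(P)`: the number of members of `𝒳` that contain the pair `P`. -/
def coverDegree {V : Type u} (𝒳 : Finset (Finset V)) (P : Finset V) : ℕ :=
  (𝒳.filter (fun X => P ⊆ X)).card

open scoped Classical in
/-- The graph `(V, S(𝒳))`. -/
def sharedGraph {V : Type u} (𝒳 : Finset (Finset V)) : SimpleGraph V where
  Adj x y := x ≠ y ∧ ({x, y} : Finset V) ∈ sharedPairs 𝒳
  symm := ⟨fun x y h => ⟨h.1.symm, by rw [Finset.pair_comm]; exact h.2⟩⟩
  loopless := ⟨fun _ h => h.1 rfl⟩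

/-- The graph `G⋆ = G ∪ S(𝒳)`. -/
def starGraph {V : Type u} (G : SimpleGraph V) (𝒳 : Finset (Finset V)) : SimpleGraph V :=
  G ⊔ sharedGraph 𝒳

/-- `𝒳` is a 2-thin cover of `G` with independent shared part and tight rank count
`rank G = ∑ rank (G⋆[X]) - ∑ (d(P) - 1)`. -/
structure IsTightCover {V : Type u} (G : SimpleGraph V) (𝒳 : Finset (Finset V)) : Prop where
  cover : IsCover G 𝒳
  twoThin : IsTwoThin 𝒳
  shared_independent : IsIndependent (sharedGraph 𝒳)
  rank_eq : (genericRank G : ℤ) =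
    ∑ X ∈ 𝒳, (genericRank ((starGraph G 𝒳).induce (X : Set V)) : ℤ)
      - ∑ P ∈ sharedPairs 𝒳, ((coverDegree 𝒳 P : ℤ) - 1)

/-- `{x, y}` is a shared non-edge: a non-edge of `G` that belongs to `S(𝒳)`. -/
def IsSharedNonedge {V : Type u} (G : SimpleGraph V) (𝒳 : Finset (Finset V)) (x y : V) : Prop :=
  (sharedGraph 𝒳).Adj x y ∧ ¬ G.Adj x y

/-! ### Graph cutting and roof-addition

The vertices `a`, `b` are split into `a₁, a₂` and `b₁, b₂`.  In `V ⊕ Fin 2` the vertices `a₁`, `b₁`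
are `Sum.inl a`, `Sum.inl b`, and `a₂`, `b₂` are `Sum.inr 0`, `Sum.inr 1`.  The function `side`
records how the edges incident to `a` or `b` are distributed: `true` means that the edge is
assigned to `a₁` or `b₁`, and `false` that it is assigned to `a₂` or `b₂`. -/

open scoped Classical in
/-- The end of the edge `e` at `x` after the cutting along `{a, b}`. -/
def cutEnd {V : Type u} (a b : V) (side : Sym2 V → Bool) (e : Sym2 V) (x : V) : V ⊕ Fin 2 :=
  if side e = false ∧ x = a then Sum.inr 0
  else if side e = false ∧ x = b then Sum.inr 1
  else Sum.inl x

theorem cutEnd_injective {V : Type u} (a b : V) (side : Sym2 V → Bool) (e : Sym2 V) :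
    Function.Injective (cutEnd a b side e) := by
  intro x y h
  unfold cutEnd at h
  split_ifs at h <;> simp_all

/-- The graph obtained from `H` by cutting along `{a, b}`. -/
def graphCut {V : Type u} (H : SimpleGraph V) (a b : V) (side : Sym2 V → Bool) :
    SimpleGraph (V ⊕ Fin 2) where
  Adj z t := ∃ x y, H.Adj x y ∧
    z = cutEnd a b side s(x, y) x ∧ t = cutEnd a b side s(x, y) y
  symm := ⟨by
    rintro z t ⟨x, y, h, hz, ht⟩
    exact ⟨y, x, h.symm, by rw [Sym2.eq_swap]; exact ht, by rw [Sym2.eq_swap]; exact hz⟩⟩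
  loopless := ⟨by
    rintro z ⟨x, y, h, hz, ht⟩
    exact h.ne (cutEnd_injective a b side s(x, y) (hz.symm.trans ht))⟩

/-- The roof with apex `c` and hinge non-edges `{x, y}` and `{s, t}`: the complete graph on
`{x, y, s, t, c}` without these two edges. -/
def roof {V : Type u} (x y s t c : V) : SimpleGraph V where
  Adj z z' := z ≠ z' ∧ z ∈ ({x, y, s, t, c} : Set V) ∧ z' ∈ ({x, y, s, t, c} : Set V) ∧
    s(z, z') ≠ s(x, y) ∧ s(z, z') ≠ s(s, t)
  symm := ⟨fun z z' h => ⟨h.1.symm, h.2.2.1, h.2.1, by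
    rw [Sym2.eq_swap]; exact h.2.2.2.1, by rw [Sym2.eq_swap]; exact h.2.2.2.2⟩⟩
  loopless := ⟨fun _ h => h.1 rfl⟩

/-- Roof-addition: cut `H` along `{a, b}` and paste two roofs with the common hinge non-edge
`{u, v}` and apexes `c`, `c'`, the other hinge non-edges being `{a₁, b₁}` and `{a₂, b₂}`.
The new vertices `u, v, c, c'` are `Sum.inr 0, …, Sum.inr 3`. -/
def roofAddition {V : Type u} (H : SimpleGraph V) (a b : V) (side : Sym2 V → Bool) :
    SimpleGraph ((V ⊕ Fin 2) ⊕ Fin 4) :=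
  (graphCut H a b side).map Sum.inl
    ⊔ roof (Sum.inl (Sum.inl a)) (Sum.inl (Sum.inl b)) (Sum.inr 0) (Sum.inr 1) (Sum.inr 2)
    ⊔ roof (Sum.inl (Sum.inr 0)) (Sum.inl (Sum.inr 1)) (Sum.inr 0) (Sum.inr 1) (Sum.inr 3)

/-- The cutting of `H` along `{a, b}` given by `side` is compatible with the cover `𝒳`: for every
covering set `X` that contains a shared non-edge, all edges of `H[X]` incident to `a` or `b`
go to the same side; and the shared non-edges other than `{a, b}` are not split either, i.e. the
same holds for the edges of `H⋆[X]` other than `{a, b}`. (The values of `side` on non-edges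
do not influence the cut graph.) -/
def RespectsCover {V : Type u} (H : SimpleGraph V) (𝒳 : Finset (Finset V)) (a b : V)
    (side : Sym2 V → Bool) : Prop :=
  ∀ X ∈ 𝒳, (∃ x ∈ X, ∃ y ∈ X, IsSharedNonedge H 𝒳 x y) →
    ∃ i : Bool, ∀ x ∈ X, ∀ y ∈ X, (starGraph H 𝒳).Adj x y → (x = a ∨ x = b) →
      s(x, y) ≠ s(a, b) → side s(x, y) = i

/-- The data of an admissible roof-addition on `H`: a tight 2-thin cover `𝒳`, a shared
non-edge `{a, b}`, and a cutting along `{a, b}` that respects the cover and leaves a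
nucleation-free graph. -/
structure IsAdmissibleCut {V : Type u} (H : SimpleGraph V) (𝒳 : Finset (Finset V)) (a b : V)
    (side : Sym2 V → Bool) : Prop where
  tight : IsTightCover H 𝒳
  shared_nonedge : IsSharedNonedge H 𝒳 a b
  respects : RespectsCover H 𝒳 a b side
  nucleationFree : IsNucleationFree (graphCut H a b side)

/-- `H` is a starting graph: it is independent and admits an admissible cut. -/
def IsStartingGraph {V : Type u} (H : SimpleGraph V) : Prop :=
  IsIndependent H ∧ ∃ 𝒳 a b side, IsAdmissibleCut H 𝒳 a b side

/-! ### The moves -/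

/-- The vertices `x i` are part of a complete graph on four vertices in `G`. -/
def InK4 {V : Type u} {ι : Type v} (G : SimpleGraph V) (x : ι → V) : Prop :=
  ∃ s : Finset V, G.IsNClique 4 s ∧ ∀ i, x i ∈ s

/-- `G` is the `k`-sum of `G₁` and `G₂` that identifies the complete subgraph `φ` of `G₁` with
the complete subgraph `ψ` of `G₂` vertex by vertex; both are proper subgraphs. Here `f`, `g` are
the inclusions of the two vertex sets into that of `G`. -/
def IsKSum {V₁ : Type u} {V₂ : Type v} {W : Type w} {k : ℕ}
    (G₁ : SimpleGraph V₁) (G₂ : SimpleGraph V₂) (G : SimpleGraph W)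
    (φ : (⊤ : SimpleGraph (Fin k)) ↪g G₁) (ψ : (⊤ : SimpleGraph (Fin k)) ↪g G₂) : Prop :=
  Set.range φ ≠ Set.univ ∧ Set.range ψ ≠ Set.univ ∧
  ∃ (f : V₁ ↪ W) (g : V₂ ↪ W), (∀ i, f (φ i) = g (ψ i)) ∧
    Set.range f ∪ Set.range g = Set.univ ∧
    Set.range f ∩ Set.range g = Set.range (fun i => f (φ i)) ∧
    G = G₁.map f ⊔ G₂.map g

/-- `G` arises from `H` by a `k`-sum, `1 ≤ k ≤ 3`, with a finite nucleation-free independent graph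
`G₁`; if `k = 3`, the common triangle is not part of a `K₄` in both summands. -/
def KSumMove {V : Type u} {W : Type u} (H : SimpleGraph V) (G : SimpleGraph W) : Prop :=
  ∃ (V₁ : Type u) (_ : Finite V₁) (G₁ : SimpleGraph V₁) (k : ℕ)
    (φ : (⊤ : SimpleGraph (Fin k)) ↪g H) (ψ : (⊤ : SimpleGraph (Fin k)) ↪g G₁),
    IsNucleationFree G₁ ∧ IsIndependent G₁ ∧ 1 ≤ k ∧ k ≤ 3 ∧
    (k = 3 → ¬ InK4 H φ ∨ ¬ InK4 G₁ ψ) ∧ IsKSum H G₁ G φ ψ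

/-- `G` arises from `H` by a Henneberg-I construction: a new vertex `v` is joined to three distinct
vertices `w 0, w 1, w 2` of `H` that are not part of a `K₄` in `H`. -/
def HennebergMove {V : Type u} {W : Type w} (H : SimpleGraph V) (G : SimpleGraph W) : Prop :=
  ∃ (f : V ↪ W) (v : W) (w : Fin 3 ↪ V), v ∉ Set.range f ∧ (∀ z, z = v ∨ z ∈ Set.range f) ∧
    ¬ InK4 H w ∧
    G = H.map f ⊔ SimpleGraph.fromEdgeSet (Set.range (fun i => s(v, f (w i))))

/-- `G` arises from `H` by roof-addition along an admissible cut. -/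
def RoofMove {V : Type u} {W : Type w} (H : SimpleGraph V) (G : SimpleGraph W) : Prop :=
  ∃ 𝒳 a b side, IsAdmissibleCut H 𝒳 a b side ∧ Nonempty (G ≃g roofAddition H a b side)

/-- `G` arises from `H` by a finite sequence of `k`-sums, Henneberg-I constructions and
roof-additions. -/
inductive Generated {V : Type u} (H : SimpleGraph V) : ∀ {W : Type u}, SimpleGraph W → Prop
  | refl : Generated H H
  | kSum {W W' : Type u} {G : SimpleGraph W} {G' : SimpleGraph W'} :
      Generated H G → KSumMove G G' → Generated H G'
  | henneberg {W W' : Type u} {G : SimpleGraph W} {G' : SimpleGraph W'} :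
      Generated H G → HennebergMove G G' → Generated H G'
  | roofAdd {W W' : Type u} {G : SimpleGraph W} {G' : SimpleGraph W'} :
      Generated H G → RoofMove G G' → Generated H G'

/-- A starting graph that is nucleation-free (independence is part of being a starting graph) and
has an implied non-edge. -/
structure IsGoodStartingGraph {V : Type u} (G : SimpleGraph V) : Prop where
  starting : IsStartingGraph G
  independent : IsIndependent G
  nucleationFree : IsNucleationFree G
  implied : ∃ x y, IsImpliedNonedge G x y

end

noncomputable section
open scoped Classical RealInnerProductSpace
open Module Submodule

/-! ### Rows of the rigidity matrix, loads and motions -/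

section Rows
variable {V : Type*} {W : Type*}

/-! Implied non-edges come from tightness. For a 2-thin cover with independent shared part, a
dimension count of row spaces (`thinCover_rank`) bounds rank G⋆ + ∑ (d - 1) by ∑ rank G⋆[X]. A tight
cover has ∑ rank G⋆[X] = rank G + ∑ (d - 1), so the shared pairs do not raise the rank, and every
shared non-edge is implied (`IsTightCover.isImpliedNonedge`). It remains to show that each move
gives an independent nucleation-free graph that again has an admissible cut.

Rigidity enters only through ranks. On n ≥ 3 vertices a graph is rigid exactly when its rank is 3n -
6 (`isRigid_iff`). Hence an independent graph is nucleation-free exactly when every n ≥ 5 vertices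
span at most 3n - 7 edges. Independence is checked by statics: rows are loads, and two edge sets
have independent rows together if each does and no nonzero load is resolved by both.

k-sums and Henneberg-I constructions are both pastings (`IsPasting`) along at most three vertices;
the second one pastes a K₄. A load in equilibrium on three points in general position is resolved by
their triangle, which gives independence. Edge counts give nucleation-freeness, with two K₄'s on a
common triangle as the only exception. The old cover stays tight when every new edge is added as a
member of its own (`isTightCover_extendCover`), and the old cut remains admissible because cutting
commutes with pasting (`IsPasting.graphCut`).

For roof-addition, place the two copies of a at one point, the two copies of b at one point, and the
two apexes at one point. Folding the cut back turns its rows into those of H, and a roof resolves no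
nonzero load on either of its hinges, so all rows are independent (`linearIndepOn_roofAddition`).
Nucleation-freeness is a count that uses both the cut graph and H (`CutBound.roof_count`). The new
cover consists of the copied members that contain a shared non-edge, the leftover edges and the two
roofs. The roofs have total rank at most 18, which is paid for by their 16 edges, one extra unit of
∑ (d - 1) from splitting the hinge {a, b}, and one from the common hinge {u, v}
(`isTightCover_roofCover`). Cutting along {u, v} so that the roofs separate is again admissible.
Roof-addition can therefore be repeated forever, and it needs nucleation-freeness only of the cut
graph, not of H. -/

theorem rigidityRow_mk (p : V → Space) (x y : V) :
    rigidityRow p s(x, y) = Pi.single x (p x - p y) + Pi.single y (p y - p x) := rfl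

theorem rigidityRow_apply (p : V → Space) (x y z : V) :
    rigidityRow p s(x, y) z =
      (if z = x then p x - p y else 0) + (if z = y then p y - p x else 0) := by
  rw [rigidityRow_mk, Pi.add_apply, Pi.single_apply, Pi.single_apply]

theorem rigidityRow_apply_of_notMem (p : V → Space) {e : Sym2 V} {z : V} (h : z ∉ e) :
    rigidityRow p e z = 0 := by
  induction e with | _ x y =>
  rw [Sym2.mem_iff, not_or] at h
  rw [rigidityRow_apply, if_neg h.1, if_neg h.2, add_zero]

theorem rigidityRow_apply_left (p : V → Space) (x y : V) :
    rigidityRow p s(x, y) x = p x - p y := by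
  rw [rigidityRow_apply, if_pos rfl]
  split_ifs with h <;> simp [h]

/-- The row of a fixed pair as a linear function of the positions. -/
def rowLin (e : Sym2 V) : (V → Space) →ₗ[ℝ] (V → Space) where
  toFun p := rigidityRow p e
  map_add' p q := by
    induction e with | _ x y =>
    ext1 z
    simp only [rigidityRow_apply, Pi.add_apply]
    split_ifs <;> module
  map_smul' c p := by
    induction e with | _ x y =>
    ext1 z
    simp only [rigidityRow_apply, Pi.smul_apply, RingHom.id_apply]
    split_ifs <;> module

/-- The load on `W` obtained by moving the load at each `x : V` to `f x`. -/
def push [Fintype V] (f : V → W) : (V → Space) →ₗ[ℝ] (W → Space) where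
  toFun F w := ∑ x, if f x = w then F x else 0
  map_add' F F' := by
    ext1 w
    simp only [Pi.add_apply, ← Finset.sum_add_distrib]
    exact Finset.sum_congr rfl fun x _ => by split_ifs <;> simp
  map_smul' c F := by
    ext1 w
    simp only [Pi.smul_apply, RingHom.id_apply, Finset.smul_sum]
    exact Finset.sum_congr rfl fun x _ => by split_ifs <;> simp

theorem push_apply [Fintype V] (f : V → W) (F : V → Space) (w : W) :
    push f F w = ∑ x, if f x = w then F x else 0 := rfl

/-- With each fibre of `f` placed at a single point, identifying vertices turns rows into rows. No
injectivity is needed, so the lemma also covers folding a cut back together. -/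
theorem push_rigidityRow [Fintype V] (f : V → W) (p : W → Space) (e : Sym2 V) :
    push f (rigidityRow (p ∘ f) e) = rigidityRow p (e.map f) := by
  induction e with | _ x y =>
  ext1 w
  rw [Sym2.map_mk, rigidityRow_apply, push_apply]
  have h : ∀ z, (if f z = w then rigidityRow (p ∘ f) s(x, y) z else 0) =
      (if z = x then (if w = f x then p (f x) - p (f y) else 0) else 0) +
      (if z = y then (if w = f y then p (f y) - p (f x) else 0) else 0) := by
    intro z
    rw [rigidityRow_apply]
    by_cases hx : z = x <;> by_cases hy : z = y <;> subst_vars <;> simp_all [eq_comm]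
  simp only [h, Finset.sum_add_distrib, Finset.sum_ite_eq', Finset.mem_univ, if_true]

theorem push_injective [Fintype V] {f : V → W} (hf : Function.Injective f) :
    Function.Injective (push f) := by
  intro F F' h
  ext1 x
  have := congrFun h (f x)
  simpa [push_apply, hf.eq_iff] using this

theorem push_comp {U : Type*} [Fintype U] [Fintype V] (f : U → V) (g : V → W) (F : U → Space) :
    push g (push f F) = push (g ∘ f) F := by
  ext1 w
  simp only [push_apply, Function.comp]
  have : ∀ x, (if g x = w then ∑ y, (if f y = x then F y else 0) else 0) =
      ∑ y, (if f y = x then (if g (f y) = w then F y else 0) else 0) := by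
    intro x
    by_cases h : g x = w
    · rw [if_pos h]
      refine Finset.sum_congr rfl fun y _ => ?_
      by_cases h' : f y = x
      · subst h'; simp [h]
      · simp [h']
    · rw [if_neg h, Finset.sum_eq_zero]
      intro y _
      by_cases h' : f y = x
      · subst h'; simp [h]
      · simp [h']
  simp only [this]
  rw [Finset.sum_comm]
  simp

/-- The work of the load `F` along the motion `m`. -/
def work [Fintype V] : LinearMap.BilinForm ℝ (V → Space) :=
  LinearMap.mk₂ ℝ (fun F m => ∑ x, ⟪F x, m x⟫)
    (fun F F' m => by simp [inner_add_left, Finset.sum_add_distrib])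
    (fun c F m => by simp [inner_smul_left, Finset.mul_sum])
    (fun F m m' => by simp [inner_add_right, Finset.sum_add_distrib])
    (fun c F m => by simp [inner_smul_right, Finset.mul_sum])

theorem work_apply [Fintype V] (F m : V → Space) : work F m = ∑ x, ⟪F x, m x⟫ := rfl

theorem work_rigidityRow [Fintype V] (p m : V → Space) (x y : V) :
    work (rigidityRow p s(x, y)) m = ⟪p x - p y, m x - m y⟫ := by
  rw [work_apply]
  have h : ∀ z, ⟪rigidityRow p s(x, y) z, m z⟫ =
      (if z = x then ⟪p x - p y, m x⟫ else 0) + (if z = y then ⟪p y - p x, m y⟫ else 0) := by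
    intro z
    rw [rigidityRow_apply, inner_add_left]
    congr 1 <;> split_ifs with h <;> simp [h]
  simp only [h, Finset.sum_add_distrib, Finset.sum_ite_eq', Finset.mem_univ, if_true]
  rw [← neg_sub (p x) (p y), inner_neg_left, inner_sub_right]
  ring

theorem work_isSymm [Fintype V] : (work (V := V)).IsSymm :=
  ⟨fun F m => by simp [work_apply, real_inner_comm]⟩

theorem work_nondegenerate [Fintype V] : (work (V := V)).Nondegenerate := by
  refine (LinearMap.IsRefl.nondegenerate_iff_separatingLeft work_isSymm.isRefl).2 fun F h => ?_
  have := h F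
  rw [work_apply, Finset.sum_eq_zero_iff_of_nonneg (fun _ _ => real_inner_self_nonneg)] at this
  ext1 x
  simpa using this x (Finset.mem_univ _)

/-- The space of infinitesimal motions of the framework with positions `p` that keep the lengths of
the pairs in `E`. -/
def motions (p : V → Space) (E : Set (Sym2 V)) : Submodule ℝ (V → Space) where
  carrier := {m | ∀ x y, s(x, y) ∈ E → ⟪p x - p y, m x - m y⟫ = 0}
  add_mem' {m m'} h h' x y e := by
    have := h x y e
    have := h' x y e
    simp only [Pi.add_apply]
    rw [add_sub_add_comm, inner_add_right]; linarith
  zero_mem' x y _ := by simp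
  smul_mem' c m h x y e := by
    simp only [Pi.smul_apply]
    rw [← smul_sub, inner_smul_right, h x y e, mul_zero]

/-- The row space. -/
abbrev rowSpan (p : V → Space) (E : Set (Sym2 V)) : Submodule ℝ (V → Space) :=
  span ℝ (rigidityRow p '' E)

theorem rowSpan_mono (p : V → Space) {E E' : Set (Sym2 V)} (h : E ⊆ E') :
    rowSpan p E ≤ rowSpan p E' := span_mono (Set.image_mono h)

theorem rigidityRow_mem_rowSpan (p : V → Space) {E : Set (Sym2 V)} {e : Sym2 V} (h : e ∈ E) :
    rigidityRow p e ∈ rowSpan p E := subset_span ⟨e, h, rfl⟩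

theorem motions_eq_orthogonal [Fintype V] (p : V → Space) (E : Set (Sym2 V)) :
    motions p E = work.orthogonal (rowSpan p E) := by
  ext m
  rw [LinearMap.BilinForm.mem_orthogonal_iff]
  constructor
  · intro h F hF
    refine span_induction (p := fun F _ => work F m = 0) ?_ ?_ ?_ ?_ hF
    · rintro _ ⟨e, he, rfl⟩
      induction e with | _ x y => exact (work_rigidityRow p m x y).trans (h x y he)
    · simp
    · intro a b _ _ ha hb
      simp_all
    · intro c a _ ha
      simp_all
  · intro h x y he
    exact (work_rigidityRow p m x y).symm.trans (h _ (rigidityRow_mem_rowSpan p he))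

/-- A load is resolved by the bars iff it does no work along any infinitesimal motion: this is the
double orthogonal complement for the pairing `work`. -/
theorem mem_rowSpan_iff [Fintype V] (p : V → Space) (E : Set (Sym2 V)) (F : V → Space) :
    F ∈ rowSpan p E ↔ ∀ m ∈ motions p E, work F m = 0 := by
  have := LinearMap.BilinForm.orthogonal_orthogonal work_nondegenerate work_isSymm.isRefl
    (rowSpan p E)
  rw [← motions_eq_orthogonal] at this
  rw [← this, LinearMap.BilinForm.mem_orthogonal_iff]
  refine forall₂_congr fun m _ => ?_
  exact Eq.congr_left (work_isSymm.eq m F)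

theorem finrank_motions_add [Fintype V] (p : V → Space) (E : Set (Sym2 V)) :
    finrank ℝ (motions p E) + finrank ℝ (rowSpan p E) = 3 * Fintype.card V := by
  have h := LinearMap.BilinForm.finrank_orthogonal (V := V → Space) work_nondegenerate
    (rowSpan p E)
  have h2 : finrank ℝ (V → Space) = 3 * Fintype.card V := by
    rw [finrank_pi_fintype]; simp [mul_comm]
  have h3 := finrank_le (rowSpan p E)
  rw [motions_eq_orthogonal, h]
  omega

theorem apply_eq_zero_of_mem_rowSpan {p : V → Space} {E : Set (Sym2 V)} {F : V → Space}
    (hF : F ∈ rowSpan p E) {z : V} (hz : ∀ e ∈ E, z ∉ e) : F z = 0 := by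
  have : rowSpan p E ≤ LinearMap.ker (LinearMap.proj (R := ℝ) (φ := fun _ : V => Space) z) := by
    rw [span_le]
    rintro _ ⟨e, he, rfl⟩
    exact rigidityRow_apply_of_notMem p (hz e he)
  exact this hF

theorem map_push_rowSpan [Fintype V] (f : V → W) (p : W → Space) (E : Set (Sym2 V)) :
    (rowSpan (p ∘ f) E).map (push f) = rowSpan p (Sym2.map f '' E) := by
  rw [rowSpan, rowSpan, Submodule.map_span, Set.image_image, Set.image_image]
  simp only [push_rigidityRow]

theorem push_mem_rowSpan [Fintype V] (f : V → W) (p : W → Space) {E : Set (Sym2 V)}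
    {F : V → Space} (h : F ∈ rowSpan (p ∘ f) E) : push f F ∈ rowSpan p (Sym2.map f '' E) := by
  rw [← map_push_rowSpan]; exact mem_map_of_mem h

end Rows

/-! ### Generic positions -/

section Generic
variable {V : Type*} {W : Type*}

/-- The rank of the rows of the pairs in `E`. -/
def setRank (p : V → Space) (E : Set (Sym2 V)) : ℕ := finrank ℝ (rowSpan p E)

/-- The generic rank of a set of pairs. -/
def genRank (E : Set (Sym2 V)) : ℕ := ⨆ p : V → Space, setRank p E

theorem genericRank_eq (G : SimpleGraph V) : genericRank G = genRank G.edgeSet := rfl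

theorem bddAbove_setRank [Finite V] (E : Set (Sym2 V)) :
    BddAbove (Set.range fun p : V → Space => setRank p E) := by
  cases nonempty_fintype V
  refine ⟨3 * Fintype.card V, ?_⟩
  rintro _ ⟨p, rfl⟩
  have := finrank_motions_add p E
  simp only [setRank]; omega

theorem setRank_le_genRank [Finite V] (p : V → Space) (E : Set (Sym2 V)) :
    setRank p E ≤ genRank E := le_ciSup (bddAbove_setRank E) p

theorem exists_setRank_eq [Finite V] (E : Set (Sym2 V)) :
    ∃ p : V → Space, setRank p E = genRank E :=
  Nat.sSup_mem (Set.range_nonempty _) (bddAbove_setRank E)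

theorem setRank_mono [Finite V] (p : V → Space) {E E' : Set (Sym2 V)} (h : E ⊆ E') :
    setRank p E ≤ setRank p E' := finrank_mono (rowSpan_mono p h)

theorem genRank_mono [Finite V] {E E' : Set (Sym2 V)} (h : E ⊆ E') : genRank E ≤ genRank E' :=
  ciSup_mono (bddAbove_setRank E') fun p => setRank_mono p h

theorem linearIndepOn_iff_setRank [Finite V] {p : V → Space} {E : Set (Sym2 V)} :
    LinearIndepOn ℝ (rigidityRow p) E ↔ E.ncard ≤ setRank p E := by
  have := Fintype.ofFinite E
  rw [setRank, rowSpan, Set.image_eq_range, ← Nat.card_coe_set_eq, Nat.card_eq_fintype_card]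
  exact linearIndependent_iff_card_le_finrank_span

theorem setRank_le_ncard [Finite V] (p : V → Space) (E : Set (Sym2 V)) :
    setRank p E ≤ E.ncard := by
  have := Fintype.ofFinite E
  rw [setRank, rowSpan, Set.image_eq_range, ← Nat.card_coe_set_eq, Nat.card_eq_fintype_card]
  exact finrank_range_le_card _

theorem setRank_eq_ncard [Finite V] {p : V → Space} {E : Set (Sym2 V)}
    (h : LinearIndepOn ℝ (rigidityRow p) E) : setRank p E = E.ncard :=
  le_antisymm (setRank_le_ncard p E) (linearIndepOn_iff_setRank.1 h)

theorem genRank_le_ncard [Finite V] (E : Set (Sym2 V)) : genRank E ≤ E.ncard :=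
  ciSup_le fun p => setRank_le_ncard p E

theorem exists_basis_subset [Finite V] (p : V → Space) (E : Set (Sym2 V)) :
    ∃ B ⊆ E, LinearIndepOn ℝ (rigidityRow p) B ∧ rowSpan p B = rowSpan p E ∧
      B.ncard = setRank p E := by
  obtain ⟨B, hB, -, h, hli⟩ := exists_linearIndepOn_extension (K := ℝ) (v := rigidityRow p)
    (linearIndepOn_empty _ _) (Set.empty_subset E)
  have h2 : rowSpan p B = rowSpan p E :=
    le_antisymm (rowSpan_mono p hB) (span_le.2 h)
  refine ⟨B, hB, hli, h2, ?_⟩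
  rw [← setRank_eq_ncard hli, setRank, h2, setRank]

theorem isOpen_linearIndepOn {E M ι : Type*} [AddCommGroup E] [Module ℝ E]
    [TopologicalSpace E] [IsTopologicalAddGroup E] [ContinuousSMul ℝ E] [T2Space E]
    [FiniteDimensional ℝ E] [NormedAddCommGroup M] [NormedSpace ℝ M]
    (L : ι → E →ₗ[ℝ] M) (T : Set ι) (hT : T.Finite) :
    IsOpen {p : E | LinearIndepOn ℝ (fun i => L i p) T} := by
  have := hT.to_subtype
  have h : Continuous fun p : E => fun i : T => L i p :=
    continuous_pi fun i => (L i).continuous_of_finiteDimensional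
  exact isOpen_setOfPred_linearIndependent.preimage h

/-- Let the family be independent at `q`. Along the line from any `p` to `q`, a suitable determinant
is a polynomial in the parameter that equals 1 at `q`. It has finitely many zeros, so there are good
points arbitrarily near `p`. -/
theorem dense_linearIndepOn {E M ι : Type*} [AddCommGroup E] [Module ℝ E]
    [TopologicalSpace E] [IsTopologicalAddGroup E] [ContinuousSMul ℝ E]
    [AddCommGroup M] [Module ℝ M]
    (L : ι → E →ₗ[ℝ] M) (T : Set ι) (hT : T.Finite)
    (hne : ∃ q, LinearIndepOn ℝ (fun i => L i q) T) :
    Dense {p : E | LinearIndepOn ℝ (fun i => L i p) T} := by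
  obtain ⟨q, hq⟩ := hne
  have := hT.fintype
  have hb : LinearIndependent ℝ (fun i : T => L i q) := hq
  -- Functionals dual to the independent family at `q`. They turn the family at any other point into
  -- a square matrix, which is the identity at `q`.
  obtain ⟨φ, hφ⟩ : ∃ φ : M →ₗ[ℝ] (T → ℝ), ∀ i : T, φ (L i q) = Pi.single i 1 := by
    obtain ⟨g, hg⟩ := LinearMap.exists_extend hb.repr
    refine ⟨Finsupp.lcoeFun ∘ₗ g, fun i => ?_⟩
    have h1 : g (L i q) = Finsupp.single i 1 := by
      have h2 := hb.repr_eq_single i ⟨L i q, subset_span ⟨i, rfl⟩⟩ rfl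
      rw [← h2, ← hg]
      rfl
    ext1 j
    simp [h1, Finsupp.single_apply, Pi.single_apply, eq_comm]
  intro p
  let A (p : E) : Matrix T T ℝ := Matrix.of fun i j => φ (L i p) j
  let D : Polynomial ℝ := ((A p).map (Polynomial.C (R := ℝ)) +
    (Polynomial.X : Polynomial ℝ) • (A (q - p)).map (Polynomial.C (R := ℝ))).det
  have hD (t : ℝ) : D.eval t = (A (p + t • (q - p))).det := by
    rw [← Polynomial.coe_evalRingHom, RingHom.map_det]
    congr 1
    ext i j
    simp [A, mul_sub]
    ring
  have hD1 : D.eval 1 = 1 := by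
    rw [hD, one_smul, add_sub_cancel]
    have h1 : A q = 1 := by
      ext i j
      simp [A, hφ, Matrix.one_apply, Pi.single_apply, eq_comm]
    rw [h1, Matrix.det_one]
  have hA (p : E) (h : (A p).det ≠ 0) : LinearIndepOn ℝ (fun i => L i p) T := by
    have h1 := Matrix.linearIndependent_rows_iff_isUnit.2
      ((Matrix.isUnit_iff_isUnit_det _).2 (isUnit_iff_ne_zero.2 h))
    exact LinearIndependent.of_comp φ h1
  have hD0 : D ≠ 0 := by
    rintro h
    rw [h] at hD1
    simp at hD1
  have hev : ∀ᶠ t in 𝓝[≠] (0 : ℝ), D.eval t ≠ 0 := by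
    have h1 : (D.rootSet ℝ)ᶜ ∪ {0} ∈ 𝓝 (0 : ℝ) := by
      have h2 : IsOpen ((D.rootSet ℝ \ {0})ᶜ) :=
        ((D.rootSet_finite ℝ).subset Set.sdiff_subset).isClosed.isOpen_compl
      refine Filter.mem_of_superset (h2.mem_nhds (by simp)) fun t ht => ?_
      by_cases h0 : t = 0 <;> simp_all
    filter_upwards [mem_nhdsWithin_of_mem_nhds h1, self_mem_nhdsWithin] with t ht ht0
    rcases ht with ht | ht
    · simpa [Polynomial.mem_rootSet, hD0] using ht
    · exact absurd ht ht0
  refine mem_closure_of_tendsto (f := fun t : ℝ => p + t • (q - p)) (b := 𝓝[≠] (0 : ℝ)) ?_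
    (hev.mono fun t ht => hA _ (by rwa [← hD]))
  have : Continuous fun t : ℝ => p + t • (q - p) := by fun_prop
  simpa using this.continuousAt.tendsto.mono_left (nhdsWithin_le_nhds (a := (0 : ℝ)) (s := {0}ᶜ))

/-- Positions at which every set of pairs has its generic rank and the points are in general
linear position. -/
structure InGeneralPosition (p : V → Space) : Prop where
  setRank_eq : ∀ E : Set (Sym2 V), setRank p E = genRank E
  directions : ∀ (x : V) (T : Finset V), x ∉ T → T.card ≤ 3 →
    LinearIndepOn ℝ (fun y => p x - p y) (T : Set V)

theorem exists_directions {x : V} {T : Finset V} (hx : x ∉ T) (hT : T.card ≤ 3) :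
    ∃ p : V → Space, LinearIndepOn ℝ (fun y => p x - p y) (T : Set V) := by
  obtain ⟨j⟩ : Nonempty (T ↪ Fin 3) := by
    rw [Function.Embedding.nonempty_iff_card_le]; simpa using hT
  -- The points of `T` go to distinct negated basis vectors and all other points, `x` included, to
  -- the origin. The differences are then basis vectors.
  let p : V → Space := fun y => if h : y ∈ T then - EuclideanSpace.single (j ⟨y, h⟩) 1 else 0
  refine ⟨p, ?_⟩
  have h1 : LinearIndependent ℝ (fun i : Fin 3 => (EuclideanSpace.single i 1 : Space)) := by
    have := (EuclideanSpace.basisFun (Fin 3) ℝ).toBasis.linearIndependent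
    convert! this using 1
    ext i
    simp
  have h2 := h1.comp j j.injective
  have h3 : (fun y : (T : Set V) => p x - p y) =
      (fun i : Fin 3 => (EuclideanSpace.single i 1 : Space)) ∘ j := by
    ext1 y
    have : (y : V) ∈ T := y.2
    simp [p, hx, this]
  rw [← h3] at h2
  exact h2

theorem isOpen_rows [Finite V] (B : Set (Sym2 V)) :
    IsOpen {p : V → Space | LinearIndepOn ℝ (rigidityRow p) B} := by
  cases nonempty_fintype V
  have h := isOpen_setOfPred_linearIndependent (𝕜 := ℝ) (E := V → Space) (ι := B)
  have hc : Continuous fun p : V → Space => fun e : B => rigidityRow p e :=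
    continuous_pi fun e => (rowLin (e : Sym2 V)).continuous_of_finiteDimensional
  exact h.preimage hc

theorem dense_rows [Finite V] {B : Set (Sym2 V)} {q : V → Space}
    (hq : LinearIndepOn ℝ (rigidityRow q) B) :
    Dense {p : V → Space | LinearIndepOn ℝ (rigidityRow p) B} := by
  cases nonempty_fintype V
  exact dense_linearIndepOn rowLin B B.toFinite ⟨q, hq⟩

/-- The difference of two positions as a linear function of the positions. -/
def dirLin (x y : V) : (V → Space) →ₗ[ℝ] Space :=
  LinearMap.proj (R := ℝ) (φ := fun _ : V => Space) x - LinearMap.proj (φ := fun _ : V => Space) y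

theorem isOpen_directions [Finite V] (x : V) (T : Set V) :
    IsOpen {p : V → Space | LinearIndepOn ℝ (fun y => p x - p y) T} := by
  cases nonempty_fintype V
  exact isOpen_linearIndepOn (dirLin x) T T.toFinite

theorem dense_directions [Finite V] {x : V} {T : Finset V} (hx : x ∉ T) (hT : T.card ≤ 3) :
    Dense {p : V → Space | LinearIndepOn ℝ (fun y => p x - p y) (T : Set V)} := by
  cases nonempty_fintype V
  exact dense_linearIndepOn (dirLin x) T (Set.toFinite _) (exists_directions hx hT)

/-- Each condition holds on an open dense set. For a set `E` of pairs it is enough to keep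
independent the rows of a subset `B E` that is a basis at a position of maximal rank. -/
theorem dense_inGeneralPosition [Finite V] : Dense {p : V → Space | InGeneralPosition p} := by
  choose q hq using fun E : Set (Sym2 V) => exists_setRank_eq E
  choose B hB hli _ hc using fun E : Set (Sym2 V) => exists_basis_subset (q E) E
  have h1 := dense_iInter_of_isOpen (fun E => isOpen_rows (B E)) (fun E => dense_rows (hli E))
  have h2 := dense_iInter_of_isOpen
    (fun i : {i : V × Finset V // i.1 ∉ i.2 ∧ i.2.card ≤ 3} => isOpen_directions i.1.1 i.1.2)
    (fun i => dense_directions i.2.1 i.2.2)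
  refine (h1.inter_of_isOpen_left h2
    (isOpen_iInter_of_finite fun E => isOpen_rows (B E))).mono ?_
  rintro p ⟨hp1, hp2⟩
  rw [Set.mem_iInter] at hp1 hp2
  refine ⟨fun E => le_antisymm (setRank_le_genRank p E) ?_,
    fun x T hx hT => hp2 ⟨(x, T), hx, hT⟩⟩
  rw [← hq, ← hc, ← setRank_eq_ncard (hp1 E)]
  exact setRank_mono p (hB E)

theorem exists_inGeneralPosition (V : Type*) [Finite V] :
    ∃ p : V → Space, InGeneralPosition p :=
  dense_inGeneralPosition.nonempty

theorem setRank_comp_embedding [Finite V] [Finite W] (f : V ↪ W) (p : W → Space)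
    (E : Set (Sym2 V)) : setRank (p ∘ f) E = setRank p (Sym2.map f '' E) := by
  cases nonempty_fintype V
  rw [setRank, setRank, ← map_push_rowSpan]
  exact (LinearEquiv.finrank_eq (equivMapOfInjective _ (push_injective f.injective) _))

/-- Vertices outside the range meet no pair of the image, so positions on `V` may be extended
arbitrarily to `W`. -/
theorem genRank_map [Finite V] [Finite W] (f : V ↪ W) (E : Set (Sym2 V)) :
    genRank (Sym2.map f '' E) = genRank E := by
  apply le_antisymm
  · obtain ⟨p, hp⟩ := exists_setRank_eq (Sym2.map f '' E)
    rw [← hp, ← setRank_comp_embedding]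
    exact setRank_le_genRank _ _
  · obtain ⟨p, hp⟩ := exists_setRank_eq E
    have : p = Function.extend f p 0 ∘ f := by
      ext1 x; simp [f.injective.extend_apply]
    rw [← hp, this, setRank_comp_embedding]
    exact setRank_le_genRank _ _

theorem InGeneralPosition.comp [Finite V] [Finite W] (f : V ↪ W) {p : W → Space}
    (hp : InGeneralPosition p) : InGeneralPosition (p ∘ f) := by
  refine ⟨fun E => ?_, fun x T hx hT => ?_⟩
  · rw [setRank_comp_embedding, hp.setRank_eq, genRank_map]
  · have := hp.directions (f x) (T.map f) (by simpa using hx) (by simpa using hT)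
    rw [Finset.coe_map] at this
    exact this.comp_of_image f.injective.injOn

theorem InGeneralPosition.linearIndepOn_of_le [Finite V] {p : V → Space}
    (hp : InGeneralPosition p) {E : Set (Sym2 V)} (h : E.ncard ≤ genRank E) :
    LinearIndepOn ℝ (rigidityRow p) E := by
  rwa [linearIndepOn_iff_setRank, hp.setRank_eq]

theorem InGeneralPosition.linearIndepOn [Finite V] {p : V → Space}
    (hp : InGeneralPosition p) {q : V → Space} {E : Set (Sym2 V)}
    (h : LinearIndepOn ℝ (rigidityRow q) E) :
    LinearIndepOn ℝ (rigidityRow p) E :=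
  hp.linearIndepOn_of_le ((linearIndepOn_iff_setRank.1 h).trans (setRank_le_genRank q E))

theorem isGeneric_iff [Finite V] {G : SimpleGraph V} {p : V → Space} :
    IsGeneric G p ↔ setRank p G.edgeSet = genRank G.edgeSet := by
  constructor
  · intro h
    exact le_antisymm (setRank_le_genRank _ _) (ciSup_le h)
  · intro h q
    exact (setRank_le_genRank q G.edgeSet).trans h.ge

theorem isIndependent_iff_exists [Finite V] {G : SimpleGraph V} :
    IsIndependent G ↔ ∃ p, LinearIndepOn ℝ (rigidityRow p) G.edgeSet := by
  constructor
  · rintro ⟨p, -, h⟩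
    exact ⟨p, h⟩
  · rintro ⟨p, h⟩
    obtain ⟨q, hq⟩ := exists_inGeneralPosition V
    exact ⟨q, isGeneric_iff.2 (hq.setRank_eq _), hq.linearIndepOn h⟩

theorem isIndependent_iff_genRank [Finite V] {G : SimpleGraph V} :
    IsIndependent G ↔ genRank G.edgeSet = G.edgeSet.ncard := by
  rw [isIndependent_iff_exists]
  constructor
  · rintro ⟨p, h⟩
    exact le_antisymm (genRank_le_ncard _)
      ((linearIndepOn_iff_setRank.1 h).trans (setRank_le_genRank _ _))
  · intro h
    obtain ⟨q, hq⟩ := exists_inGeneralPosition V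
    exact ⟨q, hq.linearIndepOn_of_le h.ge⟩

theorem IsIndependent.linearIndepOn [Finite V] {G : SimpleGraph V} (h : IsIndependent G)
    {p : V → Space} (hp : InGeneralPosition p) : LinearIndepOn ℝ (rigidityRow p) G.edgeSet := by
  obtain ⟨q, hq⟩ := isIndependent_iff_exists.1 h
  exact hp.linearIndepOn hq

end Generic

/-! ### Trivial motions -/

/-- The cross product of two vectors of three-space. -/
def cross : Space →ₗ[ℝ] Space →ₗ[ℝ] Space :=
  LinearMap.mk₂ ℝ (fun x y => WithLp.toLp 2 (crossProduct x.ofLp y.ofLp))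
    (fun x x' y => by simp) (fun c x y => by simp) (fun x y y' => by simp) (fun c x y => by simp)

theorem cross_apply' (x y : Space) :
    cross x y = !₂[x 1 * y 2 - x 2 * y 1, x 2 * y 0 - x 0 * y 2, x 0 * y 1 - x 1 * y 0] := by
  change WithLp.toLp 2 (crossProduct x.ofLp y.ofLp) = _
  rw [cross_apply]

theorem inner_cross_self (w x : Space) : ⟪x, cross w x⟫ = 0 := by
  simp only [cross_apply', PiLp.inner_apply, Fin.sum_univ_three]
  simp
  ring

theorem linearDependent_of_cross_eq_zero {w x y : Space} (hw : w ≠ 0) (hx : cross w x = 0)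
    (hy : cross w y = 0) : ¬ LinearIndependent ℝ ![x, y] := by
  have key : ∀ z : Space, cross w z = 0 → ∃ c : ℝ, z = c • w := by
    intro z hz
    by_contra h
    have h1 : LinearIndependent ℝ ![w, z] := by
      rw [LinearIndependent.pair_iff' hw]
      exact fun a ha => h ⟨a, ha.symm⟩
    have h2 : LinearIndependent ℝ ![w.ofLp, z.ofLp] := by
      have := h1.map' (WithLp.linearEquiv 2 ℝ (Fin 3 → ℝ)).toLinearMap (LinearEquiv.ker _)
      convert! this using 1
      ext i
      fin_cases i <;> rfl
    have h3 := crossProduct_ne_zero_iff_linearIndependent.2 h2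
    exact h3 (congrArg WithLp.ofLp hz)
  obtain ⟨a, rfl⟩ := key x hx
  obtain ⟨b, rfl⟩ := key y hy
  intro h
  rw [LinearIndependent.pair_iff] at h
  have h1 := h b (-a) (by module)
  have h2 := h 1 0 (by simp [neg_eq_zero.1 h1.2])
  simp at h2

theorem exists_cross_of_skew {B : Space →ₗ[ℝ] Space} (hB : ∀ x, ⟪x, B x⟫ = 0) :
    ∃ w, ∀ x, B x = cross w x := by
  have hpol (x y : Space) : ⟪x, B y⟫ = - ⟪y, B x⟫ := by
    have := hB (x + y)
    rw [map_add, inner_add_left, inner_add_right, inner_add_right, hB, hB] at this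
    linarith
  let e (i : Fin 3) : Space := EuclideanSpace.single i 1
  have he (i : Fin 3) (x : Space) : ⟪e i, x⟫ = x i := by
    simp [e, EuclideanSpace.inner_single_left]
  have hanti (i j : Fin 3) : B (e j) i = - B (e i) j := by
    rw [← he, ← he, hpol]
  have hdiag (i : Fin 3) : B (e i) i = 0 := by rw [← he, hB]
  -- The three independent entries of a skew matrix, in the order in which they appear in the matrix
  -- of `w × ·`.
  refine ⟨!₂[B (e 1) 2, B (e 2) 0, B (e 0) 1], fun x => ?_⟩
  have hx : x = x 0 • e 0 + x 1 • e 1 + x 2 • e 2 := by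
    ext i
    fin_cases i <;> simp [e]
  have h01 := hanti 0 1
  have h02 := hanti 0 2
  have h12 := hanti 1 2
  have h0 := hdiag 0
  have h1 := hdiag 1
  have h2 := hdiag 2
  have hBx : B x = x 0 • B (e 0) + x 1 • B (e 1) + x 2 • B (e 2) := by
    conv_lhs => rw [hx]
    simp
  rw [hBx, cross_apply']
  ext i
  fin_cases i
  · simp
    linear_combination x 0 * h0 + x 1 * h01
  · simp
    linear_combination x 1 * h1 + x 2 * h12
  · simp
    linear_combination x 0 * h02 + x 2 * h2

section Trivial
variable {V : Type*}

/-- The velocities `x ↦ w × p x + c` of a rigid motion of space. -/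
def trivialMotion (p : V → Space) : (Space × Space) →ₗ[ℝ] (V → Space) where
  toFun a x := cross a.1 (p x) + a.2
  map_add' a b := by
    ext1 x
    simp
    abel
  map_smul' c a := by
    ext1 x
    simp

theorem trivialMotion_apply (p : V → Space) (a : Space × Space) (x : V) :
    trivialMotion p a x = cross a.1 (p x) + a.2 := rfl

theorem trivialMotion_mem_motions (p : V → Space) (E : Set (Sym2 V)) (a : Space × Space) :
    trivialMotion p a ∈ motions p E := by
  intro x y _
  rw [trivialMotion_apply, trivialMotion_apply, add_sub_add_right_eq_sub, ← map_sub,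
    inner_cross_self]

theorem trivialMotion_injective {p : V → Space} {x y z : V}
    (h : LinearIndependent ℝ ![p x - p y, p x - p z]) :
    Function.Injective (trivialMotion p) := by
  rw [← LinearMap.ker_eq_bot, LinearMap.ker_eq_bot']
  rintro ⟨w, c⟩ hwc
  have h0 (z : V) : cross w (p z) + c = 0 := congrFun hwc z
  have h1 (t : V) : cross w (p x - p t) = 0 := by
    rw [map_sub, sub_eq_zero]
    exact add_right_cancel ((h0 x).trans (h0 t).symm)
  have hw : w = 0 := by
    by_contra hw
    exact linearDependent_of_cross_eq_zero hw (h1 y) (h1 z) h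
  subst hw
  have := h0 x
  simp_all

theorem InGeneralPosition.linearIndependent_pair {p : V → Space} (hp : InGeneralPosition p)
    {x y z : V} (hxy : x ≠ y) (hxz : x ≠ z) (hyz : y ≠ z) :
    LinearIndependent ℝ ![p x - p y, p x - p z] := by
  have h := hp.directions x {y, z} (by simp [hxy, hxz]) (by rw [Finset.card_pair hyz]; norm_num)
  have h2 := LinearIndependent.comp (ι := ((({y, z} : Finset V) : Set V) : Type _)) h
    ![⟨y, by simp⟩, ⟨z, by simp⟩] (by
      intro i j
      fin_cases i <;> fin_cases j <;> simp [hyz, hyz.symm])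
  convert! h2 using 1
  ext1 i
  fin_cases i <;> rfl

/-- Three non-collinear points make the six-dimensional space of rotations and translations act
faithfully, and these velocities are always motions. -/
theorem genRank_add_six_le [Finite V] (h3 : 3 ≤ Nat.card V) (E : Set (Sym2 V)) :
    genRank E + 6 ≤ 3 * Nat.card V := by
  cases nonempty_fintype V
  obtain ⟨p, hp⟩ := exists_inGeneralPosition V
  rw [Nat.card_eq_fintype_card] at h3 ⊢
  obtain ⟨x, y, z, hxy, hxz, hyz⟩ := Fintype.two_lt_card_iff.1 h3
  have h1 := LinearMap.finrank_range_of_inj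
    (trivialMotion_injective (hp.linearIndependent_pair hxy hxz hyz))
  have h2 : LinearMap.range (trivialMotion p) ≤ motions p E := by
    rintro _ ⟨a, rfl⟩
    exact trivialMotion_mem_motions p E a
  have h4 := finrank_mono h2
  have h5 := finrank_motions_add p E
  have h6 : finrank ℝ (Space × Space) = 6 := by simp
  rw [← hp.setRank_eq, setRank]
  omega

theorem exists_linearMap_of_dependences {ι M : Type*} [Fintype ι] [AddCommGroup M] [Module ℝ M]
    {N : Type*} [AddCommGroup N] [Module ℝ N] (u : ι → M) (n : ι → N)
    (h : ∀ c : ι → ℝ, ∑ i, c i • u i = 0 → ∑ i, c i • n i = 0) :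
    ∃ B : M →ₗ[ℝ] N, ∀ i, B (u i) = n i := by
  let f := Fintype.linearCombination ℝ u
  let g := Fintype.linearCombination ℝ n
  have hfg : LinearMap.ker f ≤ LinearMap.ker g := fun c hc => h c hc
  obtain ⟨B, hB⟩ := LinearMap.exists_extend
    ((LinearMap.ker f).liftQ g hfg ∘ₗ f.quotKerEquivRange.symm.toLinearMap)
  refine ⟨B, fun i => ?_⟩
  have h1 : f (Pi.single i 1) = u i := by simp [f]
  have h2 : g (Pi.single i 1) = n i := by simp [g]
  have h3 := LinearMap.congr_fun hB ⟨f (Pi.single i 1), LinearMap.mem_range_self _ _⟩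
  rw [← h2, ← h1]
  refine h3.trans ?_
  rw [LinearMap.comp_apply, LinearEquiv.coe_coe, LinearMap.quotKerEquivRange_symm_apply_image]
  rfl

/-- Skewness on the span of the points is all that lengths can give; when the points are flat, the
map must still be completed to a skew map of the whole space. -/
theorem exists_skew_extension (U : Submodule ℝ Space) (B : Space →ₗ[ℝ] Space)
    (hB : ∀ x ∈ U, ⟪x, B x⟫ = 0) :
    ∃ B' : Space →ₗ[ℝ] Space, (∀ x ∈ U, B' x = B x) ∧ ∀ x, ⟪x, B' x⟫ = 0 := by
  let P : Space →ₗ[ℝ] Space := U.starProjection.toLinearMap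
  have hP (x : Space) : P x ∈ U := U.starProjection_apply_mem x
  have hPs (x y : Space) : ⟪x, P y⟫ = ⟪P x, y⟫ :=
    (U.inner_starProjection_left_eq_right x y).symm
  have hPU (x : Space) (hx : x ∈ U) : P x = x := Submodule.starProjection_eq_self_iff.2 hx
  -- On `U` the second term vanishes. For any `x`, moving the projection and the adjoint across the
  -- inner product leaves ⟪P x, B (P x)⟫, which is zero.
  refine ⟨B ∘ₗ P - P ∘ₗ B.adjoint ∘ₗ (LinearMap.id - P), fun x hx => ?_, fun x => ?_⟩
  · simp [hPU x hx]
  · simp only [LinearMap.sub_apply, LinearMap.comp_apply, LinearMap.id_apply, inner_sub_right]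
    rw [hPs x (B.adjoint _), LinearMap.adjoint_inner_right, inner_sub_right,
      real_inner_comm x (B (P x)), real_inner_comm (P x) (B (P x)), hB _ (hP x)]
    ring

/-- Orthogonality alone is not sufficient for flat configurations: points of a plane may move
independently in the normal direction. Respecting affine dependences makes the relative velocities a
linear function of the relative positions. That function is skew on their span, so it extends to a
cross product. -/
theorem exists_eq_trivialMotion [Fintype V] (p m : V → Space)
    (hpm : ∀ x y, ⟪p x - p y, m x - m y⟫ = 0)
    (hdep : ∀ c : V → ℝ, ∑ x, c x = 0 → ∑ x, c x • p x = 0 → ∑ x, c x • m x = 0) :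
    ∃ a, m = trivialMotion p a := by
  rcases isEmpty_or_nonempty V with hV | ⟨⟨o⟩⟩
  · exact ⟨0, Subsingleton.elim _ _⟩
  obtain ⟨B, hB⟩ := exists_linearMap_of_dependences (fun x => p x - p o) (fun x => m x - m o) (by
    intro c hc
    -- Giving the base point `o` the weight -∑ c turns a linear dependence of differences into an
    -- affine dependence.
    have key : ∀ f : V → Space, ∑ x, c x • (f x - f o) =
        ∑ x, (c x - if x = o then ∑ y, c y else 0) • f x := by
      intro f
      simp [smul_sub, sub_smul, Finset.sum_sub_distrib, ← Finset.sum_smul, ite_smul]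
    rw [key] at hc ⊢
    exact hdep _ (by simp) hc)
  have hskew : ∀ v ∈ span ℝ (Set.range fun x => p x - p o), ⟪v, B v⟫ = 0 := by
    have h2 : ∀ x y, ⟪p x - p o, m y - m o⟫ + ⟪p y - p o, m x - m o⟫ = 0 := by
      intro x y
      have h : ⟪(p x - p o) - (p y - p o), (m x - m o) - (m y - m o)⟫ = 0 := by
        simpa using hpm x y
      have hx := hpm x o
      have hy := hpm y o
      rw [inner_sub_left, inner_sub_right (p x - p o), inner_sub_right (p y - p o)] at h
      linarith
    intro v hv
    rw [mem_span_range_iff_exists_fun] at hv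
    obtain ⟨c, rfl⟩ := hv
    simp only [map_sum, map_smul, hB, sum_inner, inner_sum, inner_smul_left, inner_smul_right]
    have h3 : ∑ x, ∑ y, (c x * (c y * ⟪p y - p o, m x - m o⟫)) =
        - ∑ x, ∑ y, (c x * (c y * ⟪p y - p o, m x - m o⟫)) := by
      conv_lhs => rw [Finset.sum_comm]
      rw [← Finset.sum_neg_distrib]
      refine Finset.sum_congr rfl fun x _ => ?_
      rw [← Finset.sum_neg_distrib]
      refine Finset.sum_congr rfl fun y _ => ?_
      linear_combination (c x * c y) * h2 x y
    simp only [RCLike.conj_to_real, Finset.mul_sum]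
    linarith
  obtain ⟨B', hB', hs⟩ := exists_skew_extension _ B hskew
  obtain ⟨w, hw⟩ := exists_cross_of_skew hs
  refine ⟨(w, m o - cross w (p o)), ?_⟩
  ext1 x
  have h1 := hB' (p x - p o) (subset_span ⟨x, rfl⟩)
  rw [hB, hw, map_sub] at h1
  rw [eq_comm, sub_eq_iff_eq_add] at h1
  rw [trivialMotion_apply, h1, sub_add_eq_add_sub, add_sub_assoc]

end Trivial

/-! ### Rigidity and rank -/

section Rigidity
variable {V : Type*}

theorem motions_mono (p : V → Space) {E E' : Set (Sym2 V)} (h : E ⊆ E') :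
    motions p E' ≤ motions p E := fun _ hm x y he => hm x y (h he)

theorem motions_eq_of_rowSpan_eq [Fintype V] {p : V → Space} {E E' : Set (Sym2 V)}
    (h : rowSpan p E = rowSpan p E') : motions p E = motions p E' := by
  rw [motions_eq_orthogonal, motions_eq_orthogonal, h]

theorem norm_sub_sq_sub_norm_sub_sq (a b c d : Space) :
    ‖a - b‖ ^ 2 - ‖c - d‖ ^ 2 = ⟪(a + c) - (b + d), (a - c) - (b - d)⟫ := by
  rw [← real_inner_self_eq_norm_sq, ← real_inner_self_eq_norm_sq]
  have h1 : (a + c) - (b + d) = (a - b) + (c - d) := by abel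
  have h2 : (a - c) - (b - d) = (a - b) - (c - d) := by abel
  rw [h1, h2]
  generalize a - b = u
  generalize c - d = v
  rw [inner_add_left, inner_sub_right, inner_sub_right, real_inner_comm u v]
  ring

/-- Averaging argument: if `q` and `p` have equal edge lengths, then `q - p` is an infinitesimal
motion of the midpoint framework. Near `p` the midpoint framework still has full rank, so its
motions preserve every pair, and the same identity read backwards gives that all distances agree. -/
theorem isRigidFramework_of_rank [Finite V] {G : SimpleGraph V} {p : V → Space}
    (h3 : 3 ≤ Nat.card V) (hp : 3 * Nat.card V ≤ setRank p G.edgeSet + 6) :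
    IsRigidFramework G p := by
  cases nonempty_fintype V
  obtain ⟨B, hB, hli, hspan, hcard⟩ := exists_basis_subset p G.edgeSet
  have hcont : Continuous fun q : V → Space => (2⁻¹ : ℝ) • (q + p) := by fun_prop
  have hev : ∀ᶠ q in 𝓝 p, LinearIndepOn ℝ (rigidityRow ((2⁻¹ : ℝ) • (q + p))) B := by
    refine hcont.continuousAt.eventually (p := fun q => LinearIndepOn ℝ (rigidityRow q) B)
      ((isOpen_rows B).mem_nhds ?_)
    have : (2⁻¹ : ℝ) • (p + p) = p := by module
    change LinearIndepOn ℝ (rigidityRow ((2⁻¹ : ℝ) • (p + p))) B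
    rw [this]
    exact hli
  filter_upwards [hev] with q hq hlen
  set r : V → Space := (2⁻¹ : ℝ) • (q + p) with hr
  have hrank : 3 * Nat.card V ≤ setRank r G.edgeSet + 6 := by
    have h1 := setRank_mono r hB
    have h2 := setRank_eq_ncard hq
    omega
  have hfull : motions r Set.univ = motions r G.edgeSet := by
    refine eq_of_le_of_finrank_le (motions_mono r (Set.subset_univ _)) ?_
    have h1 := finrank_motions_add r G.edgeSet
    have h2 := finrank_motions_add r (Set.univ : Set (Sym2 V))
    have h4 := genRank_add_six_le h3 (Set.univ : Set (Sym2 V))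
    have h5 := setRank_le_genRank r (Set.univ : Set (Sym2 V))
    rw [Nat.card_eq_fintype_card] at *
    rw [setRank] at hrank h5
    omega
  have key (x y : V) : ⟪r x - r y, (q - p) x - (q - p) y⟫ =
      2⁻¹ * (‖q x - q y‖ ^ 2 - ‖p x - p y‖ ^ 2) := by
    rw [norm_sub_sq_sub_norm_sub_sq, hr]
    simp only [Pi.smul_apply, Pi.add_apply, Pi.sub_apply]
    rw [← smul_sub, inner_smul_left]
    simp
  have hm : q - p ∈ motions r Set.univ := by
    rw [hfull]
    intro x y he
    have h1 := hlen x y he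
    rw [dist_eq_norm, dist_eq_norm] at h1
    rw [key, h1, sub_self, mul_zero]
  intro x y
  have h1 := hm x y (Set.mem_univ _)
  rw [key] at h1
  rw [dist_eq_norm, dist_eq_norm, ← sq_eq_sq₀ (norm_nonneg _) (norm_nonneg _)]
  linarith

/-- For weights of sum zero, the squared norm of ∑ c x • p x depends only on the pairwise distances.
-/
theorem sum_smul_eq_zero_of_congruent [Fintype V] {p q : V → Space}
    (h : ∀ x y, dist (q x) (q y) = dist (p x) (p y)) {c : V → ℝ} (hc : ∑ x, c x = 0)
    (hp : ∑ x, c x • p x = 0) : ∑ x, c x • q x = 0 := by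
  have key (r : V → Space) : ⟪∑ x, c x • r x, ∑ x, c x • r x⟫ =
      (-∑ x, ∑ y, c x * c y * (dist (r x) (r y) * dist (r x) (r y))) / 2 := by
    have := EuclideanGeometry.inner_weightedVSub (P := Space) (V := Space) (s₁ := Finset.univ)
      (s₂ := Finset.univ) (w₁ := c) (w₂ := c) r hc r hc
    rwa [Finset.weightedVSub_eq_linear_combination _ hc] at this
  have h1 := key q
  simp only [h] at h1
  rw [← key p, hp, inner_zero_left] at h1
  exact inner_self_eq_zero.1 h1

/-- The function is the squared length of the pair, written through the row so that its derivative
is twice that row. -/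
theorem hasFDerivAt_work_rigidityRow [Fintype V] (e : Sym2 V) (q : V → Space) :
    HasFDerivAt (fun q => work (rigidityRow q e) q)
      (LinearMap.toContinuousLinearMap ((2 : ℝ) • work (rigidityRow q e))) q := by
  induction e with | _ x y =>
  simp only [work_rigidityRow]
  have hx := hasFDerivAt_apply (𝕜 := ℝ) x q
  have hy := hasFDerivAt_apply (𝕜 := ℝ) y q
  refine ((hx.sub hy).inner ℝ (hx.sub hy)).congr_fderiv ?_
  ext m
  simp [work_rigidityRow, real_inner_comm (q x - q y), two_mul]

theorem contDiff_work_rigidityRow [Fintype V] (e : Sym2 V) :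
    ContDiff ℝ 1 (fun q : V → Space => work (rigidityRow q e) q) := by
  induction e with | _ x y =>
  simp only [work_rigidityRow]
  exact ((contDiff_apply ℝ Space x).sub (contDiff_apply ℝ Space y)).inner ℝ
    ((contDiff_apply ℝ Space x).sub (contDiff_apply ℝ Space y))

/-- Near a position of maximal rank every infinitesimal motion is the initial velocity of a
continuous motion that keeps the lengths. -/
theorem exists_flex [Fintype V] {p m : V → Space} {E : Set (Sym2 V)}
    (hp : setRank p E = genRank E) (hm : m ∈ motions p E) :
    ∃ q : ℝ → V → Space, q 0 = p ∧ HasDerivAt q m 0 ∧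
      ∀ᶠ t in 𝓝 (0 : ℝ), ∀ x y, s(x, y) ∈ E → dist (q t x) (q t y) = dist (p x) (p y) := by
  obtain ⟨B, hB, hli, hspan, hcard⟩ := exists_basis_subset p E
  have hBfin : Fintype B := Fintype.ofFinite B
  obtain ⟨π, hπ⟩ := LinearMap.exists_leftInverse_of_injective (motions p E).subtype
    (ker_subtype _)
  have hπ' (k : motions p E) : π k = k := LinearMap.congr_fun hπ k
  -- The derivative of the chart `Φ` below. At `p` its kernel is trivial: the first component leaves
  -- only motions, and `π` is the identity on these.
  let D (q : V → Space) : (V → Space) →ₗ[ℝ] (B → ℝ) × motions p E :=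
    (LinearMap.pi fun e : B => (2 : ℝ) • (work (rigidityRow q e))).prod π
  have hDinj : Function.Injective (D p) := by
    rw [← LinearMap.ker_eq_bot, LinearMap.ker_eq_bot']
    intro k hk
    have h1 : k ∈ motions p E := by
      rw [← motions_eq_of_rowSpan_eq hspan]
      intro x y he
      have := congrFun (congrArg Prod.fst hk) ⟨s(x, y), he⟩
      simpa [D, work_rigidityRow] using this
    have h2 : π k = 0 := congrArg Prod.snd hk
    have h3 := hπ' ⟨k, h1⟩
    rw [h2] at h3
    exact (congrArg Subtype.val h3).symm
  have hdim : finrank ℝ (V → Space) = finrank ℝ ((B → ℝ) × motions p E) := by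
    have h1 := finrank_motions_add p E
    rw [finrank_prod, finrank_pi_fintype, finrank_pi_fintype]
    rw [setRank] at hcard
    simp
    omega
  let Φ' : (V → Space) ≃L[ℝ] (B → ℝ) × motions p E :=
    (LinearEquiv.ofInjectiveOfFinrankEq (D p) hDinj hdim).toContinuousLinearEquiv
  let Φ (q : V → Space) : (B → ℝ) × motions p E := (fun e => work (rigidityRow q e) q, π q)
  have hΦ' : HasFDerivAt Φ (Φ' : (V → Space) →L[ℝ] (B → ℝ) × motions p E) p := by
    have h1 := (hasFDerivAt_pi.2 fun e : B => hasFDerivAt_work_rigidityRow (e : Sym2 V) p).prodMk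
      (LinearMap.toContinuousLinearMap π).hasFDerivAt
    refine h1.congr_fderiv ?_
    ext m : 1
    rfl
  have hΦ : ContDiffAt ℝ 1 Φ p :=
    ((contDiff_pi.2 fun e : B => contDiff_work_rigidityRow (e : Sym2 V)).prodMk
      (LinearMap.toContinuousLinearMap π).contDiff).contDiffAt
  let Ψ := hΦ.localInverse hΦ' one_ne_zero
  have hΨ : ContDiffAt ℝ 1 Ψ (Φ p) := hΦ.to_localInverse hΦ' one_ne_zero
  have hs := hΦ.hasStrictFDerivAt' hΦ' one_ne_zero
  have hΨp : Ψ (Φ p) = p := hs.localInverse_apply_image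
  have hΨr : ∀ᶠ z in 𝓝 (Φ p), Φ (Ψ z) = z := hs.eventually_right_inverse
  have hΨ' : HasFDerivAt Ψ (Φ'.symm : (B → ℝ) × motions p E →L[ℝ] (V → Space)) (Φ p) :=
    hs.to_localInverse.hasFDerivAt
  -- In the chart, the lengths of the basis pairs stay fixed and the second coordinate moves in the
  -- direction `m`.
  let l (t : ℝ) : (B → ℝ) × motions p E := Φ p + t • (0, ⟨m, hm⟩)
  have hl0 : l 0 = Φ p := by simp [l]
  have hlc : ContDiff ℝ 1 l := contDiff_const.add (contDiff_id.smul contDiff_const)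
  have hld : HasDerivAt l (0, ⟨m, hm⟩) 0 := by
    have h1 := ((hasDerivAt_id (0 : ℝ)).smul_const
      ((0, ⟨m, hm⟩) : (B → ℝ) × motions p E)).const_add (Φ p)
    rw [one_smul] at h1
    exact h1
  have hlt : Filter.Tendsto l (𝓝 0) (𝓝 (Φ p)) := by
    rw [← hl0]; exact hlc.continuous.continuousAt
  have hΦm : Φ' m = (0, ⟨m, hm⟩) := by
    refine Prod.ext ?_ (hπ' ⟨m, hm⟩)
    ext1 e
    obtain ⟨e, he⟩ := e
    induction e with | _ x y =>
    change (2 : ℝ) * work (rigidityRow p s(x, y)) m = 0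
    rw [work_rigidityRow, hm x y (hB he), mul_zero]
  have hqd : HasDerivAt (Ψ ∘ l) m 0 := by
    rw [← hl0] at hΨ'
    have := hΨ'.comp_hasDerivAt 0 hld
    rw [← hΦm] at this
    simpa using this
  have hqc : ContDiffAt ℝ 1 (Ψ ∘ l) 0 := by
    rw [← hl0] at hΨ
    exact hΨ.comp 0 hlc.contDiffAt
  have hq0 : (Ψ ∘ l) 0 = p := by rw [Function.comp, hl0, hΨp]
  refine ⟨Ψ ∘ l, hq0, hqd, ?_⟩
  have hqt : Filter.Tendsto (Ψ ∘ l) (𝓝 0) (𝓝 p) := by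
    have := hqd.continuousAt.tendsto
    rwa [hq0] at this
  have hdiff : ∀ᶠ t in 𝓝 (0 : ℝ), DifferentiableAt ℝ (Ψ ∘ l) t :=
    (hqc.eventually (by simp)).mono fun t ht => ht.differentiableAt one_ne_zero
  have hfib : ∀ᶠ t in 𝓝 (0 : ℝ), Φ ((Ψ ∘ l) t) = l t := hlt.eventually hΨr
  have hLI : ∀ᶠ t in 𝓝 (0 : ℝ), LinearIndepOn ℝ (rigidityRow ((Ψ ∘ l) t)) B :=
    hqt.eventually ((isOpen_rows B).mem_nhds hli)
  generalize Ψ ∘ l = q at hdiff hfib hLI hq0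
  obtain ⟨ε, hε, hball⟩ := Metric.eventually_nhds_iff_ball.1
    (hdiff.and (hfib.eventually_nhds.and hLI))
  filter_upwards [Metric.ball_mem_nhds 0 hε] with t ht x y hxy
  have hderiv (e : Sym2 V) (s : ℝ) (hs : s ∈ Metric.ball 0 ε) :
      HasDerivAt (fun t => work (rigidityRow (q t) e) (q t))
        (2 * work (rigidityRow (q s) e) (deriv q s)) s :=
    (hasFDerivAt_work_rigidityRow e (q s)).comp_hasDerivAt s (hball s hs).1.hasDerivAt
  -- `B` stays independent near `p` and the rank of `E` cannot exceed its generic value, so `B`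
  -- still spans all rows of `E`. Keeping the lengths of `B` therefore forces the velocity to be a
  -- motion for all of `E`.
  have hmot (s : ℝ) (hs : s ∈ Metric.ball 0 ε) : deriv q s ∈ motions (q s) E := by
    obtain ⟨-, h2, h3⟩ := hball s hs
    have h4 : rowSpan (q s) B = rowSpan (q s) E := by
      refine eq_of_le_of_finrank_le (rowSpan_mono _ hB) ?_
      have h5 := setRank_eq_ncard h3
      have h6 := setRank_le_genRank (q s) E
      rw [setRank] at h5 h6
      omega
    rw [← motions_eq_of_rowSpan_eq h4]
    intro x y he
    have h5 : (fun t => work (rigidityRow (q t) s(x, y)) (q t)) =ᶠ[𝓝 s]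
        fun _ => work (rigidityRow p s(x, y)) p := by
      filter_upwards [h2] with t ht
      have := congrFun (congrArg Prod.fst ht) ⟨s(x, y), he⟩
      simpa [Φ, l] using this
    have h6 := (hderiv s(x, y) s hs).unique ((hasDerivAt_const s _).congr_of_eventuallyEq h5)
    rw [work_rigidityRow] at h6
    linarith
  have h1 := Metric.isOpen_ball.is_const_of_deriv_eq_zero
    (convex_ball (0 : ℝ) ε).isPreconnected
    (f := fun t => work (rigidityRow (q t) s(x, y)) (q t))
    (fun s hs => (hderiv s(x, y) s hs).differentiableAt.differentiableWithinAt)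
    (fun s hs => by
      rw [(hderiv s(x, y) s hs).deriv, work_rigidityRow, hmot s hs x y hxy]
      simp) ht (Metric.mem_ball_self hε)
  simp only [work_rigidityRow, hq0, real_inner_self_eq_norm_sq] at h1
  rw [dist_eq_norm, dist_eq_norm]
  exact (sq_eq_sq₀ (norm_nonneg _) (norm_nonneg _)).1 h1

/-- At a generic position every infinitesimal motion is the velocity of a flex. Rigidity makes the
flex a congruence, so the velocity is that of a rigid motion and the space of motions has dimension
at most six. The converse is `isRigidFramework_of_rank`. -/
theorem isRigid_iff [Finite V] {G : SimpleGraph V} (h3 : 3 ≤ Nat.card V) :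
    IsRigid G ↔ genRank G.edgeSet + 6 = 3 * Nat.card V := by
  cases nonempty_fintype V
  constructor
  · rintro ⟨p, hp, hrig⟩
    rw [isGeneric_iff] at hp
    have h1 : motions p G.edgeSet ≤ LinearMap.range (trivialMotion p) := by
      intro m hm
      obtain ⟨q, hq0, hq, hlen⟩ := exists_flex hp hm
      have hcongr : ∀ᶠ t in 𝓝 (0 : ℝ), ∀ x y, dist (q t x) (q t y) = dist (p x) (p y) := by
        have h1 : Filter.Tendsto q (𝓝 0) (𝓝 p) := by
          have := hq.continuousAt.tendsto
          rwa [hq0] at this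
        filter_upwards [h1.eventually hrig, hlen] with t h2 h4
        exact h2 fun x y h => h4 x y h
      have hpm (x y : V) : ⟪p x - p y, m x - m y⟫ = 0 := by
        have h2 := (hasFDerivAt_work_rigidityRow s(x, y) (q 0)).comp_hasDerivAt 0 hq
        have h4 : (fun t => work (rigidityRow (q t) s(x, y)) (q t)) =ᶠ[𝓝 0]
            fun _ => ‖p x - p y‖ ^ 2 := by
          filter_upwards [hcongr] with t ht
          have := ht x y
          rw [dist_eq_norm, dist_eq_norm] at this
          rw [work_rigidityRow, real_inner_self_eq_norm_sq, this]
        have h5 := h2.unique ((hasDerivAt_const (0 : ℝ) _).congr_of_eventuallyEq h4)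
        have h6 : 2 * work (rigidityRow (q 0) s(x, y)) m = 0 := h5
        rw [hq0, work_rigidityRow] at h6
        linarith
      have hdep (c : V → ℝ) (hc : ∑ x, c x = 0) (hcp : ∑ x, c x • p x = 0) :
          ∑ x, c x • m x = 0 := by
        have h2 : HasDerivAt (fun t => ∑ x, c x • q t x) (∑ x, c x • m x) 0 :=
          HasDerivAt.fun_sum fun x _ => (hasDerivAt_pi.1 hq x).const_smul (c x)
        have h4 : (fun t => ∑ x, c x • q t x) =ᶠ[𝓝 0] fun _ => 0 := by
          filter_upwards [hcongr] with t ht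
          exact sum_smul_eq_zero_of_congruent ht hc hcp
        exact h2.unique ((hasDerivAt_const (0 : ℝ) (0 : Space)).congr_of_eventuallyEq h4)
      obtain ⟨a, rfl⟩ := exists_eq_trivialMotion p m hpm hdep
      exact ⟨a, rfl⟩
    have h2 := finrank_mono h1
    have h4 := LinearMap.finrank_range_le (trivialMotion p)
    have h5 : finrank ℝ (Space × Space) = 6 := by simp
    have h6 := finrank_motions_add p G.edgeSet
    have h7 := genRank_add_six_le h3 G.edgeSet
    rw [Nat.card_eq_fintype_card] at *
    rw [setRank] at hp
    omega
  · intro h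
    obtain ⟨p, hp⟩ := exists_inGeneralPosition V
    refine ⟨p, isGeneric_iff.2 (hp.setRank_eq _), isRigidFramework_of_rank h3 ?_⟩
    rw [hp.setRank_eq, h]

end Rigidity

/-! ### Independent sets of pairs -/

section Independence
variable {V : Type*} {W : Type*}

/-- Independence of the images makes `f` injective on the span. -/
theorem eq_zero_of_mem_span_of_linearIndepOn {ι M N : Type*} [AddCommGroup M] [Module ℝ M]
    [AddCommGroup N] [Module ℝ N] {f : M →ₗ[ℝ] N} {g : ι → M} {s : Set ι}
    (h : LinearIndepOn ℝ (fun i => f (g i)) s) {x : M} (hx : x ∈ span ℝ (g '' s))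
    (hf : f x = 0) : x = 0 := by
  have h1 : LinearIndependent ℝ (f ∘ fun i : s => g i) := h
  rw [Set.image_eq_range] at hx
  exact (Submodule.disjoint_def.1 (Submodule.range_ker_disjoint h1)) x hx hf

/-- The pairs of distinct elements of `T`. -/
def pairsIn (T : Set V) : Set (Sym2 V) := {e | ¬ e.IsDiag ∧ ∀ x ∈ e, x ∈ T}

theorem mk_mem_pairsIn {T : Set V} {x y : V} : s(x, y) ∈ pairsIn T ↔ x ≠ y ∧ x ∈ T ∧ y ∈ T := by
  simp [pairsIn]

theorem work_trivialMotion_eq_zero [Fintype V] {p : V → Space} {E : Set (Sym2 V)} {F : V → Space}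
    (hF : F ∈ rowSpan p E) (a : Space × Space) : work F (trivialMotion p a) = 0 :=
  (mem_rowSpan_iff p E F).1 hF _ (trivialMotion_mem_motions p E a)

theorem InGeneralPosition.eq_zero_of_dependence {p : V → Space}
    (hp : InGeneralPosition p) {T : Finset V} (hT : T.card ≤ 4) {c : V → ℝ}
    (h1 : ∑ x ∈ T, c x = 0) (h2 : ∑ x ∈ T, c x • p x = 0) : ∀ x ∈ T, c x = 0 := by
  have key : ∀ x ∈ T, ∀ y ∈ T.erase x, c y = 0 := by
    intro x hx
    have h3 := hp.directions x (T.erase x) (by simp) (by rw [Finset.card_erase_of_mem hx]; omega)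
    refine linearIndepOn_finset_iff.1 h3 c ?_
    have h4 : ∑ y ∈ T, c y • (p x - p y) = 0 := by
      simp [smul_sub, ← Finset.sum_smul, h1, h2]
    rw [← Finset.add_sum_erase _ _ hx] at h4
    simpa using h4
  intro x hx
  rw [← Finset.add_sum_erase _ _ hx, Finset.sum_eq_zero (key x hx), add_zero] at h1
  exact h1

/-- A load in equilibrium on at most three points is resolved by the bars between them. -/
theorem mem_rowSpan_pairsIn [Fintype V] {p : V → Space} (hp : InGeneralPosition p)
    {T : Finset V} (hT : T.card ≤ 4) {F : V → Space} (hF : ∀ z ∉ T, F z = 0)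
    (heq : ∀ a, work F (trivialMotion p a) = 0) : F ∈ rowSpan p (pairsIn (T : Set V)) := by
  rw [mem_rowSpan_iff]
  intro m hm
  obtain ⟨a, ha⟩ := exists_eq_trivialMotion (fun x : T => p x) (fun x : T => m x)
    (fun x y => by
      by_cases hxy : x = y
      · simp [hxy]
      · exact hm x y (mk_mem_pairsIn.2 ⟨fun h => hxy (Subtype.ext h), x.2, y.2⟩))
    (fun c hc hcp => by
      have h1 := hp.eq_zero_of_dependence hT
        (c := fun x => if h : x ∈ T then c ⟨x, h⟩ else 0)
        (by rw [← Finset.sum_coe_sort]; simpa using hc)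
        (by rw [← Finset.sum_coe_sort]; simpa using hcp)
      refine Finset.sum_eq_zero fun x _ => ?_
      have h2 := h1 x x.2
      simp only [Finset.coe_mem, dif_pos] at h2
      rw [h2, zero_smul])
  rw [← heq a, work_apply, work_apply]
  refine Finset.sum_congr rfl fun x _ => ?_
  by_cases hx : x ∈ T
  · have := congrFun ha ⟨x, hx⟩
    rw [this]
    rfl
  · rw [hF x hx, inner_zero_left, inner_zero_left]

/-- Joining a new vertex to at most three vertices keeps independence. -/
theorem InGeneralPosition.linearIndepOn_union_star {p : V → Space} (hp : InGeneralPosition p)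
    {E : Set (Sym2 V)} (hE : LinearIndepOn ℝ (rigidityRow p) E) {v : V} (hv : ∀ e ∈ E, v ∉ e)
    {N : Finset V} (hvN : v ∉ N) (hN : N.card ≤ 3) :
    LinearIndepOn ℝ (rigidityRow p) (E ∪ (fun y => s(v, y)) '' (N : Set V)) := by
  -- In the columns of `v` the new rows are the directions from the points of `N` to `v`, which are
  -- independent, while the rows of `E` vanish there.
  have h1 : LinearIndepOn ℝ
      (fun e => LinearMap.proj (R := ℝ) (φ := fun _ : V => Space) v (rigidityRow p e))
      ((fun y => s(v, y)) '' (N : Set V)) := by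
    refine LinearIndepOn.image_of_comp _ _ ?_
    have := hp.directions v N hvN hN
    convert! this using 2 with y
    exact rigidityRow_apply_left p v y
  refine hE.union (LinearIndepOn.of_comp _ h1) (Submodule.disjoint_def.2 fun F hF hF' => ?_)
  exact eq_zero_of_mem_span_of_linearIndepOn h1 hF' (apply_eq_zero_of_mem_rowSpan hF hv)

theorem pairsIn_insert {v : V} {T : Set V} (hv : v ∉ T) :
    pairsIn (insert v T) = pairsIn T ∪ (fun y => s(v, y)) '' T := by
  ext e
  induction e with | _ x y =>
  simp only [Set.mem_union, Set.mem_image, mk_mem_pairsIn, Set.mem_insert_iff, Sym2.eq_iff]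
  constructor
  · rintro ⟨hxy, rfl | hx, rfl | hy⟩
    · exact absurd rfl hxy
    · exact Or.inr ⟨y, hy, by simp⟩
    · exact Or.inr ⟨x, hx, by simp⟩
    · exact Or.inl ⟨hxy, hx, hy⟩
  · rintro (⟨hxy, hx, hy⟩ | ⟨z, hz, ⟨rfl, rfl⟩ | ⟨rfl, rfl⟩⟩)
    · exact ⟨hxy, Or.inr hx, Or.inr hy⟩
    · exact ⟨fun h => hv (h ▸ hz), Or.inl rfl, Or.inr hz⟩
    · exact ⟨fun h => hv (h ▸ hz), Or.inr hz, Or.inl rfl⟩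

theorem InGeneralPosition.linearIndepOn_pairsIn {p : V → Space} (hp : InGeneralPosition p)
    {T : Finset V} (hT : T.card ≤ 4) : LinearIndepOn ℝ (rigidityRow p) (pairsIn (T : Set V)) := by
  induction T using Finset.induction_on with
  | empty =>
    have : pairsIn ((∅ : Finset V) : Set V) = ∅ := by
      ext e
      induction e with | _ x y => simp [mk_mem_pairsIn]
    rw [this]
    exact linearIndepOn_empty _ _
  | insert v T hv ih =>
    rw [Finset.card_insert_of_notMem hv] at hT
    rw [Finset.coe_insert, pairsIn_insert (by simpa using hv)]
    refine hp.linearIndepOn_union_star (ih (by omega)) (fun e he hve => hv ?_) hv (by omega)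
    exact he.2 v hve

/-- Gluing independent sets of pairs along at most three vertices. -/
theorem InGeneralPosition.linearIndepOn_union [Finite V] {p : V → Space}
    (hp : InGeneralPosition p) {E E' : Set (Sym2 V)} {T : Finset V} (hT : T.card ≤ 3)
    (hE : LinearIndepOn ℝ (rigidityRow p) E)
    (hE' : LinearIndepOn ℝ (rigidityRow p) (E' ∪ pairsIn (T : Set V)))
    (hdisj : Disjoint E' (pairsIn (T : Set V)))
    (hmeet : ∀ e ∈ E, ∀ e' ∈ E', ∀ x ∈ e, x ∈ e' → x ∈ T) :
    LinearIndepOn ℝ (rigidityRow p) (E ∪ E') := by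
  cases nonempty_fintype V
  have h1 := (linearIndepOn_union_iff hdisj).1 hE'
  refine hE.union h1.1 (Submodule.disjoint_def.2 fun F hF hF' => ?_)
  refine Submodule.disjoint_def.1 h1.2.2 F hF' ?_
  -- A load resolved on both sides lives on the common vertices `T` and is in equilibrium, so the
  -- bars inside `T` resolve it; the rows of `E'` are independent of these bars.
  refine mem_rowSpan_pairsIn hp (by omega) (fun z hz => ?_) (work_trivialMotion_eq_zero hF)
  by_contra hne
  have h2 : ∃ e ∈ E, z ∈ e := by
    by_contra h
    push Not at h
    exact hne (apply_eq_zero_of_mem_rowSpan hF h)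
  have h3 : ∃ e ∈ E', z ∈ e := by
    by_contra h
    push Not at h
    exact hne (apply_eq_zero_of_mem_rowSpan hF' h)
  obtain ⟨e, he, hze⟩ := h2
  obtain ⟨e', he', hze'⟩ := h3
  exact hz (hmeet e he e' he' z hze hze')

theorem linearIndepOn_of_push [Fintype V] {f : V → W} {p : W → Space} {E : Set (Sym2 V)}
    (hinj : Set.InjOn (Sym2.map f) E)
    (h : LinearIndepOn ℝ (rigidityRow p) (Sym2.map f '' E)) :
    LinearIndepOn ℝ (fun e => push f (rigidityRow (p ∘ f) e)) E := by
  simp only [push_rigidityRow]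
  exact h.comp_of_image hinj

theorem linearIndepOn_comp [Fintype V] {f : V → W} {p : W → Space} {E : Set (Sym2 V)}
    (hinj : Set.InjOn (Sym2.map f) E)
    (h : LinearIndepOn ℝ (rigidityRow p) (Sym2.map f '' E)) :
    LinearIndepOn ℝ (rigidityRow (p ∘ f)) E :=
  LinearIndepOn.of_comp _ (linearIndepOn_of_push hinj h)

theorem eq_zero_of_push_eq_zero [Fintype V] {f : V → W} {p : W → Space} {E : Set (Sym2 V)}
    (hinj : Set.InjOn (Sym2.map f) E)
    (h : LinearIndepOn ℝ (rigidityRow p) (Sym2.map f '' E)) {F : V → Space}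
    (hF : F ∈ rowSpan (p ∘ f) E) (h0 : push f F = 0) : F = 0 :=
  eq_zero_of_mem_span_of_linearIndepOn (linearIndepOn_of_push hinj h) hF h0

theorem linearIndepOn_map_iff [Fintype V] [Finite W] (f : V ↪ W) (p : W → Space)
    (E : Set (Sym2 V)) : LinearIndepOn ℝ (rigidityRow (p ∘ f)) E ↔
      LinearIndepOn ℝ (rigidityRow p) (Sym2.map f '' E) := by
  rw [linearIndepOn_iff_setRank, linearIndepOn_iff_setRank, setRank_comp_embedding,
    Set.ncard_image_of_injective _ (Sym2.map.injective f.injective)]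

end Independence

/-! ### Counting edges -/

section Counting
variable {V : Type*} {W : Type*}

/-- The edges of `G` inside `U`. -/
def edgesIn (G : SimpleGraph V) (U : Set V) : Set (Sym2 V) := {e ∈ G.edgeSet | ∀ x ∈ e, x ∈ U}

theorem mk_mem_edgesIn {G : SimpleGraph V} {U : Set V} {x y : V} :
    s(x, y) ∈ edgesIn G U ↔ G.Adj x y ∧ x ∈ U ∧ y ∈ U := by
  simp [edgesIn]

theorem edgesIn_subset (G : SimpleGraph V) (U : Set V) : edgesIn G U ⊆ G.edgeSet :=
  Set.sep_subset _ _

theorem edgesIn_subset_pairsIn (G : SimpleGraph V) (U : Set V) : edgesIn G U ⊆ pairsIn U := by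
  intro e
  induction e with | _ x y =>
  rw [mk_mem_edgesIn, mk_mem_pairsIn]
  exact fun h => ⟨h.1.ne, h.2⟩

theorem map_edgeSet_induce (G : SimpleGraph V) (U : Set V) :
    Sym2.map (Subtype.val : U → V) '' (G.induce U).edgeSet = edgesIn G U := by
  ext e
  induction e with | _ x y =>
  rw [mk_mem_edgesIn]
  constructor
  · rintro ⟨e, he, h⟩
    induction e with | _ x' y' =>
    rw [Sym2.map_mk, Sym2.eq_iff] at h
    have h1 : G.Adj x' y' := he
    rcases h with ⟨rfl, rfl⟩ | ⟨rfl, rfl⟩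
    · exact ⟨h1, x'.2, y'.2⟩
    · exact ⟨h1.symm, y'.2, x'.2⟩
  · rintro ⟨h, hx, hy⟩
    exact ⟨s(⟨x, hx⟩, ⟨y, hy⟩), h, rfl⟩

theorem genericRank_induce [Finite V] (G : SimpleGraph V) (U : Set V) :
    genericRank (G.induce U) = genRank (edgesIn G U) := by
  rw [genericRank_eq, ← map_edgeSet_induce]
  exact (genRank_map (Function.Embedding.subtype (· ∈ U)) _).symm

theorem genRank_edgesIn_add_six_le [Finite V] (G : SimpleGraph V) {U : Set V}
    (hU : 3 ≤ U.ncard) : genRank (edgesIn G U) + 6 ≤ 3 * U.ncard := by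
  rw [← genericRank_induce, genericRank_eq, ← Nat.card_coe_set_eq]
  exact genRank_add_six_le (by rwa [Nat.card_coe_set_eq]) _

/-- Rank is monotone, so induced subgraphs suffice, and failing to reach 3n - 6 means having rank at
most 3n - 7. -/
theorem isNucleationFree_iff [Finite V] {G : SimpleGraph V} :
    IsNucleationFree G ↔ ∀ U : Set V, 5 ≤ U.ncard → genRank (edgesIn G U) + 7 ≤ 3 * U.ncard := by
  constructor
  · intro h U hU
    have h1 := genRank_edgesIn_add_six_le G (U := U) (by omega)
    have h2 : ¬ IsRigid (V := U) ((⊤ : G.Subgraph).induce U).coe :=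
      h ((⊤ : G.Subgraph).induce U) hU
    have h3 : ((⊤ : G.Subgraph).induce U).coe = G.induce U := by
      ext x y
      simp only [SimpleGraph.Subgraph.coe_adj, SimpleGraph.Subgraph.induce_adj,
        SimpleGraph.Subgraph.top_adj]
      exact ⟨fun h => h.2.2, fun h => ⟨x.2, y.2, h⟩⟩
    rw [h3, isRigid_iff (by rw [Nat.card_coe_set_eq]; omega), Nat.card_coe_set_eq] at h2
    have h4 := genericRank_induce G U
    rw [genericRank_eq] at h4
    omega
  · intro h K hK hrig
    have h3 : Nat.card K.verts = K.verts.ncard := Nat.card_coe_set_eq _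
    rw [isRigid_iff (by omega)] at hrig
    have h1 := h K.verts hK
    rw [← genericRank_induce, genericRank_eq] at h1
    have h2 : genRank K.coe.edgeSet ≤ genRank (G.induce K.verts).edgeSet := by
      refine genRank_mono (SimpleGraph.edgeSet_mono ?_)
      intro x y hxy
      exact K.adj_sub hxy
    omega

theorem ncard_pairsIn [Finite V] (U : Set V) : (pairsIn U).ncard = U.ncard.choose 2 := by
  cases nonempty_fintype V
  rw [Set.ncard_eq_toFinset_card' U, ← Sym2.card_image_offDiag, ← Set.ncard_coe_finset]
  congr 1
  ext e
  induction e with | _ x y =>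
  rw [mk_mem_pairsIn]
  simp only [Finset.coe_image, Set.mem_image, Finset.mem_coe, Finset.mem_offDiag, Set.mem_toFinset,
    Prod.exists]
  constructor
  · rintro ⟨hxy, hx, hy⟩
    exact ⟨x, y, ⟨hx, hy, hxy⟩, rfl⟩
  · rintro ⟨x', y', ⟨hx, hy, hxy⟩, h⟩
    rcases Sym2.eq_iff.1 h with ⟨rfl, rfl⟩ | ⟨rfl, rfl⟩
    · exact ⟨hxy, hx, hy⟩
    · exact ⟨hxy.symm, hy, hx⟩

theorem ncard_edgesIn_le_choose [Finite V] (G : SimpleGraph V) (U : Set V) :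
    (edgesIn G U).ncard ≤ U.ncard.choose 2 := by
  rw [← ncard_pairsIn]
  exact Set.ncard_le_ncard (edgesIn_subset_pairsIn G U)

theorem IsIndependent.genRank_edgesIn [Finite V] {G : SimpleGraph V} (h : IsIndependent G)
    (U : Set V) : genRank (edgesIn G U) = (edgesIn G U).ncard := by
  obtain ⟨p, hp⟩ := exists_inGeneralPosition V
  rw [← hp.setRank_eq]
  exact setRank_eq_ncard ((h.linearIndepOn hp).mono (edgesIn_subset G U))

theorem IsIndependent.ncard_edgesIn_add_six_le [Finite V] {G : SimpleGraph V}
    (h : IsIndependent G) {U : Set V} (hU : 3 ≤ U.ncard) :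
    (edgesIn G U).ncard + 6 ≤ 3 * U.ncard := by
  rw [← h.genRank_edgesIn]; exact genRank_edgesIn_add_six_le G hU

theorem IsIndependent.ncard_edgesIn_add_seven_le [Finite V] {G : SimpleGraph V}
    (h : IsIndependent G) (hnf : IsNucleationFree G) {U : Set V} (hU : 5 ≤ U.ncard) :
    (edgesIn G U).ncard + 7 ≤ 3 * U.ncard := by
  rw [← h.genRank_edgesIn]; exact isNucleationFree_iff.1 hnf U hU

theorem isNucleationFree_of_ncard [Finite V] {G : SimpleGraph V}
    (h : ∀ U : Set V, 5 ≤ U.ncard → (edgesIn G U).ncard + 7 ≤ 3 * U.ncard) :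
    IsNucleationFree G :=
  isNucleationFree_iff.2 fun U hU => (Nat.add_le_add_right (genRank_le_ncard _) 7).trans (h U hU)

end Counting

/-! ### Thin covers -/

section Covers
variable {V : Type*} {𝒳 : Finset (Finset V)}

/-- The number of members of `𝒳` that contain the pair `e`. -/
def pairDegree (𝒳 : Finset (Finset V)) (e : Sym2 V) : ℕ := {X ∈ 𝒳 | ∀ x ∈ e, x ∈ X}.card

theorem coverDegree_pair (x y : V) : coverDegree 𝒳 {x, y} = pairDegree 𝒳 s(x, y) := by
  rw [coverDegree, pairDegree]
  congr 1
  ext X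
  simp [Finset.insert_subset_iff]

/-- In a 2-thin family two distinct members that contain a common pair meet exactly in that pair, so
being shared is just having degree at least two. -/
theorem mem_sharedPairs_iff (h : IsTwoThin 𝒳) {P : Finset V} :
    P ∈ sharedPairs 𝒳 ↔ P.card = 2 ∧ 2 ≤ coverDegree 𝒳 P := by
  simp only [sharedPairs, Finset.mem_filter, Finset.mem_image, Finset.mem_offDiag, Prod.exists]
  constructor
  · rintro ⟨⟨X, Y, ⟨hX, hY, hne⟩, rfl⟩, hc⟩
    refine ⟨hc, Finset.one_lt_card.2 ⟨X, ?_, Y, ?_, hne⟩⟩ <;> simp [*]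
  · rintro ⟨hc, hd⟩
    obtain ⟨X, hX, Y, hY, hne⟩ := Finset.one_lt_card.1 hd
    rw [Finset.mem_filter] at hX hY
    refine ⟨⟨X, Y, ⟨hX.1, hY.1, hne⟩, ?_⟩, hc⟩
    refine (Finset.eq_of_subset_of_card_le (Finset.subset_inter hX.2 hY.2) ?_).symm
    rw [hc]
    convert! h X hX.1 Y hY.1 hne

theorem sharedGraph_adj_iff (h : IsTwoThin 𝒳) {x y : V} :
    (sharedGraph 𝒳).Adj x y ↔ x ≠ y ∧ 2 ≤ pairDegree 𝒳 s(x, y) := by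
  change x ≠ y ∧ _ ↔ _
  refine and_congr_right fun hxy => ?_
  rw [mem_sharedPairs_iff h, coverDegree_pair]
  simp [Finset.card_pair hxy]

theorem exists_of_two_le_pairDegree {e : Sym2 V} (h : 2 ≤ pairDegree 𝒳 e) :
    ∃ X ∈ 𝒳, ∃ Y ∈ 𝒳, X ≠ Y ∧ (∀ x ∈ e, x ∈ X) ∧ ∀ x ∈ e, x ∈ Y := by
  obtain ⟨X, hX, Y, hY, hne⟩ := Finset.one_lt_card.1 h
  rw [Finset.mem_filter] at hX hY
  exact ⟨X, hX.1, Y, hY.1, hne, hX.2, hY.2⟩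

/-- The sum of `d - 1` over the pairs that lie in some member of the family. -/
def excess [Fintype V] (𝒳 : Finset (Finset V)) : ℕ :=
  ∑ e : Sym2 V with ¬ e.IsDiag, (pairDegree 𝒳 e - 1)

theorem sum_le_excess [Fintype V] (𝒳 : Finset (Finset V)) {s : Finset (Sym2 V)}
    (h : ∀ e ∈ s, ¬ e.IsDiag) : ∑ e ∈ s, (pairDegree 𝒳 e - 1) ≤ excess 𝒳 :=
  Finset.sum_le_sum_of_subset fun e he => Finset.mem_filter.2 ⟨Finset.mem_univ _, h e he⟩

/-- Truncated subtraction makes pairs of degree 0 or 1 contribute nothing, so summing over all pairs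
is the same as summing over the shared ones. -/
theorem excess_eq [Fintype V] (h : IsTwoThin 𝒳) :
    excess 𝒳 = ∑ e ∈ (sharedGraph 𝒳).edgeSet.toFinset, (pairDegree 𝒳 e - 1) := by
  rw [excess]
  refine (Finset.sum_subset ?_ ?_).symm
  · intro e
    induction e with | _ x y =>
    simp [sharedGraph_adj_iff h]
    tauto
  · intro e
    induction e with | _ x y =>
    simp only [Finset.mem_filter, Finset.mem_univ, true_and, Sym2.mk_isDiag_iff,
      Set.mem_toFinset, SimpleGraph.mem_edgeSet, sharedGraph_adj_iff h]
    intro h1 h2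
    have : ¬ 2 ≤ pairDegree 𝒳 s(x, y) := fun h3 => h2 ⟨h1, h3⟩
    omega

theorem sum_sharedPairs [Fintype V] (h : IsTwoThin 𝒳) :
    ∑ P ∈ sharedPairs 𝒳, ((coverDegree 𝒳 P : ℤ) - 1) = excess 𝒳 := by
  rw [excess_eq h, Nat.cast_sum]
  symm
  refine Finset.sum_bij (fun e _ => e.toFinset) ?_ ?_ ?_ ?_
  · intro e
    induction e with | _ x y =>
    intro he
    have h1 : (sharedGraph 𝒳).Adj x y := by simpa using he
    have h2 : s(x, y).toFinset = {x, y} := by ext; simp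
    rw [h2]
    exact h1.2
  · intro e _ e' _ h1
    ext x
    rw [← Sym2.mem_toFinset, h1, Sym2.mem_toFinset]
  · intro P hP
    obtain ⟨x, y, hxy, rfl⟩ := Finset.card_eq_two.1 ((mem_sharedPairs_iff h).1 hP).1
    refine ⟨s(x, y), ?_, by ext; simp⟩
    rw [Set.mem_toFinset]
    exact ⟨hxy, hP⟩
  · intro e
    induction e with | _ x y =>
    intro he
    have h1 : (sharedGraph 𝒳).Adj x y := by simpa using he
    have h2 : s(x, y).toFinset = {x, y} := by ext; simp
    have h3 := ((sharedGraph_adj_iff h).1 h1).2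
    rw [h2, coverDegree_pair]
    omega

theorem sum_ncard_edgesIn [Fintype V] (G : SimpleGraph V) (𝒴 : Finset (Finset V)) :
    ∑ X ∈ 𝒴, (edgesIn G (X : Set V)).ncard = ∑ e ∈ G.edgeSet.toFinset, pairDegree 𝒴 e := by
  simp only [pairDegree, Finset.card_filter]
  rw [Finset.sum_comm]
  refine Finset.sum_congr rfl fun X _ => ?_
  trans (G.edgeSet.toFinset.filter fun e => ∀ x ∈ e, x ∈ X).card
  · rw [← Set.ncard_coe_finset]
    congr 1
    ext e
    simp [edgesIn]
  · rw [Finset.card_filter]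
    exact Finset.sum_congr rfl fun e _ => by congr

theorem le_starGraph (G : SimpleGraph V) (𝒳 : Finset (Finset V)) : G ≤ starGraph G 𝒳 := le_sup_left

theorem sharedGraph_le_starGraph (G : SimpleGraph V) (𝒳 : Finset (Finset V)) :
    sharedGraph 𝒳 ≤ starGraph G 𝒳 := le_sup_right

theorem edgesIn_mono {G G' : SimpleGraph V} (h : G ≤ G') (U : Set V) :
    edgesIn G U ⊆ edgesIn G' U := fun _ he => ⟨SimpleGraph.edgeSet_mono h he.1, he.2⟩

theorem exists_mem_of_starGraph_adj {G : SimpleGraph V} (hc : IsCover G 𝒳)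
    (h2 : IsTwoThin 𝒳) {x y : V} (h : (starGraph G 𝒳).Adj x y) : ∃ X ∈ 𝒳, x ∈ X ∧ y ∈ X := by
  rcases h with h | h
  · exact hc.covers x y h
  · obtain ⟨X, hX, -, -, -, h3, -⟩ :=
      exists_of_two_le_pairDegree ((sharedGraph_adj_iff h2).1 h).2
    exact ⟨X, hX, h3 x (by simp), h3 y (by simp)⟩

/-- The map (z, s) ↦ ∑ zᵢ - s on ∏ A i × S has range (⨆ A i) ⊔ S, and its kernel contains the copy b
↦ (b, ∑ bᵢ) of ∏ B i. Rank-nullity gives the inequality. -/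
theorem finrank_iSup_sup_add_sum_le {M ι : Type*} [AddCommGroup M] [Module ℝ M]
    [FiniteDimensional ℝ M] [Fintype ι] (A B : ι → Submodule ℝ M) (S : Submodule ℝ M)
    (hBA : ∀ i, B i ≤ A i) (hBS : ∀ i, B i ≤ S) :
    finrank ℝ ((⨆ i, A i) ⊔ S : Submodule ℝ M) + ∑ i, finrank ℝ (B i) ≤
      ∑ i, finrank ℝ (A i) + finrank ℝ S := by
  obtain ⟨Ψ, hΨ⟩ : ∃ Ψ : ((i : ι) → A i) × S →ₗ[ℝ] M, ∀ z, Ψ z = ∑ i, (z.1 i : M) - z.2 :=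
    ⟨LinearMap.coprod (∑ i, (A i).subtype ∘ₗ LinearMap.proj i) (-S.subtype),
      fun z => by simp [sub_eq_add_neg]⟩
  obtain ⟨J, hJ, hJ'⟩ : ∃ J : ((i : ι) → B i) →ₗ[ℝ] ((i : ι) → A i) × S,
      (∀ b i, ((J b).1 i : M) = b i) ∧ ∀ b, ((J b).2 : M) = ∑ i, (b i : M) :=
    ⟨LinearMap.prod (LinearMap.pi fun i => inclusion (hBA i) ∘ₗ LinearMap.proj i)
      (∑ i, inclusion (hBS i) ∘ₗ LinearMap.proj i), fun b i => by simp, fun b => by simp⟩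
  have hJinj : Function.Injective J := by
    intro b b' h
    ext1 i
    exact Subtype.ext (by rw [← hJ, ← hJ, h])
  have hJΨ : LinearMap.range J ≤ LinearMap.ker Ψ := by
    rintro _ ⟨b, rfl⟩
    rw [LinearMap.mem_ker, hΨ, hJ', sub_eq_zero]
    exact Finset.sum_congr rfl fun i _ => hJ b i
  have hrange : LinearMap.range Ψ = (⨆ i, A i) ⊔ S := by
    apply le_antisymm
    · rintro _ ⟨z, rfl⟩
      rw [hΨ]
      exact sub_mem (sum_mem fun i _ => le_sup_left (α := Submodule ℝ M)
        (le_iSup A i (z.1 i).2)) (le_sup_right (α := Submodule ℝ M) z.2.2)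
    · refine sup_le (iSup_le fun i x hx => ⟨(Pi.single i ⟨x, hx⟩, 0), ?_⟩)
        fun x hx => ⟨(0, ⟨-x, neg_mem hx⟩), ?_⟩
      · rw [hΨ, Finset.sum_eq_single i]
        · simp
        · intro j _ hne
          simp [hne]
        · simp
      · rw [hΨ]
        simp
  have hJr := LinearMap.finrank_range_of_inj hJinj
  have hΨr := LinearMap.finrank_range_add_finrank_ker Ψ
  have hle := finrank_mono hJΨ
  rw [finrank_pi_fintype] at hJr
  rw [finrank_prod, finrank_pi_fintype, hrange] at hΨr
  omega

/-- The rank bound of a 2-thin cover with independent shared part. -/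
theorem thinCover_rank [Fintype V] {G : SimpleGraph V} (hc : IsCover G 𝒳) (h2 : IsTwoThin 𝒳)
    (hs : IsIndependent (sharedGraph 𝒳)) {p : V → Space} (hp : InGeneralPosition p) :
    genRank (starGraph G 𝒳).edgeSet + excess 𝒳 ≤
      ∑ X ∈ 𝒳, genRank (edgesIn (starGraph G 𝒳) (X : Set V)) := by
  let A (X : 𝒳) : Submodule ℝ (V → Space) := rowSpan p (edgesIn (starGraph G 𝒳) (X : Set V))
  let B (X : 𝒳) : Submodule ℝ (V → Space) := rowSpan p (edgesIn (sharedGraph 𝒳) (X : Set V))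
  let S : Submodule ℝ (V → Space) := rowSpan p (sharedGraph 𝒳).edgeSet
  have hBA (X : 𝒳) : B X ≤ A X :=
    rowSpan_mono p (edgesIn_mono (sharedGraph_le_starGraph G 𝒳) _)
  have hBS (X : 𝒳) : B X ≤ S := rowSpan_mono p (edgesIn_subset _ _)
  have hstar : S ≤ rowSpan p (starGraph G 𝒳).edgeSet :=
    rowSpan_mono p (SimpleGraph.edgeSet_mono (sharedGraph_le_starGraph G 𝒳))
  have hsup : (⨆ X, A X) ⊔ S = rowSpan p (starGraph G 𝒳).edgeSet := by
    refine le_antisymm (sup_le (iSup_le fun X => rowSpan_mono p (edgesIn_subset _ _)) hstar)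
      (le_sup_of_le_left (span_le.2 ?_))
    rintro _ ⟨e, he, rfl⟩
    induction e with | _ x y =>
    obtain ⟨X, hX, hx, hy⟩ := exists_mem_of_starGraph_adj hc h2 he
    exact le_iSup A ⟨X, hX⟩ (rigidityRow_mem_rowSpan p (mk_mem_edgesIn.2 ⟨he, hx, hy⟩))
  have hA : ∑ X, finrank ℝ (A X) =
      ∑ X ∈ 𝒳, genRank (edgesIn (starGraph G 𝒳) (X : Set V)) := by
    rw [← Finset.sum_coe_sort 𝒳 (fun X => genRank (edgesIn (starGraph G 𝒳) (X : Set V)))]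
    exact Finset.sum_congr rfl fun X _ => hp.setRank_eq _
  have hS : finrank ℝ S = (sharedGraph 𝒳).edgeSet.toFinset.card := by
    rw [← Set.ncard_eq_toFinset_card']
    exact setRank_eq_ncard (hs.linearIndepOn hp)
  have hB : ∑ X, finrank ℝ (B X) =
      ∑ e ∈ (sharedGraph 𝒳).edgeSet.toFinset, pairDegree 𝒳 e := by
    rw [← sum_ncard_edgesIn, ← Finset.sum_coe_sort 𝒳
      (fun X => (edgesIn (sharedGraph 𝒳) (X : Set V)).ncard)]
    refine Finset.sum_congr rfl fun X _ => ?_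
    exact setRank_eq_ncard ((hs.linearIndepOn hp).mono (edgesIn_subset _ _))
  -- By double counting, the dimensions of the `B X` add up to the total degree of the shared pairs.
  -- Subtracting the dimension of `S` leaves exactly ∑ (d - 1).
  have hex : excess 𝒳 + (sharedGraph 𝒳).edgeSet.toFinset.card =
      ∑ e ∈ (sharedGraph 𝒳).edgeSet.toFinset, pairDegree 𝒳 e := by
    rw [excess_eq h2, Finset.card_eq_sum_ones, ← Finset.sum_add_distrib]
    refine Finset.sum_congr rfl fun e => ?_
    induction e with | _ x y =>
    intro he
    have h1 : (sharedGraph 𝒳).Adj x y := by simpa using he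
    have h3 := ((sharedGraph_adj_iff h2).1 h1).2
    omega
  have hstarrank : finrank ℝ (rowSpan p (starGraph G 𝒳).edgeSet) =
      genRank (starGraph G 𝒳).edgeSet := hp.setRank_eq _
  have key := finrank_iSup_sup_add_sum_le A B S hBA hBS
  rw [hsup, hstarrank, hA, hB, hS] at key
  omega

theorem IsTightCover.sum_genRank [Fintype V] {G : SimpleGraph V} (h : IsTightCover G 𝒳) :
    ∑ X ∈ 𝒳, genRank (edgesIn (starGraph G 𝒳) (X : Set V)) = genRank G.edgeSet + excess 𝒳 := by
  have h1 := h.rank_eq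
  rw [sum_sharedPairs h.twoThin] at h1
  simp only [genericRank_induce] at h1
  rw [genericRank_eq] at h1
  zify
  linarith

theorem IsTightCover.genRank_starGraph [Fintype V] {G : SimpleGraph V} (h : IsTightCover G 𝒳) :
    genRank (starGraph G 𝒳).edgeSet = genRank G.edgeSet := by
  obtain ⟨p, hp⟩ := exists_inGeneralPosition V
  have h1 := thinCover_rank h.cover h.twoThin h.shared_independent hp
  rw [h.sum_genRank] at h1
  exact le_antisymm (by omega) (genRank_mono (SimpleGraph.edgeSet_mono (le_starGraph G 𝒳)))

/-- Only one inequality has to be checked; the other is `thinCover_rank` together with rank G ≤ rank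
G⋆. -/
theorem isTightCover_of_le [Fintype V] {G : SimpleGraph V} (hc : IsCover G 𝒳)
    (h2 : IsTwoThin 𝒳) (hs : IsIndependent (sharedGraph 𝒳))
    (hle : ∑ X ∈ 𝒳, genRank (edgesIn (starGraph G 𝒳) (X : Set V)) ≤
      genRank G.edgeSet + excess 𝒳) : IsTightCover G 𝒳 := by
  refine ⟨hc, h2, hs, ?_⟩
  obtain ⟨p, hp⟩ := exists_inGeneralPosition V
  have h1 := thinCover_rank hc h2 hs hp
  have h3 := genRank_mono (SimpleGraph.edgeSet_mono (le_starGraph G 𝒳))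
  rw [sum_sharedPairs h2]
  simp only [genericRank_induce]
  rw [genericRank_eq]
  zify at h1 h3 hle
  linarith

/-- G and G⋆ have the same generic rank, so at a position generic for G the row space of G is
already that of G⋆. -/
theorem IsTightCover.isImpliedNonedge [Finite V] {G : SimpleGraph V} (h : IsTightCover G 𝒳)
    {a b : V} (hab : IsSharedNonedge G 𝒳 a b) : IsImpliedNonedge G a b := by
  cases nonempty_fintype V
  refine ⟨hab.1.ne, hab.2, fun p hp => ?_⟩
  rw [isGeneric_iff] at hp
  have h1 : rowSpan p G.edgeSet = rowSpan p (starGraph G 𝒳).edgeSet := by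
    refine eq_of_le_of_finrank_le
      (rowSpan_mono p (SimpleGraph.edgeSet_mono (le_starGraph G 𝒳))) ?_
    have h3 := setRank_le_genRank p (starGraph G 𝒳).edgeSet
    rw [h.genRank_starGraph, ← hp] at h3
    exact h3
  change _ ∈ rowSpan p G.edgeSet
  rw [h1]
  exact rigidityRow_mem_rowSpan p (SimpleGraph.edgeSet_mono (sharedGraph_le_starGraph G 𝒳) hab.1)

end Covers

/-! ### Pasting along a clique of one side -/

section Pasting
variable {V V₁ W : Type*} {k : ℕ}

/-- `G` arises from `A` by identifying at most three vertices `φ i` of `A` with the vertices `ψ i`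
of a clique of `B`, without adding the edges of this clique. -/
structure IsPasting (A : SimpleGraph V) (B : SimpleGraph V₁) (G : SimpleGraph W)
    (φ : Fin k → V) (ψ : Fin k → V₁) (f : V ↪ W) (g : V₁ ↪ W) : Prop where
  le_three : k ≤ 3
  injective : Function.Injective ψ
  clique : ∀ i j, i ≠ j → B.Adj (ψ i) (ψ j)
  glue : ∀ i, f (φ i) = g (ψ i)
  inter : ∀ x y, f x = g y → ∃ i, φ i = x ∧ ψ i = y
  union : ∀ z, z ∈ Set.range f ∨ z ∈ Set.range g
  edgeSet : G.edgeSet =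
    Sym2.map f '' A.edgeSet ∪ Sym2.map g '' (B.edgeSet \ pairsIn (Set.range ψ))

theorem map_pairsIn (g : V₁ ↪ W) (T : Set V₁) :
    Sym2.map g '' pairsIn T = pairsIn (g '' T) := by
  ext e
  induction e with | _ x y =>
  rw [mk_mem_pairsIn]
  constructor
  · rintro ⟨e, he, h⟩
    induction e with | _ x' y' =>
    rw [mk_mem_pairsIn] at he
    rw [Sym2.map_mk, Sym2.eq_iff] at h
    rcases h with ⟨rfl, rfl⟩ | ⟨rfl, rfl⟩
    · exact ⟨fun h => he.1 (g.injective h), ⟨_, he.2.1, rfl⟩, ⟨_, he.2.2, rfl⟩⟩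
    · exact ⟨fun h => he.1 (g.injective h.symm), ⟨_, he.2.2, rfl⟩, ⟨_, he.2.1, rfl⟩⟩
  · rintro ⟨hxy, ⟨x', hx, rfl⟩, ⟨y', hy, rfl⟩⟩
    exact ⟨s(x', y'), mk_mem_pairsIn.2 ⟨fun h => hxy (h ▸ rfl), hx, hy⟩, rfl⟩

namespace IsPasting
variable {A : SimpleGraph V} {B : SimpleGraph V₁} {G : SimpleGraph W}
  {φ : Fin k → V} {ψ : Fin k → V₁} {f : V ↪ W} {g : V₁ ↪ W}

theorem pairsIn_subset (h : IsPasting A B G φ ψ f g) : pairsIn (Set.range ψ) ⊆ B.edgeSet := by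
  intro e
  induction e with | _ x y =>
  rw [mk_mem_pairsIn]
  rintro ⟨hxy, ⟨i, rfl⟩, ⟨j, rfl⟩⟩
  exact h.clique i j fun hij => hxy (hij ▸ rfl)

theorem range_comp (h : IsPasting A B G φ ψ f g) : g '' Set.range ψ = Set.range (f ∘ φ) := by
  rw [← Set.range_comp]
  congr 1
  ext i
  exact (h.glue i).symm

/-- Glue along the images of the clique. The remaining edges of `B` together with the clique are the
edges of `B`, hence independent; `A` need not contain the clique. -/
theorem linearIndepOn [Finite V] [Finite V₁] [Finite W] (h : IsPasting A B G φ ψ f g)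
    (hA : IsIndependent A) (hB : IsIndependent B) {p : W → Space} (hp : InGeneralPosition p) :
    LinearIndepOn ℝ (rigidityRow p) G.edgeSet := by
  cases nonempty_fintype V
  cases nonempty_fintype V₁
  have hT : ((Finset.univ.image (f ∘ φ) : Finset W) : Set W) = g '' Set.range ψ := by
    rw [h.range_comp]; simp [Function.comp_def]
  rw [h.edgeSet]
  refine hp.linearIndepOn_union (T := Finset.univ.image (f ∘ φ)) ?_ ?_ ?_ ?_ ?_
  · exact Finset.card_image_le.trans (by simpa using h.le_three)
  · rw [← linearIndepOn_map_iff]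
    exact hA.linearIndepOn (hp.comp f)
  · rw [hT, ← map_pairsIn, ← Set.image_union, Set.sdiff_union_of_subset h.pairsIn_subset,
      ← linearIndepOn_map_iff]
    exact hB.linearIndepOn (hp.comp g)
  · rw [hT, ← map_pairsIn, Set.disjoint_image_iff (Sym2.map.injective g.injective)]
    exact Set.disjoint_sdiff_left
  · rintro _ ⟨e, he, rfl⟩ _ ⟨e', he', rfl⟩ z hz hz'
    rw [Sym2.mem_map] at hz hz'
    obtain ⟨x, -, rfl⟩ := hz
    obtain ⟨y, -, hxy⟩ := hz'
    obtain ⟨i, rfl, rfl⟩ := h.inter x y hxy.symm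
    simp

theorem isIndependent [Finite V] [Finite V₁] [Finite W] (h : IsPasting A B G φ ψ f g)
    (hA : IsIndependent A) (hB : IsIndependent B) : IsIndependent G := by
  obtain ⟨p, hp⟩ := exists_inGeneralPosition W
  exact isIndependent_iff_exists.2 ⟨p, h.linearIndepOn hA hB hp⟩

theorem not_mem_range (h : IsPasting A B G φ ψ f g) {e : Sym2 V₁}
    (he : e ∈ B.edgeSet \ pairsIn (Set.range ψ)) : ∃ x ∈ e.map g, x ∉ Set.range f := by
  by_contra hne
  push Not at hne
  refine he.2 ⟨B.not_isDiag_of_mem_edgeSet he.1, fun y hy => ?_⟩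
  obtain ⟨x, hx⟩ := hne (g y) (Sym2.mem_map.2 ⟨y, hy, rfl⟩)
  obtain ⟨i, -, rfl⟩ := h.inter x y hx
  exact ⟨i, rfl⟩

end IsPasting

theorem inK4_of_ncard [Finite V] {A : SimpleGraph V} {U : Set V} (hU : U.ncard = 4)
    (he : 6 ≤ (edgesIn A U).ncard) {ι : Type*} {φ : ι → V} (hφ : ∀ i, φ i ∈ U) : InK4 A φ := by
  cases nonempty_fintype V
  have h1 : edgesIn A U = pairsIn U := by
    refine Set.eq_of_subset_of_ncard_le (edgesIn_subset_pairsIn A U) ?_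
    rw [ncard_pairsIn, hU]
    exact he
  refine ⟨U.toFinset, ⟨?_, ?_⟩, fun i => by simpa using hφ i⟩
  · rw [SimpleGraph.isClique_iff]
    intro x hx y hy hxy
    rw [Set.coe_toFinset] at hx hy
    have h2 : s(x, y) ∈ edgesIn A U := by
      rw [h1]; exact mk_mem_pairsIn.2 ⟨hxy, hx, hy⟩
    exact h2.1
  · rw [← Set.ncard_eq_toFinset_card', hU]

/-- The variables `a`, `b`, `t` count the chosen vertices in the two summands and in their overlap.
The case excluded by `h4` is genuine: two K₄'s on a common triangle have 9 edges on 5 vertices, and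
9 = 3 · 5 - 6. -/
theorem pasting_count {a b n t eA eB eG : ℕ} (hn : n + t = a + b) (h5 : 5 ≤ n) (hta : t ≤ a)
    (htb : t ≤ b) (ht : t ≤ 3) (he : eG + t.choose 2 ≤ eA + eB)
    (ha : eA ≤ a.choose 2) (hb : eB ≤ b.choose 2)
    (ha3 : 3 ≤ a → eA + 6 ≤ 3 * a) (hb3 : 3 ≤ b → eB + 6 ≤ 3 * b)
    (ha5 : 5 ≤ a → eA + 7 ≤ 3 * a) (hb5 : 5 ≤ b → eB + 7 ≤ 3 * b)
    (h4 : ¬ (t = 3 ∧ a = 4 ∧ b = 4 ∧ 6 ≤ eA ∧ 6 ≤ eB)) : eG + 7 ≤ 3 * n := by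
  have hsmall (c e : ℕ) (h : e ≤ c.choose 2) : (c ≤ 1 → e = 0) ∧ (c = 2 → e ≤ 1) := by
    refine ⟨fun hc => ?_, fun hc => ?_⟩
    · interval_cases c <;> simpa using h
    · subst hc
      simpa using h
  have ha2 := hsmall a eA ha
  have hb2 := hsmall b eB hb
  clear ha hb hsmall
  interval_cases t <;> simp only [Nat.choose] at he <;> omega

theorem IsPasting.isNucleationFree [Finite V] [Finite V₁] [Finite W]
    {A : SimpleGraph V} {B : SimpleGraph V₁} {G : SimpleGraph W}
    {φ : Fin k → V} {ψ : Fin k → V₁} {f : V ↪ W} {g : V₁ ↪ W}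
    (h : IsPasting A B G φ ψ f g)
    (hA : IsIndependent A) (hB : IsIndependent B) (hA' : IsNucleationFree A)
    (hB' : IsNucleationFree B) (hK : k = 3 → ¬ InK4 A φ ∨ ¬ InK4 B ψ) :
    IsNucleationFree G := by
  refine isNucleationFree_of_ncard fun U hU => ?_
  -- The overlap of the two traces of `U`, seen in `B`. It spans a clique there, so the choose-two
  -- of its size may be subtracted from the edges counted in `B`.
  let I : Set V₁ := Set.range ψ ∩ g ⁻¹' U
  have hgI : g '' I = f '' (f ⁻¹' U) ∩ g '' (g ⁻¹' U) := by
    ext z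
    constructor
    · rintro ⟨_, ⟨⟨i, rfl⟩, hi⟩, rfl⟩
      refine ⟨⟨φ i, ?_, h.glue i⟩, ⟨ψ i, hi, rfl⟩⟩
      change f (φ i) ∈ U
      rw [h.glue i]
      exact hi
    · rintro ⟨⟨x, hx, rfl⟩, ⟨y, hy, hxy⟩⟩
      obtain ⟨i, rfl, rfl⟩ := h.inter x y hxy.symm
      exact ⟨ψ i, ⟨⟨i, rfl⟩, hy⟩, hxy⟩
  have hUu : U = f '' (f ⁻¹' U) ∪ g '' (g ⁻¹' U) := by
    ext z
    constructor
    · intro hz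
      rcases h.union z with ⟨x, rfl⟩ | ⟨x, rfl⟩
      · exact Or.inl ⟨x, hz, rfl⟩
      · exact Or.inr ⟨x, hz, rfl⟩
    · rintro (⟨x, hx, rfl⟩ | ⟨x, hx, rfl⟩) <;> exact hx
  have hn : U.ncard + I.ncard = (f ⁻¹' U).ncard + (g ⁻¹' U).ncard := by
    have h1 := Set.ncard_union_add_ncard_inter (f '' (f ⁻¹' U)) (g '' (g ⁻¹' U))
    rwa [← hUu, ← hgI, Set.ncard_image_of_injective _ f.injective,
      Set.ncard_image_of_injective _ g.injective,
      Set.ncard_image_of_injective _ g.injective] at h1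
  have hIb : I.ncard ≤ (g ⁻¹' U).ncard := Set.ncard_le_ncard Set.inter_subset_right
  have hIa : I.ncard ≤ (f ⁻¹' U).ncard := by
    rw [← Set.ncard_image_of_injective I g.injective,
      ← Set.ncard_image_of_injective _ f.injective, hgI]
    exact Set.ncard_le_ncard Set.inter_subset_left
  have hIk : I.ncard ≤ k := by
    refine (Set.ncard_le_ncard (t := Set.range ψ) Set.inter_subset_left).trans ?_
    rw [← Set.image_univ]
    refine (Set.ncard_image_le (Set.toFinite _)).trans ?_
    rw [Set.ncard_univ, Nat.card_eq_fintype_card, Fintype.card_fin]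
  have hsub : pairsIn I ⊆ edgesIn B (g ⁻¹' U) := by
    intro e he
    exact ⟨h.pairsIn_subset ⟨he.1, fun x hx => (he.2 x hx).1⟩, fun x hx => (he.2 x hx).2⟩
  have hdiff : edgesIn B (g ⁻¹' U) \ pairsIn (Set.range ψ) ⊆
      edgesIn B (g ⁻¹' U) \ pairsIn I := by
    rintro e ⟨h1, h2⟩
    exact ⟨h1, fun h3 => h2 ⟨h3.1, fun x hx => (h3.2 x hx).1⟩⟩
  have hedges : edgesIn G U ⊆ Sym2.map f '' edgesIn A (f ⁻¹' U) ∪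
      Sym2.map g '' (edgesIn B (g ⁻¹' U) \ pairsIn I) := by
    rintro e ⟨he, heU⟩
    rw [h.edgeSet] at he
    rcases he with ⟨e', he', rfl⟩ | ⟨e', he', rfl⟩
    · exact Or.inl ⟨e', ⟨he', fun x hx => heU _ (Sym2.mem_map.2 ⟨x, hx, rfl⟩)⟩, rfl⟩
    · exact Or.inr ⟨e', hdiff ⟨⟨he'.1, fun x hx => heU _ (Sym2.mem_map.2 ⟨x, hx, rfl⟩)⟩, he'.2⟩,
        rfl⟩
  have he : (edgesIn G U).ncard + I.ncard.choose 2 ≤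
      (edgesIn A (f ⁻¹' U)).ncard + (edgesIn B (g ⁻¹' U)).ncard := by
    have h1 := (Set.ncard_le_ncard hedges).trans (Set.ncard_union_le _ _)
    rw [Set.ncard_image_of_injective _ (Sym2.map.injective f.injective),
      Set.ncard_image_of_injective _ (Sym2.map.injective g.injective)] at h1
    have h2 := Set.ncard_sdiff_add_ncard_of_subset hsub
    rw [ncard_pairsIn] at h2
    omega
  have ha := ncard_edgesIn_le_choose A (f ⁻¹' U)
  have hb := ncard_edgesIn_le_choose B (g ⁻¹' U)
  have ha3 := hA.ncard_edgesIn_add_six_le (U := f ⁻¹' U)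
  have hb3 := hB.ncard_edgesIn_add_six_le (U := g ⁻¹' U)
  have ha5 := hA.ncard_edgesIn_add_seven_le hA' (U := f ⁻¹' U)
  have hb5 := hB.ncard_edgesIn_add_seven_le hB' (U := g ⁻¹' U)
  have hk4 : ¬ (I.ncard = 3 ∧ (f ⁻¹' U).ncard = 4 ∧ (g ⁻¹' U).ncard = 4 ∧
      6 ≤ (edgesIn A (f ⁻¹' U)).ncard ∧ 6 ≤ (edgesIn B (g ⁻¹' U)).ncard) := by
    rintro ⟨h1, h2, h3, h4, h5⟩
    have hk3 : k = 3 := le_antisymm h.le_three (h1 ▸ hIk)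
    have hI : I = Set.range ψ := by
      refine Set.eq_of_subset_of_ncard_le Set.inter_subset_left ?_
      rw [h1, ← hk3, ← Set.image_univ]
      refine (Set.ncard_image_le (Set.toFinite _)).trans ?_
      rw [Set.ncard_univ, Nat.card_eq_fintype_card, Fintype.card_fin]
    have hψ (i) : ψ i ∈ g ⁻¹' U := by
      have h6 : ψ i ∈ I := by rw [hI]; exact ⟨i, rfl⟩
      exact h6.2
    have hφ (i) : φ i ∈ f ⁻¹' U := by
      change f (φ i) ∈ U
      rw [h.glue]
      exact hψ i
    rcases hK hk3 with h6 | h6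
    · exact h6 (inK4_of_ncard h2 h4 hφ)
    · exact h6 (inK4_of_ncard h3 h5 hψ)
  have hk3 := h.le_three
  exact pasting_count hn hU hIa hIb (hIk.trans h.le_three) he ha hb ha3 hb3 ha5 hb5 hk4

end Pasting

/-! ### Cut graphs -/

section Cut
variable {V : Type*} {W : Type*}

/-- The map that undoes the splitting of `a` and `b`. -/
def uncut (a b : V) : V ⊕ Fin 2 → V := Sum.elim id ![a, b]

theorem uncut_cutEnd (a b : V) (side : Sym2 V → Bool) (e : Sym2 V) (x : V) :
    uncut a b (cutEnd a b side e x) = x := by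
  unfold cutEnd
  split_ifs with h1 h2
  · exact h1.2.symm
  · exact h2.2.symm
  · rfl

/-- The copy of the edge `e` in the cut graph. -/
def cutEdge (a b : V) (side : Sym2 V → Bool) (e : Sym2 V) : Sym2 (V ⊕ Fin 2) :=
  e.map (cutEnd a b side e)

theorem map_uncut_cutEdge (a b : V) (side : Sym2 V → Bool) (e : Sym2 V) :
    (cutEdge a b side e).map (uncut a b) = e := by
  rw [cutEdge, Sym2.map_map]
  have : uncut a b ∘ cutEnd a b side e = id := funext (uncut_cutEnd a b side e)
  rw [this, Sym2.map_id, id]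

theorem edgeSet_graphCut (H : SimpleGraph V) (a b : V) (side : Sym2 V → Bool) :
    (graphCut H a b side).edgeSet = cutEdge a b side '' H.edgeSet := by
  ext e
  induction e with | _ z t =>
  constructor
  · rintro ⟨x, y, h, rfl, rfl⟩
    exact ⟨s(x, y), h, rfl⟩
  · rintro ⟨e, he, h⟩
    induction e with | _ x y =>
    rw [cutEdge, Sym2.map_mk, Sym2.eq_iff] at h
    rcases h with ⟨rfl, rfl⟩ | ⟨rfl, rfl⟩
    · exact ⟨x, y, he, rfl, rfl⟩
    · exact ⟨y, x, H.adj_symm he, by rw [Sym2.eq_swap], by rw [Sym2.eq_swap]⟩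

theorem map_uncut_edgeSet (H : SimpleGraph V) (a b : V) (side : Sym2 V → Bool) :
    Sym2.map (uncut a b) '' (graphCut H a b side).edgeSet = H.edgeSet := by
  rw [edgeSet_graphCut, Set.image_image]
  simp [map_uncut_cutEdge]

theorem injOn_map_uncut (H : SimpleGraph V) (a b : V) (side : Sym2 V → Bool) :
    Set.InjOn (Sym2.map (uncut a b)) (graphCut H a b side).edgeSet := by
  rw [edgeSet_graphCut]
  rintro _ ⟨e, -, rfl⟩ _ ⟨e', -, rfl⟩ h
  rw [map_uncut_cutEdge, map_uncut_cutEdge] at h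
  rw [h]

theorem adj_uncut {H : SimpleGraph V} {a b : V} {side : Sym2 V → Bool} {z t : V ⊕ Fin 2}
    (h : (graphCut H a b side).Adj z t) : H.Adj (uncut a b z) (uncut a b t) := by
  obtain ⟨x, y, hxy, rfl, rfl⟩ := h
  rwa [uncut_cutEnd, uncut_cutEnd]

/-- Place both copies of a split vertex at the position of the original. Folding back maps the edges
bijectively to those of `H`, whose rows are independent. -/
theorem isIndependent_graphCut [Finite V] {H : SimpleGraph V} (hH : IsIndependent H) (a b : V)
    (side : Sym2 V → Bool) : IsIndependent (graphCut H a b side) := by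
  cases nonempty_fintype V
  obtain ⟨p, hp⟩ := exists_inGeneralPosition V
  refine isIndependent_iff_exists.2 ⟨p ∘ uncut a b, ?_⟩
  refine linearIndepOn_comp (injOn_map_uncut H a b side) ?_
  rw [map_uncut_edgeSet]
  exact hH.linearIndepOn hp

theorem InK4.of_graphCut {H : SimpleGraph V} {a b : V} {side : Sym2 V → Bool} {ι : Type*}
    {x : ι → V} (h : InK4 (graphCut H a b side) (Sum.inl ∘ x)) : InK4 H x := by
  obtain ⟨s, ⟨hs, hc⟩, hx⟩ := h
  rw [SimpleGraph.isClique_iff] at hs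
  refine ⟨s.image (uncut a b), ⟨?_, ?_⟩, fun i => ?_⟩
  · rw [SimpleGraph.isClique_iff]
    intro z hz t ht hzt
    rw [Finset.mem_coe, Finset.mem_image] at hz ht
    obtain ⟨z, hz, rfl⟩ := hz
    obtain ⟨t, ht, rfl⟩ := ht
    exact adj_uncut (hs hz ht fun h => hzt (h ▸ rfl))
  · rw [Finset.card_image_of_injOn, hc]
    intro z hz t ht hzt
    by_contra hne
    exact (adj_uncut (hs hz ht hne)).ne hzt
  · exact Finset.mem_image.2 ⟨_, hx i, rfl⟩

end Cut

/-! ### Extending a tight cover by new edges -/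

section Extend
variable {V : Type*} {W : Type*} {f : V ↪ W} {N : Finset (Sym2 W)} {𝒳 : Finset (Finset V)}

/-- The cover by the images of the members of `𝒳` and by the pairs in `N`. -/
def extendCover (f : V ↪ W) (𝒳 : Finset (Finset V)) (N : Finset (Sym2 W)) :
    Finset (Finset W) :=
  𝒳.image (Finset.map f) ∪ N.image Sym2.toFinset

theorem mem_extendCover {X : Finset W} :
    X ∈ extendCover f 𝒳 N ↔ (∃ Y ∈ 𝒳, Y.map f = X) ∨ ∃ e ∈ N, e.toFinset = X := by
  simp [extendCover]

/-- `N` consists of pairs of distinct elements, not both in the range of `f`. -/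
def IsNew (f : V ↪ W) (N : Finset (Sym2 W)) : Prop :=
  ∀ e ∈ N, ¬ e.IsDiag ∧ ∃ x ∈ e, x ∉ Set.range f

theorem card_toFinset_of_isNew (hN : IsNew f N) {e : Sym2 W} (he : e ∈ N) :
    e.toFinset.card = 2 := Sym2.card_toFinset_of_not_isDiag e (hN e he).1

theorem toFinset_inj {α : Type*} [DecidableEq α] {e e' : Sym2 α} (h : e.toFinset = e'.toFinset) : e = e' := by
  ext x
  rw [← Sym2.mem_toFinset, h, Sym2.mem_toFinset]

theorem not_toFinset_subset_map (hN : IsNew f N) {e : Sym2 W} (he : e ∈ N) (Y : Finset V) :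
    ¬ e.toFinset ⊆ Y.map f := by
  intro h
  obtain ⟨x, hx, hxf⟩ := (hN e he).2
  obtain ⟨y, -, rfl⟩ := Finset.mem_map.1 (h (Sym2.mem_toFinset.2 hx))
  exact hxf ⟨y, rfl⟩

theorem isTwoThin_extendCover (h : IsTwoThin 𝒳) (hN : IsNew f N) :
    IsTwoThin (extendCover f 𝒳 N) := by
  intro X hX Y hY hne
  rw [mem_extendCover] at hX hY
  rcases hX with ⟨X, hX, rfl⟩ | ⟨e, he, rfl⟩
  · rcases hY with ⟨Y, hY, rfl⟩ | ⟨e, he, rfl⟩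
    · have h1 := h X hX Y hY fun h => hne (h ▸ rfl)
      rw [← Finset.card_map f] at h1
      convert! h1 using 2
      ext x
      simp only [Finset.mem_inter, Finset.mem_map]
      constructor
      · rintro ⟨⟨x, hx, rfl⟩, ⟨y, hy, hxy⟩⟩
        rw [f.injective hxy] at hy
        exact ⟨x, ⟨hx, hy⟩, rfl⟩
      · rintro ⟨x, hx, rfl⟩
        exact ⟨⟨x, hx.1, rfl⟩, ⟨x, hx.2, rfl⟩⟩
    · rw [← card_toFinset_of_isNew hN he]
      exact Finset.card_le_card Finset.inter_subset_right
  · rw [← card_toFinset_of_isNew hN he]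
    exact Finset.card_le_card Finset.inter_subset_left

theorem pairDegree_le_extendCover (e : Sym2 V) :
    pairDegree 𝒳 e ≤ pairDegree (extendCover f 𝒳 N) (e.map f) := by
  refine Finset.card_le_card_of_injOn (Finset.map f) (fun X hX => ?_)
    (Finset.map_injective f).injOn
  rw [Finset.mem_coe, Finset.mem_filter] at hX ⊢
  refine ⟨mem_extendCover.2 (Or.inl ⟨X, hX.1, rfl⟩), fun x hx => ?_⟩
  obtain ⟨y, hy, rfl⟩ := Sym2.mem_map.1 hx
  simpa using hX.2 y hy

theorem mk_eq_of_mem {e : Sym2 W} {x y : W} (hxy : x ≠ y)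
    (hx : x ∈ e) (hy : y ∈ e) : s(x, y) = e :=
  ((Sym2.mem_and_mem_iff hxy).1 ⟨hx, hy⟩).symm

/-- A new pair has an end outside the range of `f`, so no other member contains it and it is never
shared. -/
theorem edgeSet_sharedGraph_extendCover (h : IsTwoThin 𝒳) (hN : IsNew f N) :
    (sharedGraph (extendCover f 𝒳 N)).edgeSet = Sym2.map f '' (sharedGraph 𝒳).edgeSet := by
  ext e
  induction e with | _ x y =>
  rw [SimpleGraph.mem_edgeSet, sharedGraph_adj_iff (isTwoThin_extendCover h hN)]
  constructor
  · rintro ⟨hxy, hd⟩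
    obtain ⟨X, hX, Y, hY, hne, hX', hY'⟩ := exists_of_two_le_pairDegree hd
    have hxX := hX' x (by simp)
    have hyX := hX' y (by simp)
    have hxY := hY' x (by simp)
    have hyY := hY' y (by simp)
    rw [mem_extendCover] at hX hY
    have key : ∀ e ∈ N, x ∈ e → y ∈ e → ∀ Z ∈ extendCover f 𝒳 N, x ∈ Z → y ∈ Z →
        Z = e.toFinset := by
      intro e he hx hy Z hZ hxZ hyZ
      have h1 := mk_eq_of_mem hxy hx hy
      have h2 : e.toFinset ⊆ Z := by
        intro z hz
        rw [Sym2.mem_toFinset, ← h1, Sym2.mem_iff] at hz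
        rcases hz with rfl | rfl <;> assumption
      rcases mem_extendCover.1 hZ with ⟨Z, -, rfl⟩ | ⟨e', he', rfl⟩
      · exact absurd h2 (not_toFinset_subset_map hN he Z)
      · refine (Finset.eq_of_subset_of_card_le h2 ?_).symm
        rw [card_toFinset_of_isNew hN he, card_toFinset_of_isNew hN he']
    rcases hX with ⟨X, hX, rfl⟩ | ⟨e, he, rfl⟩
    · rcases hY with ⟨Y, hY, rfl⟩ | ⟨e, he, rfl⟩
      · obtain ⟨x, hx, rfl⟩ := Finset.mem_map.1 hxX
        obtain ⟨y, hy, rfl⟩ := Finset.mem_map.1 hyX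
        rw [Finset.mem_map' f] at hxY hyY
        refine ⟨s(x, y), ?_, rfl⟩
        rw [SimpleGraph.mem_edgeSet, sharedGraph_adj_iff h]
        refine ⟨fun h => hxy (h ▸ rfl), Finset.one_lt_card.2 ⟨X, ?_, Y, ?_, fun h => hne (h ▸ rfl)⟩⟩
        · simp [*]
        · simp [*]
      · exact absurd (key e he (by simpa using hxY) (by simpa using hyY) (X.map f)
          (mem_extendCover.2 (Or.inl ⟨X, hX, rfl⟩)) hxX hyX) hne
    · exact absurd (key e he (by simpa using hxX) (by simpa using hyX) Y
        (mem_extendCover.2 hY) hxY hyY).symm hne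
  · rintro ⟨e, he, h1⟩
    induction e with | _ x' y' =>
    rw [SimpleGraph.mem_edgeSet, sharedGraph_adj_iff h] at he
    have h2 := pairDegree_le_extendCover (f := f) (N := N) (𝒳 := 𝒳) s(x', y')
    rw [h1] at h2
    refine ⟨?_, he.2.trans h2⟩
    rw [Sym2.map_mk, Sym2.eq_iff] at h1
    rcases h1 with ⟨rfl, rfl⟩ | ⟨rfl, rfl⟩
    · exact fun h => he.1 (f.injective h)
    · exact fun h => he.1 (f.injective h).symm

theorem excess_le_extendCover [Fintype V] [Fintype W] :
    excess 𝒳 ≤ excess (extendCover f 𝒳 N) := by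
  have hinj : Function.Injective (Sym2.map f) := Sym2.map.injective f.injective
  calc excess 𝒳 ≤ ∑ e : Sym2 V with ¬ e.IsDiag, (pairDegree (extendCover f 𝒳 N) (e.map f) - 1) :=
        Finset.sum_le_sum fun e _ => Nat.sub_le_sub_right (pairDegree_le_extendCover e) 1
    _ = ∑ e ∈ ({e : Sym2 V | ¬ e.IsDiag} : Finset _).image (Sym2.map f),
          (pairDegree (extendCover f 𝒳 N) e - 1) := by
        rw [Finset.sum_image hinj.injOn]
    _ ≤ _ := by
        refine Finset.sum_le_sum_of_subset fun e he => ?_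
        rw [Finset.mem_image] at he
        obtain ⟨e, he, rfl⟩ := he
        rw [Finset.mem_filter] at he ⊢
        exact ⟨Finset.mem_univ _, fun h => he.2 ((Sym2.isDiag_map f.injective).1 h)⟩

variable {H : SimpleGraph V} {G : SimpleGraph W}

theorem isCover_extendCover (hc : IsCover H 𝒳) (hN : IsNew f N)
    (hG : G.edgeSet = Sym2.map f '' H.edgeSet ∪ N) : IsCover G (extendCover f 𝒳 N) := by
  refine ⟨fun X hX => ?_, fun X hX Y hY hXY => ?_, fun x y hxy => ?_⟩
  · rcases mem_extendCover.1 hX with ⟨X, hX', rfl⟩ | ⟨e, he, rfl⟩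
    · rw [Finset.card_map]
      exact hc.two_le_card X hX'
    · exact (card_toFinset_of_isNew hN he).ge
  · rcases mem_extendCover.1 hX with ⟨X, hX', rfl⟩ | ⟨e, he, rfl⟩
    · rcases mem_extendCover.1 hY with ⟨Y, hY', rfl⟩ | ⟨e, he, rfl⟩
      · rw [hc.incomparable X hX' Y hY' (Finset.map_subset_map.1 hXY)]
      · refine Finset.eq_of_subset_of_card_le hXY ?_
        rw [card_toFinset_of_isNew hN he, Finset.card_map]
        exact hc.two_le_card X hX'
    · rcases mem_extendCover.1 hY with ⟨Y, hY', rfl⟩ | ⟨e', he', rfl⟩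
      · exact absurd hXY (not_toFinset_subset_map hN he Y)
      · refine Finset.eq_of_subset_of_card_le hXY ?_
        rw [card_toFinset_of_isNew hN he, card_toFinset_of_isNew hN he']
  · have h1 : s(x, y) ∈ Sym2.map f '' H.edgeSet ∪ N := hG ▸ hxy
    rcases h1 with ⟨e, he, h2⟩ | he
    · induction e with | _ x' y' =>
      obtain ⟨X, hX, hx, hy⟩ := hc.covers x' y' he
      refine ⟨X.map f, mem_extendCover.2 (Or.inl ⟨X, hX, rfl⟩), ?_⟩
      rw [Sym2.map_mk, Sym2.eq_iff] at h2
      rcases h2 with ⟨rfl, rfl⟩ | ⟨rfl, rfl⟩ <;> simp [hx, hy]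
    · exact ⟨_, mem_extendCover.2 (Or.inr ⟨_, he, rfl⟩), by simp, by simp⟩

theorem edgeSet_starGraph (H : SimpleGraph V) (𝒳 : Finset (Finset V)) :
    (starGraph H 𝒳).edgeSet = H.edgeSet ∪ (sharedGraph 𝒳).edgeSet :=
  SimpleGraph.edgeSet_sup _ _

theorem edgeSet_starGraph_extendCover (h : IsTwoThin 𝒳) (hN : IsNew f N)
    (hG : G.edgeSet = Sym2.map f '' H.edgeSet ∪ N) :
    (starGraph G (extendCover f 𝒳 N)).edgeSet = Sym2.map f '' (starGraph H 𝒳).edgeSet ∪ N := by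
  rw [edgeSet_starGraph, edgeSet_starGraph, hG, edgeSet_sharedGraph_extendCover h hN,
    Set.image_union, Set.union_right_comm]

theorem edgesIn_starGraph_extendCover (h : IsTwoThin 𝒳) (hN : IsNew f N)
    (hG : G.edgeSet = Sym2.map f '' H.edgeSet ∪ N) (X : Finset V) :
    edgesIn (starGraph G (extendCover f 𝒳 N)) (X.map f : Finset W) ⊆
      Sym2.map f '' edgesIn (starGraph H 𝒳) X := by
  rintro e ⟨he, heX⟩
  rw [edgeSet_starGraph_extendCover h hN hG] at he
  rcases he with ⟨e, he, rfl⟩ | he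
  · refine ⟨e, ⟨he, fun x hx => ?_⟩, rfl⟩
    have := heX (f x) (Sym2.mem_map.2 ⟨x, hx, rfl⟩)
    simpa using this
  · obtain ⟨x, hx, hxf⟩ := (hN e he).2
    obtain ⟨y, -, rfl⟩ := Finset.mem_map.1 (Finset.mem_coe.1 (heX x hx))
    exact absurd ⟨y, rfl⟩ hxf

/-- As `G` is independent, every new edge raises the rank by one, and as a two-element member it
adds at most one to the sum of ranks. The excess does not fall. -/
theorem isTightCover_extendCover [Finite V] [Finite W] (ht : IsTightCover H 𝒳)
    (hN : IsNew f N) (hG : G.edgeSet = Sym2.map f '' H.edgeSet ∪ N) (hind : IsIndependent G) :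
    IsTightCover G (extendCover f 𝒳 N) := by
  cases nonempty_fintype V
  cases nonempty_fintype W
  obtain ⟨p, hp⟩ := exists_inGeneralPosition W
  have h2 := isTwoThin_extendCover ht.twoThin hN
  refine isTightCover_of_le (isCover_extendCover ht.cover hN hG) h2 ?_ ?_
  · refine isIndependent_iff_exists.2 ⟨p, ?_⟩
    rw [edgeSet_sharedGraph_extendCover ht.twoThin hN, ← linearIndepOn_map_iff]
    exact ht.shared_independent.linearIndepOn (hp.comp f)
  · have hdisj : Disjoint (Sym2.map f '' H.edgeSet) (N : Set (Sym2 W)) := by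
      rw [Set.disjoint_left]
      rintro _ ⟨e, -, rfl⟩ he
      obtain ⟨x, hx, hxf⟩ := (hN _ he).2
      obtain ⟨y, -, rfl⟩ := Sym2.mem_map.1 hx
      exact hxf ⟨y, rfl⟩
    have hrank : genRank H.edgeSet + N.card ≤ genRank G.edgeSet := by
      rw [isIndependent_iff_genRank.1 hind, hG, Set.ncard_union_eq hdisj, Set.ncard_coe_finset,
        Set.ncard_image_of_injective _ (Sym2.map.injective f.injective)]
      exact Nat.add_le_add_right (genRank_le_ncard _) _
    have hex : excess 𝒳 ≤ excess (extendCover f 𝒳 N) := excess_le_extendCover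
    have hsum := ht.sum_genRank
    let F : Finset W → ℕ := fun X => genRank (edgesIn (starGraph G (extendCover f 𝒳 N)) X)
    have h3 : ∑ X ∈ extendCover f 𝒳 N, F X ≤
        ∑ X ∈ 𝒳.image (Finset.map f), F X + ∑ X ∈ N.image Sym2.toFinset, F X := by
      rw [extendCover, ← Finset.sum_union_inter]
      exact Nat.le_add_right _ _
    have h4 : ∑ X ∈ 𝒳.image (Finset.map f), F X ≤
        ∑ X ∈ 𝒳, genRank (edgesIn (starGraph H 𝒳) (X : Set V)) := by
      rw [Finset.sum_image (Finset.map_injective f).injOn]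
      refine Finset.sum_le_sum fun X _ => ?_
      rw [← genRank_map f]
      exact genRank_mono (edgesIn_starGraph_extendCover ht.twoThin hN hG X)
    have h5 : ∑ X ∈ N.image Sym2.toFinset, F X ≤ N.card := by
      refine (Finset.sum_le_card_nsmul _ _ 1 fun X hX => ?_).trans ?_
      · obtain ⟨e, he, rfl⟩ := Finset.mem_image.1 hX
        refine (genRank_le_ncard _).trans ((ncard_edgesIn_le_choose _ _).trans ?_)
        rw [Set.ncard_coe_finset, card_toFinset_of_isNew hN he]
        simp
      · rw [smul_eq_mul, mul_one]
        exact Finset.card_image_le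
    have h6 : ∑ X ∈ extendCover f 𝒳 N, F X ≤ genRank G.edgeSet + excess (extendCover f 𝒳 N) := by
      omega
    exact h6

theorem isSharedNonedge_extendCover (h : IsTwoThin 𝒳) (hN : IsNew f N)
    (hG : G.edgeSet = Sym2.map f '' H.edgeSet ∪ N) {x y : W} :
    IsSharedNonedge G (extendCover f 𝒳 N) x y ↔
      ∃ x' y', f x' = x ∧ f y' = y ∧ IsSharedNonedge H 𝒳 x' y' := by
  have hinj : Function.Injective (Sym2.map f) := Sym2.map.injective f.injective
  have hadj (x' y' : V) : G.Adj (f x') (f y') ↔ H.Adj x' y' := by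
    rw [← SimpleGraph.mem_edgeSet, hG, ← Sym2.map_mk, Set.mem_union, hinj.mem_set_image,
      SimpleGraph.mem_edgeSet, or_iff_left]
    intro he
    obtain ⟨z, hz, hzf⟩ := (hN _ he).2
    obtain ⟨z', -, rfl⟩ := Sym2.mem_map.1 hz
    exact hzf ⟨z', rfl⟩
  have hsh := edgeSet_sharedGraph_extendCover h hN
  constructor
  · rintro ⟨h1, h2⟩
    rw [← SimpleGraph.mem_edgeSet, hsh] at h1
    obtain ⟨e, he, h3⟩ := h1
    induction e with | _ x' y' =>
    rw [Sym2.map_mk, Sym2.eq_iff] at h3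
    rcases h3 with ⟨rfl, rfl⟩ | ⟨rfl, rfl⟩
    · exact ⟨x', y', rfl, rfl, he, fun h => h2 ((hadj _ _).2 h)⟩
    · exact ⟨y', x', rfl, rfl, SimpleGraph.adj_symm _ he, fun h => h2 ((hadj _ _).2 h)⟩
  · rintro ⟨x', y', rfl, rfl, h1, h2⟩
    refine ⟨?_, fun h => h2 ((hadj _ _).1 h)⟩
    rw [← SimpleGraph.mem_edgeSet, hsh]
    exact ⟨s(x', y'), h1, rfl⟩

/-- The distribution of edges that agrees with `side` on the old pairs and assigns the new ones to
the first side. -/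
def extendSide (f : V ↪ W) (side : Sym2 V → Bool) : Sym2 W → Bool :=
  Function.extend (Sym2.map f) side fun _ => true

theorem extendSide_map (f : V ↪ W) (side : Sym2 V → Bool) (e : Sym2 V) :
    extendSide f side (e.map f) = side e :=
  (Sym2.map.injective f.injective).extend_apply _ _ _

theorem respectsCover_extendCover (h : IsTwoThin 𝒳) (hN : IsNew f N)
    (hG : G.edgeSet = Sym2.map f '' H.edgeSet ∪ N) {a b : V} {side : Sym2 V → Bool}
    (hr : RespectsCover H 𝒳 a b side) :
    RespectsCover G (extendCover f 𝒳 N) (f a) (f b) (extendSide f side) := by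
  rintro X hX ⟨x, hx, y, hy, hxy⟩
  have hxy' := hxy.1.ne
  rw [isSharedNonedge_extendCover h hN hG] at hxy
  obtain ⟨x, y, rfl, rfl, hxy⟩ := hxy
  rcases mem_extendCover.1 hX with ⟨X, hX', rfl⟩ | ⟨e, he, rfl⟩
  · rw [Finset.mem_map' f] at hx hy
    obtain ⟨i, hi⟩ := hr X hX' ⟨x, hx, y, hy, hxy⟩
    refine ⟨i, ?_⟩
    intro z hz t ht hzt hab hne
    have h1 : s(z, t) ∈ edgesIn (starGraph G (extendCover f 𝒳 N)) (X.map f : Finset W) :=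
      mk_mem_edgesIn.2 ⟨hzt, hz, ht⟩
    obtain ⟨z, hzX, rfl⟩ := Finset.mem_map.1 hz
    obtain ⟨t, htX, rfl⟩ := Finset.mem_map.1 ht
    have h2 := edgesIn_starGraph_extendCover h hN hG X h1
    rw [← Sym2.map_mk, (Sym2.map.injective f.injective).mem_set_image, mk_mem_edgesIn] at h2
    rw [← Sym2.map_mk, extendSide_map]
    refine hi z hzX t htX h2.1 (hab.imp (fun h => f.injective h) fun h => f.injective h) ?_
    exact fun h => hne (congrArg (Sym2.map f) h)
  -- A shared non-edge comes from `V`, but a member given by a new edge has an end outside `V`.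
  · exfalso
    rw [Sym2.mem_toFinset] at hx hy
    obtain ⟨z, hz, hzf⟩ := (hN e he).2
    rw [← mk_eq_of_mem hxy' hx hy, Sym2.mem_iff] at hz
    rcases hz with rfl | rfl
    · exact hzf ⟨x, rfl⟩
    · exact hzf ⟨y, rfl⟩

theorem cutEnd_extend (f : V ↪ W) (a b : V) (side : Sym2 V → Bool) (e : Sym2 V) (x : V) :
    cutEnd (f a) (f b) (extendSide f side) (e.map f) (f x) =
      Sum.map f id (cutEnd a b side e x) := by
  unfold cutEnd
  rw [extendSide_map]
  simp only [f.injective.eq_iff]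
  split_ifs <;> rfl

theorem cutEdge_extend (f : V ↪ W) (a b : V) (side : Sym2 V → Bool) (e : Sym2 V) :
    cutEdge (f a) (f b) (extendSide f side) (e.map f) =
      (cutEdge a b side e).map (Sum.map f id) := by
  rw [cutEdge, cutEdge, Sym2.map_map, Sym2.map_map]
  congr 1
  ext1 x
  exact cutEnd_extend f a b side e x

theorem cutEdge_of_side_eq_true {a b : V} {side : Sym2 V → Bool} {e : Sym2 V}
    (h : side e = true) : cutEdge a b side e = e.map Sum.inl := by
  rw [cutEdge]
  congr 1
  ext1 x
  simp [cutEnd, h]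

end Extend

/-! ### Admissible cuts under pasting. -/

namespace IsPasting
variable {V V₁ W : Type*} {k : ℕ} {A : SimpleGraph V} {B : SimpleGraph V₁} {G : SimpleGraph W}
  {φ : Fin k → V} {ψ : Fin k → V₁} {f : V ↪ W} {g : V₁ ↪ W}

/-- All new edges go to the first side, so `B` is pasted at `a₁`, `b₁`. The cut may move edges of
the clique in `A` to the second side, which is why a pasting does not ask for the clique in `A`. -/
theorem graphCut (h : IsPasting A B G φ ψ f g) (a b : V) (side : Sym2 V → Bool) :
    IsPasting (graphCut A a b side) B (graphCut G (f a) (f b) (extendSide f side))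
      (Sum.inl ∘ φ) ψ (f.sumMap (Function.Embedding.refl (Fin 2)))
      (g.trans Function.Embedding.inl) := by
  refine ⟨h.le_three, h.injective, h.clique, fun i => ?_, ?_, ?_, ?_⟩
  · exact congrArg Sum.inl (h.glue i)
  · rintro (x | x) y hxy
    · obtain ⟨i, rfl, rfl⟩ := h.inter x y (Sum.inl_injective hxy)
      exact ⟨i, rfl, rfl⟩
    · cases hxy
  · rintro (z | z)
    · rcases h.union z with ⟨x, rfl⟩ | ⟨x, rfl⟩
      · exact Or.inl ⟨Sum.inl x, rfl⟩
      · exact Or.inr ⟨x, rfl⟩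
    · exact Or.inl ⟨Sum.inr z, rfl⟩
  · rw [edgeSet_graphCut, edgeSet_graphCut, h.edgeSet, Set.image_union, Set.image_image,
      Set.image_image, Set.image_image]
    congr 1
    · refine Set.image_congr fun e _ => ?_
      exact cutEdge_extend f a b side e
    · refine Set.image_congr fun e he => ?_
      rw [cutEdge_of_side_eq_true]
      · rw [Sym2.map_map]; rfl
      · refine Function.extend_apply' _ _ _ ?_
        rintro ⟨e', he'⟩
        obtain ⟨x, hx, hxf⟩ := h.not_mem_range he
        rw [← he'] at hx
        obtain ⟨y, -, rfl⟩ := Sym2.mem_map.1 hx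
        exact hxf ⟨y, rfl⟩

/-- Pasting an independent nucleation-free graph keeps starting graphs. -/
theorem isStartingGraph [Finite V] [Finite V₁] [Finite W] (h : IsPasting A B G φ ψ f g)
    (hA : IsStartingGraph A) (hB : IsIndependent B) (hB' : IsNucleationFree B)
    (hK : k = 3 → ¬ InK4 A φ ∨ ¬ InK4 B ψ) : IsStartingGraph G := by
  cases nonempty_fintype W
  obtain ⟨hind, 𝒳, a, b, side, hcut⟩ := hA
  let N : Finset (Sym2 W) := (Sym2.map g '' (B.edgeSet \ pairsIn (Set.range ψ))).toFinset
  have hNc : (N : Set (Sym2 W)) = Sym2.map g '' (B.edgeSet \ pairsIn (Set.range ψ)) :=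
    Set.coe_toFinset _
  have hG : G.edgeSet = Sym2.map f '' A.edgeSet ∪ N := by rw [hNc, h.edgeSet]
  have hN : IsNew f N := by
    intro e he
    have he' : e ∈ G.edgeSet := by rw [hG]; exact Or.inr he
    rw [← Finset.mem_coe, hNc] at he
    refine ⟨G.not_isDiag_of_mem_edgeSet he', ?_⟩
    obtain ⟨e, he, rfl⟩ := he
    exact h.not_mem_range he
  have hGi := h.isIndependent hind hB
  refine ⟨hGi, extendCover f 𝒳 N, f a, f b, extendSide f side, ?_, ?_, ?_, ?_⟩
  · exact isTightCover_extendCover hcut.tight hN hG hGi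
  · exact (isSharedNonedge_extendCover hcut.tight.twoThin hN hG).2
      ⟨a, b, rfl, rfl, hcut.shared_nonedge⟩
  · exact respectsCover_extendCover hcut.tight.twoThin hN hG hcut.respects
  -- Folding back maps a K₄ of the cut graph to a K₄ of `A`, so the condition on the common triangle
  -- survives the cut.
  · exact (h.graphCut a b side).isNucleationFree (isIndependent_graphCut hind a b side) hB
      hcut.nucleationFree hB' fun hk => (hK hk).imp (fun h h' => h h'.of_graphCut) id

end IsPasting

theorem IsStartingGraph.isGoodStartingGraph {V : Type*} [Finite V] {G : SimpleGraph V}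
    (h : IsStartingGraph G) (hnf : IsNucleationFree G) : IsGoodStartingGraph G := by
  obtain ⟨hind, 𝒳, a, b, side, hcut⟩ := h
  exact ⟨⟨hind, 𝒳, a, b, side, hcut⟩, hind, hnf,
    a, b, hcut.tight.isImpliedNonedge hcut.shared_nonedge⟩

theorem IsPasting.isGoodStartingGraph {V V₁ W : Type*} {k : ℕ} [Finite V] [Finite V₁] [Finite W]
    {A : SimpleGraph V} {B : SimpleGraph V₁} {G : SimpleGraph W}
    {φ : Fin k → V} {ψ : Fin k → V₁} {f : V ↪ W} {g : V₁ ↪ W} (h : IsPasting A B G φ ψ f g)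
    (hA : IsStartingGraph A) (hA' : IsNucleationFree A) (hB : IsIndependent B)
    (hB' : IsNucleationFree B) (hK : k = 3 → ¬ InK4 A φ ∨ ¬ InK4 B ψ) :
    IsGoodStartingGraph G :=
  (h.isStartingGraph hA hB hB' hK).isGoodStartingGraph
    (h.isNucleationFree hA.1 hB hA' hB' hK)

/-! ### Roofs -/

section Roofs
variable {V : Type*} {W : Type*}

/-- The eight edges of a roof. -/
def roofEdges (x y s t c : V) : Set (Sym2 V) :=
  {s(x, s), s(x, t), s(y, s), s(y, t), s(c, x), s(c, y), s(c, s), s(c, t)}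

theorem roofEdges_swap (x y s t c : V) : roofEdges x y s t c = roofEdges s t x y c := by
  ext e
  simp only [roofEdges, Set.mem_insert_iff, Set.mem_singleton_iff, Sym2.eq_swap (a := s),
    Sym2.eq_swap (a := t)]
  tauto

theorem map_roofEdges (f : V → W) (x y s t c : V) :
    Sym2.map f '' roofEdges x y s t c = roofEdges (f x) (f y) (f s) (f t) (f c) := by
  simp only [roofEdges, Set.image_insert_eq, Set.image_singleton, Sym2.map_mk]

theorem edgeSet_roof {x y s t c : V} (h : [x, y, s, t, c].Nodup) :
    (roof x y s t c).edgeSet = roofEdges x y s t c := by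
  simp only [List.nodup_cons, List.mem_cons, List.not_mem_nil, or_false, not_or] at h
  obtain ⟨⟨h1, h2, h3, h4⟩, ⟨h5, h6, h7⟩, ⟨h8, h9⟩, h10, -⟩ := h
  ext e
  induction e with | _ z z' =>
  simp only [SimpleGraph.mem_edgeSet, roof, roofEdges, Set.mem_insert_iff, Set.mem_singleton_iff,
    Sym2.eq_iff]
  constructor
  · rintro ⟨hne, rfl | rfl | rfl | rfl | rfl, rfl | rfl | rfl | rfl | rfl, h11, h12⟩ <;>
      simp_all
  · rintro ((⟨rfl, rfl⟩ | ⟨rfl, rfl⟩) | (⟨rfl, rfl⟩ | ⟨rfl, rfl⟩) | (⟨rfl, rfl⟩ | ⟨rfl, rfl⟩) |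
      (⟨rfl, rfl⟩ | ⟨rfl, rfl⟩) | (⟨rfl, rfl⟩ | ⟨rfl, rfl⟩) | (⟨rfl, rfl⟩ | ⟨rfl, rfl⟩) |
      (⟨rfl, rfl⟩ | ⟨rfl, rfl⟩) | (⟨rfl, rfl⟩ | ⟨rfl, rfl⟩)) <;> simp_all [eq_comm]

/-- The roof with the hinge bar {x, y} is contained in a K₄ on x, y, s, c with t joined to x, y, c.
-/
theorem InGeneralPosition.linearIndepOn_roofEdges {p : V → Space} (hp : InGeneralPosition p)
    {x y s t c : V} (h : [x, y, s, t, c].Nodup) :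
    LinearIndepOn ℝ (rigidityRow p) (insert s(x, y) (roofEdges x y s t c)) := by
  simp only [List.nodup_cons, List.mem_cons, List.not_mem_nil, or_false, not_or] at h
  obtain ⟨⟨h1, h2, h3, h4⟩, ⟨h5, h6, h7⟩, ⟨h8, h9⟩, h10, -⟩ := h
  have h11 := hp.linearIndepOn_union_star (v := t) (N := {x, y, c})
    (hp.linearIndepOn_pairsIn (T := {x, y, s, c}) Finset.card_le_four)
    (fun e he hte => by
      have := he.2 t hte
      simp only [Finset.coe_insert, Finset.coe_singleton, Set.mem_insert_iff,
        Set.mem_singleton_iff] at this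
      rcases this with rfl | rfl | rfl | rfl <;> simp_all)
    (by simp only [Finset.mem_insert, Finset.mem_singleton]; tauto) Finset.card_le_three
  refine h11.mono ?_
  intro e he
  simp only [roofEdges, Set.mem_insert_iff, Set.mem_singleton_iff] at he
  rcases he with rfl | rfl | rfl | rfl | rfl | rfl | rfl | rfl | rfl
  · exact Or.inl (mk_mem_pairsIn.2 ⟨h1, by simp, by simp⟩)
  · exact Or.inl (mk_mem_pairsIn.2 ⟨h2, by simp, by simp⟩)
  · exact Or.inr ⟨x, by simp, Sym2.eq_swap⟩
  · exact Or.inl (mk_mem_pairsIn.2 ⟨h5, by simp, by simp⟩)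
  · exact Or.inr ⟨y, by simp, Sym2.eq_swap⟩
  · exact Or.inl (mk_mem_pairsIn.2 ⟨Ne.symm h4, by simp, by simp⟩)
  · exact Or.inl (mk_mem_pairsIn.2 ⟨Ne.symm h7, by simp, by simp⟩)
  · exact Or.inl (mk_mem_pairsIn.2 ⟨Ne.symm h9, by simp, by simp⟩)
  · exact Or.inr ⟨c, by simp, Sym2.eq_swap⟩

theorem notMem_roofEdges {x y s t c : V} (h : [x, y, s, t, c].Nodup) :
    s(x, y) ∉ roofEdges x y s t c := by
  rw [← edgeSet_roof h]
  exact fun h => h.2.2.2.1 rfl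

theorem ncard_roofEdges {x y s t c : V} (h : [x, y, s, t, c].Nodup) :
    (roofEdges x y s t c).ncard = 8 := by
  simp only [List.nodup_cons, List.mem_cons, List.not_mem_nil, or_false, not_or] at h
  obtain ⟨⟨h1, h2, h3, h4⟩, ⟨h5, h6, h7⟩, ⟨h8, h9⟩, h10, -⟩ := h
  have h11 : roofEdges x y s t c = (({s(x, s), s(x, t), s(y, s), s(y, t), s(c, x), s(c, y),
    s(c, s), s(c, t)} : Finset (Sym2 V)) : Set (Sym2 V)) := by simp [roofEdges]
  rw [h11, Set.ncard_coe_finset]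
  repeat rw [Finset.card_insert_of_notMem (by
    simp only [Finset.mem_insert, Finset.mem_singleton, Sym2.eq_iff]; grind)]
  rw [Finset.card_singleton]

/-- A load on the hinge of a roof that is resolved by the roof is zero. -/
theorem InGeneralPosition.eq_zero_of_mem_roof [Fintype V] {p : V → Space}
    (hp : InGeneralPosition p) {x y s t c : V} (h : [x, y, s, t, c].Nodup) {F : V → Space}
    (hF : F ∈ rowSpan p (roofEdges x y s t c)) (hsupp : ∀ z, z ≠ x → z ≠ y → F z = 0) :
    F = 0 := by
  -- An equilibrium load on two points is a multiple of the bar between them, and that bar is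
  -- independent of the roof.
  have h1 : F ∈ rowSpan p {s(x, y)} := by
    refine rowSpan_mono p ?_ (mem_rowSpan_pairsIn hp (T := {x, y})
      (Finset.card_le_two.trans (by norm_num))
      (fun z hz => ?_) (work_trivialMotion_eq_zero hF))
    · intro e
      induction e with | _ z z' =>
      rw [mk_mem_pairsIn]
      simp only [Finset.coe_insert, Finset.coe_singleton, Set.mem_insert_iff,
        Set.mem_singleton_iff]
      rintro ⟨hne, rfl | rfl, rfl | rfl⟩ <;> simp_all [Sym2.eq_swap]
    · simp only [Finset.mem_insert, Finset.mem_singleton, not_or] at hz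
      exact hsupp z hz.1 hz.2
  have h2 := hp.linearIndepOn_roofEdges h
  rw [Set.insert_eq, linearIndepOn_union_iff
    (Set.disjoint_singleton_left.2 (notMem_roofEdges h))] at h2
  exact Submodule.disjoint_def.1 h2.2.2 F h1 hF

theorem edgeSet_map_of_injective {f : V → W} (hf : Function.Injective f) (G : SimpleGraph V) :
    (G.map f).edgeSet = Sym2.map f '' G.edgeSet := by
  ext e
  induction e with | _ x y =>
  constructor
  · rintro ⟨-, x', y', h, rfl, rfl⟩
    exact ⟨s(x', y'), h, rfl⟩
  · rintro ⟨e, he, h⟩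
    induction e with | _ x' y' =>
    rw [Sym2.map_mk, Sym2.eq_iff] at h
    rcases h with ⟨rfl, rfl⟩ | ⟨rfl, rfl⟩
    · exact ⟨hf.ne (G.ne_of_adj he), x', y', he, rfl, rfl⟩
    · exact ⟨hf.ne (G.ne_of_adj he).symm, y', x', G.adj_symm he, rfl, rfl⟩

theorem push_apply_of_injective [Fintype V] {f : V → W} (hf : Function.Injective f)
    (F : V → Space) (x : V) : push f F (f x) = F x := by
  simp [push_apply, hf.eq_iff]

end Roofs

/-! ### Roof-addition keeps independence -/

section RoofAddition
variable {V : Type*}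

/-- The two copies of `V` in the cut graph. -/
def lift (a b : V) (i : Bool) (x : V) : V ⊕ Fin 2 := cutEnd a b (fun _ => i) s(a, b) x

theorem cutEdge_eq (a b : V) (side : Sym2 V → Bool) (e : Sym2 V) :
    cutEdge a b side e = e.map (lift a b (side e)) := rfl

theorem lift_injective (a b : V) (i : Bool) : Function.Injective (lift a b i) :=
  cutEnd_injective _ _ _ _

theorem uncut_lift (a b : V) (i : Bool) (x : V) : uncut a b (lift a b i x) = x :=
  uncut_cutEnd _ _ _ _ _

theorem lift_true (a b x : V) : lift a b true x = Sum.inl x := by simp [lift, cutEnd]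

theorem lift_of_ne {a b x : V} (i : Bool) (ha : x ≠ a) (hb : x ≠ b) :
    lift a b i x = Sum.inl x := by simp [lift, cutEnd, ha, hb]

theorem lift_false_left (a b : V) : lift a b false a = Sum.inr 0 := by simp [lift, cutEnd]

theorem lift_false_right {a b : V} (h : a ≠ b) : lift a b false b = Sum.inr 1 := by
  simp [lift, cutEnd, h.symm]

/-- The vertices after identifying the two sides of the cut and the two apexes. -/
def collapse (a b : V) : (V ⊕ Fin 2) ⊕ Fin 4 → V ⊕ Fin 3 :=
  Sum.elim (Sum.inl ∘ uncut a b) ![Sum.inr 0, Sum.inr 1, Sum.inr 2, Sum.inr 2]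

/-- The vertices on the side `i`, with the apex `j`. -/
def sideEmb (a b : V) (i : Bool) (j : Fin 4) : V ⊕ Fin 3 → (V ⊕ Fin 2) ⊕ Fin 4 :=
  Sum.elim (Sum.inl ∘ lift a b i) ![Sum.inr 0, Sum.inr 1, Sum.inr j]

theorem collapse_sideEmb (a b : V) (i : Bool) {j : Fin 4} (hj : j = 2 ∨ j = 3)
    (x : V ⊕ Fin 3) : collapse a b (sideEmb a b i j x) = x := by
  rcases x with x | x
  · exact congrArg Sum.inl (uncut_lift a b i x)
  · fin_cases x
    · rfl
    · rfl
    · rcases hj with rfl | rfl <;> rfl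

theorem sideEmb_injective (a b : V) (i : Bool) {j : Fin 4} (hj : j = 2 ∨ j = 3) :
    Function.Injective (sideEmb a b i j) :=
  Function.LeftInverse.injective (collapse_sideEmb a b i hj)

/-- The edges of the roof on the side `i`. -/
def sideRoof (a b : V) (i : Bool) (j : Fin 4) : Set (Sym2 ((V ⊕ Fin 2) ⊕ Fin 4)) :=
  roofEdges (Sum.inl (lift a b i a)) (Sum.inl (lift a b i b)) (Sum.inr 0) (Sum.inr 1) (Sum.inr j)

/-- The edges of the roof in the collapsed graph. -/
def baseRoof (a b : V) : Set (Sym2 (V ⊕ Fin 3)) :=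
  roofEdges (Sum.inl a) (Sum.inl b) (Sum.inr 0) (Sum.inr 1) (Sum.inr 2)

theorem nodup_base {a b : V} (hab : a ≠ b) :
    [(Sum.inl a : V ⊕ Fin 3), Sum.inl b, Sum.inr 0, Sum.inr 1, Sum.inr 2].Nodup := by
  simp [hab]

theorem nodup_side {a b : V} (hab : a ≠ b) (i : Bool) {j : Fin 4} (hj : j = 2 ∨ j = 3) :
    [(Sum.inl (lift a b i a) : (V ⊕ Fin 2) ⊕ Fin 4), Sum.inl (lift a b i b), Sum.inr 0,
      Sum.inr 1, Sum.inr j].Nodup := by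
  have h : lift a b i a ≠ lift a b i b := fun h => hab (lift_injective a b i h)
  rcases hj with rfl | rfl <;> simp [h]

theorem sideRoof_eq (a b : V) (i : Bool) (j : Fin 4) :
    sideRoof a b i j = Sym2.map (sideEmb a b i j) '' baseRoof a b := by
  rw [baseRoof, map_roofEdges]
  rfl

theorem map_collapse_sideRoof (a b : V) (i : Bool) {j : Fin 4} (hj : j = 2 ∨ j = 3) :
    Sym2.map (collapse a b) '' sideRoof a b i j = baseRoof a b := by
  rw [sideRoof_eq, Set.image_image]
  have : collapse a b ∘ sideEmb a b i j = id := funext (collapse_sideEmb a b i hj)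
  simp only [Sym2.map_map, this, id, Set.image_id', Sym2.map_id']

theorem edgeSet_roofAddition (H : SimpleGraph V) {a b : V} (hab : a ≠ b)
    (side : Sym2 V → Bool) : (roofAddition H a b side).edgeSet =
      Sym2.map Sum.inl '' (graphCut H a b side).edgeSet ∪
        (sideRoof a b true 2 ∪ sideRoof a b false 3) := by
  have h1 := edgeSet_roof (nodup_side hab true (j := 2) (Or.inl rfl))
  have h2 := edgeSet_roof (nodup_side hab false (j := 3) (Or.inr rfl))
  rw [lift_true, lift_true] at h1
  rw [lift_false_left, lift_false_right hab] at h2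
  rw [roofAddition, SimpleGraph.edgeSet_sup, SimpleGraph.edgeSet_sup, h1, h2, Set.union_assoc]
  congr 1
  · exact edgeSet_map_of_injective Sum.inl_injective _
  · rw [sideRoof, sideRoof, lift_true, lift_true, lift_false_left, lift_false_right hab]

/-- It is enough to find one position with independent rows. In this one both sides of the cut lie
on top of each other, and both roofs coincide. -/
theorem linearIndepOn_roofAddition [Fintype V] {H : SimpleGraph V} (hH : IsIndependent H)
    {a b : V} (hab : a ≠ b) (side : Sym2 V → Bool) {p : V ⊕ Fin 3 → Space}
    (hp : InGeneralPosition p) :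
    LinearIndepOn ℝ (rigidityRow (p ∘ collapse a b)) (roofAddition H a b side).edgeSet := by
  have hpV : InGeneralPosition (p ∘ Sum.inl) := hp.comp Function.Embedding.inl
  have hroof (i : Bool) {j : Fin 4} (hj : j = 2 ∨ j = 3) :
      LinearIndepOn ℝ (rigidityRow (p ∘ collapse a b)) (sideRoof a b i j) := by
    rw [sideRoof_eq]
    refine (linearIndepOn_map_iff ⟨_, sideEmb_injective a b i hj⟩ _ _).1 ?_
    have : (p ∘ collapse a b) ∘ sideEmb a b i j = p := by
      ext1 x
      exact congrArg p (collapse_sideEmb a b i hj x)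
    change LinearIndepOn ℝ (rigidityRow ((p ∘ collapse a b) ∘ sideEmb a b i j)) _
    rw [this]
    exact (hp.linearIndepOn_roofEdges (nodup_base hab)).mono (Set.subset_insert _ _)
  have hcutinj := injOn_map_uncut H a b side
  have hcutLI : LinearIndepOn ℝ (rigidityRow (p ∘ Sum.inl))
      (Sym2.map (uncut a b) '' (graphCut H a b side).edgeSet) := by
    rw [map_uncut_edgeSet]
    exact hH.linearIndepOn hpV
  rw [edgeSet_roofAddition H hab]
  refine LinearIndepOn.union ?_ ((hroof true (Or.inl rfl)).union (hroof false (Or.inr rfl)) ?_) ?_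
  · refine (linearIndepOn_map_iff Function.Embedding.inl _ _).1 ?_
    exact linearIndepOn_comp (f := uncut a b) (p := p ∘ Sum.inl) hcutinj hcutLI
  -- The two roofs have only the ends of the common hinge in common, so a load resolved by both
  -- lives on this hinge and vanishes.
  · refine Submodule.disjoint_def.2 fun F hF hF' => ?_
    have hcomp : (p ∘ collapse a b) ∘ sideEmb a b true 2 = p := by
      ext1 x
      exact congrArg p (collapse_sideEmb a b true (Or.inl rfl) x)
    have hF1 : F ∈ (rowSpan ((p ∘ collapse a b) ∘ sideEmb a b true 2) (baseRoof a b)).map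
        (push (sideEmb a b true 2)) := by
      rw [map_push_rowSpan, ← sideRoof_eq]
      exact hF
    rw [hcomp] at hF1
    obtain ⟨F', hF1, rfl⟩ := hF1
    have h0 : F' = 0 := by
      rw [SetLike.mem_coe, baseRoof, roofEdges_swap] at hF1
      refine hp.eq_zero_of_mem_roof (x := Sum.inr 0) (y := Sum.inr 1) (s := Sum.inl a)
        (t := Sum.inl b) (by simp [hab]) hF1 fun z hz0 hz1 => ?_
      rw [← push_apply_of_injective (sideEmb_injective a b true (j := 2) (Or.inl rfl)) F' z]
      refine apply_eq_zero_of_mem_rowSpan hF' fun e he hze => ?_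
      simp only [sideRoof, roofEdges, Set.mem_insert_iff, Set.mem_singleton_iff] at he
      rcases z with z | z
      · have hz : sideEmb a b true 2 (Sum.inl z) = Sum.inl (Sum.inl z) := by
          simp [sideEmb, lift_true]
        rw [hz] at hze
        rw [lift_false_left, lift_false_right hab] at he
        rcases he with rfl | rfl | rfl | rfl | rfl | rfl | rfl | rfl <;> simp at hze
      · fin_cases z
        · exact hz0 rfl
        · exact hz1 rfl
        · have hze : Sum.inr 2 ∈ e := hze
          rcases he with rfl | rfl | rfl | rfl | rfl | rfl | rfl | rfl <;> simp at hze
    rw [h0, map_zero]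
  · refine Submodule.disjoint_def.2 fun F hF hF' => ?_
    have hF1 : F ∈ (rowSpan ((p ∘ collapse a b) ∘ Sum.inl) (graphCut H a b side).edgeSet).map
        (push Sum.inl) := by
      rw [map_push_rowSpan]
      exact hF
    obtain ⟨F', hF1, rfl⟩ := hF1
    have hF1' : F' ∈ rowSpan ((p ∘ Sum.inl) ∘ uncut a b) (graphCut H a b side).edgeSet := hF1
    -- After the collapse the load lives on a and b and is resolved by the single collapsed roof,
    -- hence it is zero. The collapse is injective on loads resolved by the cut graph because the
    -- rows of `H` are independent.
    have h0 : push (uncut a b) F' = 0 := by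
      apply push_injective (Sum.inl_injective (β := Fin 3))
      rw [map_zero]
      have h1 : push (collapse a b) (push Sum.inl F') = push Sum.inl (push (uncut a b) F') := by
        rw [push_comp, push_comp]
        rfl
      refine hp.eq_zero_of_mem_roof (nodup_base hab) ?_ ?_
      · have h2 := push_mem_rowSpan (collapse a b) p hF'
        rw [Set.image_union, map_collapse_sideRoof a b true (Or.inl rfl),
          map_collapse_sideRoof a b false (Or.inr rfl), Set.union_self, h1] at h2
        exact h2
      · intro z hza hzb
        rcases z with z | z
        · have hza' : z ≠ a := fun h => hza (h ▸ rfl)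
          have hzb' : z ≠ b := fun h => hzb (h ▸ rfl)
          rw [push_apply_of_injective Sum.inl_injective, push_apply]
          refine Finset.sum_eq_zero fun t _ => ?_
          split_ifs with ht
          · have ht' : t = Sum.inl z := by
              rcases t with t | t
              · exact congrArg Sum.inl ht
              · fin_cases t
                · exact absurd ht.symm hza'
                · exact absurd ht.symm hzb'
            rw [ht', ← push_apply_of_injective (W := (V ⊕ Fin 2) ⊕ Fin 4) Sum.inl_injective F']
            refine apply_eq_zero_of_mem_rowSpan hF' fun e he hze => ?_
            simp only [sideRoof, roofEdges, Set.mem_insert_iff, Set.mem_singleton_iff,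
              Set.mem_union, lift_true, lift_false_left, lift_false_right hab] at he
            rcases he with (rfl | rfl | rfl | rfl | rfl | rfl | rfl | rfl) |
              (rfl | rfl | rfl | rfl | rfl | rfl | rfl | rfl) <;> simp_all
          · rfl
        · rw [push_apply]
          exact Finset.sum_eq_zero fun t _ => by simp
    rw [eq_zero_of_push_eq_zero hcutinj hcutLI hF1' h0, map_zero]

theorem isIndependent_roofAddition [Finite V] {H : SimpleGraph V} (hH : IsIndependent H)
    {a b : V} (hab : a ≠ b) (side : Sym2 V → Bool) : IsIndependent (roofAddition H a b side) := by
  cases nonempty_fintype V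
  obtain ⟨p, hp⟩ := exists_inGeneralPosition (V ⊕ Fin 3)
  exact isIndependent_iff_exists.2 ⟨_, linearIndepOn_roofAddition hH hab side hp⟩

end RoofAddition

/-! ### Roof-addition keeps nucleation-freeness -/

section Counts

theorem ncard_sum_fin {α : Type*} [Finite α] {m : ℕ} (U : Set (α ⊕ Fin m)) :
    U.ncard = (Sum.inl ⁻¹' U).ncard + ∑ i : Fin m, if Sum.inr i ∈ U then 1 else 0 := by
  have h1 : U = Sum.inl '' (Sum.inl ⁻¹' U) ∪ Sum.inr '' (Sum.inr ⁻¹' U) :=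
    (Set.image_preimage_inl_union_image_preimage_inr U).symm
  have h2 : (Sum.inr ⁻¹' U : Set (Fin m)).ncard = ∑ i : Fin m, if Sum.inr i ∈ U then 1 else 0 := by
    rw [Set.ncard_eq_toFinset_card', Finset.card_eq_sum_ones, ← Finset.sum_filter]
    congr 1
    ext i
    simp
  conv_lhs => rw [h1]
  rw [Set.ncard_union_eq, Set.ncard_image_of_injective _ Sum.inl_injective,
    Set.ncard_image_of_injective _ Sum.inr_injective, h2]
  rw [Set.disjoint_left]
  rintro _ ⟨x, -, rfl⟩ ⟨y, -, h⟩
  cases h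

theorem ncard_insert_inter_le {α : Type*} (x : α) (S T : Set α) :
    (insert x S ∩ T).ncard ≤ (if x ∈ T then 1 else 0) + (S ∩ T).ncard := by
  split_ifs with h
  · rw [Set.insert_inter_of_mem h, add_comm]
    exact Set.ncard_insert_le _ _
  · rw [Set.insert_inter_of_notMem h, zero_add]

theorem ncard_roofEdges_inter_le {W : Type*} (U : Set W) (x y s t c : W) :
    (roofEdges x y s t c ∩ {e | ∀ z ∈ e, z ∈ U}).ncard ≤
      ((if x ∈ U then 1 else 0) + (if y ∈ U then 1 else 0)) *
          ((if s ∈ U then 1 else 0) + (if t ∈ U then 1 else 0)) +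
        (if c ∈ U then 1 else 0) * ((if x ∈ U then 1 else 0) + (if y ∈ U then 1 else 0) +
          ((if s ∈ U then 1 else 0) + (if t ∈ U then 1 else 0))) := by
  have hmem (z z' : W) : (if s(z, z') ∈ {e : Sym2 W | ∀ z ∈ e, z ∈ U} then 1 else 0) =
      (if z ∈ U then 1 else 0) * (if z' ∈ U then 1 else 0) := by
    rw [ite_zero_mul_ite_zero, mul_one]
    simp
  have hsingle (e : Sym2 W) (T : Set (Sym2 W)) :
      ({e} ∩ T).ncard ≤ if e ∈ T then 1 else 0 := by
    have := ncard_insert_inter_le e ∅ T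
    simpa using this
  rw [roofEdges]
  refine (ncard_insert_inter_le _ _ _).trans ?_
  refine (Nat.add_le_add_left (ncard_insert_inter_le _ _ _) _).trans ?_
  refine (Nat.add_le_add_left (Nat.add_le_add_left
    (ncard_insert_inter_le _ _ _) _) _).trans ?_
  refine (Nat.add_le_add_left (Nat.add_le_add_left (Nat.add_le_add_left
    (ncard_insert_inter_le _ _ _) _) _) _).trans ?_
  refine (Nat.add_le_add_left (Nat.add_le_add_left (Nat.add_le_add_left (Nat.add_le_add_left
    (ncard_insert_inter_le _ _ _) _) _) _) _).trans ?_
  refine (Nat.add_le_add_left (Nat.add_le_add_left (Nat.add_le_add_left (Nat.add_le_add_left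
    (Nat.add_le_add_left (ncard_insert_inter_le _ _ _) _) _) _) _) _).trans ?_
  refine (Nat.add_le_add_left (Nat.add_le_add_left (Nat.add_le_add_left (Nat.add_le_add_left
    (Nat.add_le_add_left (Nat.add_le_add_left
      (ncard_insert_inter_le _ _ _) _) _) _) _) _) _).trans ?_
  refine (Nat.add_le_add_left (Nat.add_le_add_left (Nat.add_le_add_left (Nat.add_le_add_left
    (Nat.add_le_add_left (Nat.add_le_add_left (Nat.add_le_add_left
      (hsingle _ _) _) _) _) _) _) _) _).trans ?_
  simp only [hmem]
  exact le_of_eq (by ring)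

theorem ncard_edgesIn_le_of_roofs {V W : Type*} [Finite V] [Finite W] {Γ : SimpleGraph V}
    {G : SimpleGraph W} {ι : V → W} {R R' : Set (Sym2 W)}
    (hG : G.edgeSet = Sym2.map ι '' Γ.edgeSet ∪ (R ∪ R')) (U : Set W) :
    (edgesIn G U).ncard ≤ (edgesIn Γ (ι ⁻¹' U)).ncard +
      ((R ∩ {e | ∀ z ∈ e, z ∈ U}).ncard + (R' ∩ {e | ∀ z ∈ e, z ∈ U}).ncard) := by
  have h1 : edgesIn G U ⊆ Sym2.map ι '' edgesIn Γ (ι ⁻¹' U) ∪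
      ((R ∩ {e | ∀ z ∈ e, z ∈ U}) ∪ (R' ∩ {e | ∀ z ∈ e, z ∈ U})) := by
    rintro e ⟨he, heU⟩
    rw [hG] at he
    rcases he with ⟨e, he, rfl⟩ | he | he
    · exact Or.inl ⟨e, ⟨he, fun x hx => heU _ (Sym2.mem_map.2 ⟨x, hx, rfl⟩)⟩, rfl⟩
    · exact Or.inr (Or.inl ⟨he, heU⟩)
    · exact Or.inr (Or.inr ⟨he, heU⟩)
  refine (Set.ncard_le_ncard h1).trans ((Set.ncard_union_le _ _).trans ?_)
  exact Nat.add_le_add (Set.ncard_image_le (Set.toFinite _)) (Set.ncard_union_le _ _)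

/-- The bounds on the number `e` of edges that `n` vertices of the cut graph span, `A` of which
are among `a₁, b₁` and `B` among `a₂, b₂`. -/
structure CutBound (n e A B : ℕ) : Prop where
  left_le : A ≤ 2
  right_le : B ≤ 2
  add_le : A + B ≤ n
  five : 5 ≤ n → e + 7 ≤ 3 * n
  three : 3 ≤ n → e + 6 ≤ 3 * n
  two : n = 2 → e ≤ 1
  one : n ≤ 1 → e = 0
  both : A = 2 → B = 2 → e + 12 ≤ 3 * n
  mixed : A + B = 3 → e + 9 ≤ 3 * n
  pair : A + B = 2 → 3 ≤ n → e + 7 ≤ 3 * n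
  pair_two : A + B = 2 → n = 2 → e = 0

/-- The four bits record which copies of a and b are chosen, and `m` counts the vertices after
folding back. Choosing both copies of a vertex lowers `m`, so the count of `H` on `m` vertices beats
that of the cut graph. The extra unit in `hab` reflects that {a, b} is not an edge. -/
theorem cutBound_of_bits {n e m a₁ b₁ a₂ b₂ : ℕ} (ha₁ : a₁ ≤ 1) (hb₁ : b₁ ≤ 1) (ha₂ : a₂ ≤ 1)
    (hb₂ : b₂ ≤ 1) (hle : a₁ + b₁ + (a₂ + b₂) ≤ n) (hm : m + a₁ * a₂ + b₁ * b₂ ≤ n)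
    (h5 : 5 ≤ n → e + 7 ≤ 3 * n) (h3 : 3 ≤ n → e + 6 ≤ 3 * n) (h2 : e ≤ n.choose 2)
    (hm3 : 3 ≤ m → e + 6 ≤ 3 * m) (hm2 : e ≤ m.choose 2)
    (hab : 1 ≤ a₁ + a₂ → 1 ≤ b₁ + b₂ → e + 1 ≤ m.choose 2) :
    CutBound n e (a₁ + b₁) (a₂ + b₂) := by
  have hsmall (c : ℕ) : (c ≤ 1 → c.choose 2 = 0) ∧ (c = 2 → c.choose 2 = 1) ∧
      (c = 3 → c.choose 2 = 3) ∧ (c = 4 → c.choose 2 = 6) := by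
    refine ⟨fun hc => ?_, ?_, ?_, ?_⟩
    · interval_cases c <;> rfl
    · rintro rfl; rfl
    · rintro rfl; rfl
    · rintro rfl; rfl
  obtain ⟨s1, s2, s3, s4⟩ := hsmall m
  obtain ⟨t1, t2, t3, t4⟩ := hsmall n
  generalize m.choose 2 = cm at *
  generalize n.choose 2 = cn at *
  constructor <;> interval_cases a₁ <;> interval_cases a₂ <;> interval_cases b₁ <;>
    interval_cases b₂ <;> omega

/-- `A`, `B` count the chosen hinge ends on the two sides, `U` those of the common hinge, and `C`,
`C'` the apexes. Two complete roofs add 16 edges but only 4 vertices; the bound e ≤ 3n - 12 for both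
hinges, inherited from `H`, makes up for it. -/
theorem CutBound.roof_count {n e A B U C C' : ℕ} (h : CutBound n e A B) (hU : U ≤ 2)
    (hC : C ≤ 1) (hC' : C' ≤ 1) (h5 : 5 ≤ n + (U + C + C')) :
    e + ((A * U + C * (A + U)) + (B * U + C' * (B + U))) + 7 ≤ 3 * (n + (U + C + C')) := by
  obtain ⟨hA, hB, h1, h2, h3, h4, h6, h7, h8, h9, h10⟩ := h
  interval_cases A <;> interval_cases B <;> interval_cases U <;> interval_cases C <;>
    interval_cases C' <;> omega

/-- After the roofs are separated, `U` and `U'` count the ends of their own copies of the common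
hinge. A complete roof now adds 8 edges and 3 vertices to its hinge. -/
theorem CutBound.cut_count {n e A B U U' C C' : ℕ} (h : CutBound n e A B) (hU : U ≤ 2)
    (hU' : U' ≤ 2) (hC : C ≤ 1) (hC' : C' ≤ 1) (h5 : 5 ≤ n + (U + C + C') + U') :
    e + ((A * U + C * (A + U)) + (B * U' + C' * (B + U'))) + 7 ≤
      3 * (n + (U + C + C') + U') := by
  obtain ⟨hA, hB, h1, h2, h3, h4, h6, h7, h8, h9, h10⟩ := h
  interval_cases A <;> interval_cases B <;> interval_cases U <;> interval_cases U' <;>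
    interval_cases C <;> interval_cases C' <;> omega

end Counts

/-! ### Sparsity of the roof-addition and of its cut along the common hinge. -/

section NucleationFree
variable {V : Type*} {H : SimpleGraph V} {a b : V} {side : Sym2 V → Bool}

theorem cutBound [Finite V] (hH : IsIndependent H) (hab : a ≠ b) (hnadj : ¬ H.Adj a b)
    (hnf : IsNucleationFree (graphCut H a b side)) (U : Set (V ⊕ Fin 2)) :
    CutBound U.ncard (edgesIn (graphCut H a b side) U).ncard
      ((if lift a b true a ∈ U then 1 else 0) + (if lift a b true b ∈ U then 1 else 0))
      ((if lift a b false a ∈ U then 1 else 0) + (if lift a b false b ∈ U then 1 else 0)) := by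
  have hΓ := isIndependent_graphCut hH a b side
  -- Edges of the cut graph fold back injectively, so the counts of `H` on the folded vertex set
  -- apply as well.
  have hM : (edgesIn (graphCut H a b side) U).ncard ≤ (edgesIn H (uncut a b '' U)).ncard := by
    refine Set.ncard_le_ncard_of_injOn (Sym2.map (uncut a b)) ?_
      ((injOn_map_uncut H a b side).mono (edgesIn_subset _ _))
    rintro e ⟨he, heU⟩
    refine ⟨by rw [← map_uncut_edgeSet H a b side]; exact ⟨e, he, rfl⟩, fun x hx => ?_⟩
    obtain ⟨y, hy, rfl⟩ := Sym2.mem_map.1 hx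
    exact ⟨y, heU y hy, rfl⟩
  have hδ (x : V ⊕ Fin 2) : (if x ∈ U then 1 else 0) ≤ 1 := by split_ifs <;> norm_num
  have hn := ncard_sum_fin U
  rw [Fin.sum_univ_two] at hn
  rw [lift_true, lift_true, lift_false_left, lift_false_right hab]
  have hpre : (if Sum.inl a ∈ U then 1 else 0) + (if Sum.inl b ∈ U then 1 else 0) ≤
      (Sum.inl ⁻¹' U : Set V).ncard := by
    have h1 : ({a, b} ∩ (Sum.inl ⁻¹' U) : Set V).ncard ≤ (Sum.inl ⁻¹' U : Set V).ncard :=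
      Set.ncard_le_ncard Set.inter_subset_right
    refine le_trans (le_of_eq ?_) h1
    by_cases ha : Sum.inl a ∈ U <;> by_cases hb : Sum.inl b ∈ U <;>
      simp [ha, hb, Set.insert_inter_of_mem, Set.insert_inter_of_notMem, Set.ncard_pair hab]
  have himg : uncut a b '' U = Sum.inl ⁻¹' U ∪
      ((if Sum.inr 0 ∈ U then {a} else ∅) ∪ (if Sum.inr 1 ∈ U then {b} else ∅)) := by
    ext x
    constructor
    · rintro ⟨y | y, hy, rfl⟩
      · exact Or.inl hy
      · right
        fin_cases y
        · have hy : Sum.inr 0 ∈ U := hy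
          exact Or.inl (by rw [if_pos hy]; rfl)
        · have hy : Sum.inr 1 ∈ U := hy
          exact Or.inr (by rw [if_pos hy]; rfl)
    · rintro (hx | hx | hx)
      · exact ⟨_, hx, rfl⟩
      · split_ifs at hx with h
        · exact ⟨_, h, hx.symm⟩
        · exact hx.elim
      · split_ifs at hx with h
        · exact ⟨_, h, hx.symm⟩
        · exact hx.elim
  refine cutBound_of_bits (m := (uncut a b '' U).ncard) (hδ _) (hδ _) (hδ _) (hδ _) ?_ ?_
    (hΓ.ncard_edgesIn_add_seven_le hnf) hΓ.ncard_edgesIn_add_six_le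
    (ncard_edgesIn_le_choose _ _) ?_ (hM.trans (ncard_edgesIn_le_choose _ _)) ?_
  · omega
  · have hun (S : Set V) (x : V) (P : Prop) :
        (S ∪ if P then {x} else ∅).ncard + (if x ∈ S then 1 else 0) * (if P then 1 else 0) ≤
          S.ncard + if P then 1 else 0 := by
      by_cases hP : P
      · by_cases hx : x ∈ S
        · simp [hP, hx, Set.insert_eq_of_mem]
        · simp only [hP, hx, if_true, if_false, Set.union_singleton]
          simpa using Set.ncard_insert_le x S
      · simp [hP]
    have h1 := hun (Sum.inl ⁻¹' U) a (Sum.inr 0 ∈ U)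
    have h2 := hun (Sum.inl ⁻¹' U ∪ if Sum.inr 0 ∈ U then {a} else ∅) b (Sum.inr 1 ∈ U)
    have h3 : (b ∈ (Sum.inl ⁻¹' U ∪ if Sum.inr 0 ∈ U then {a} else ∅ : Set V)) ↔
        Sum.inl b ∈ U := by
      refine ⟨fun h => h.elim id fun h => ?_, fun h => Or.inl h⟩
      split_ifs at h
      · exact absurd (Set.mem_singleton_iff.1 h).symm hab
      · exact h.elim
    simp only [h3] at h2
    rw [himg, ← Set.union_assoc]
    simp only [Set.mem_preimage] at h1
    omega
  · intro h
    exact (Nat.add_le_add_right hM 6).trans (hH.ncard_edgesIn_add_six_le h)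
  · intro ha hb
    have haM : a ∈ uncut a b '' U := by
      by_cases h : Sum.inl a ∈ U
      · exact ⟨_, h, rfl⟩
      · by_cases h' : Sum.inr 0 ∈ U
        · exact ⟨_, h', rfl⟩
        · simp [h, h'] at ha
    have hbM : b ∈ uncut a b '' U := by
      by_cases h : Sum.inl b ∈ U
      · exact ⟨_, h, rfl⟩
      · by_cases h' : Sum.inr 1 ∈ U
        · exact ⟨_, h', rfl⟩
        · simp [h, h'] at hb
    refine (Nat.add_le_add_right hM 1).trans ?_
    rw [← ncard_pairsIn]
    refine Set.ncard_lt_ncard ⟨edgesIn_subset_pairsIn _ _, fun h => hnadj ?_⟩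
    exact (h (mk_mem_pairsIn.2 ⟨hab, haM, hbM⟩)).1

theorem isNucleationFree_roofAddition [Finite V] (hH : IsIndependent H) (hab : a ≠ b)
    (hnadj : ¬ H.Adj a b) (hnf : IsNucleationFree (graphCut H a b side)) :
    IsNucleationFree (roofAddition H a b side) := by
  refine isNucleationFree_of_ncard fun U hU => ?_
  have h1 := ncard_edgesIn_le_of_roofs (edgeSet_roofAddition H hab side) U
  have h2 := ncard_roofEdges_inter_le U (Sum.inl (lift a b true a)) (Sum.inl (lift a b true b))
    (Sum.inr 0) (Sum.inr 1) (Sum.inr 2)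
  have h3 := ncard_roofEdges_inter_le U (Sum.inl (lift a b false a)) (Sum.inl (lift a b false b))
    (Sum.inr 0) (Sum.inr 1) (Sum.inr 3)
  have hn := ncard_sum_fin U
  have hδ (x : (V ⊕ Fin 2) ⊕ Fin 4) : (if x ∈ U then 1 else 0) ≤ 1 := by split_ifs <;> norm_num
  rw [Fin.sum_univ_four] at hn
  rw [hn] at hU ⊢
  have h4 := (cutBound hH hab hnadj hnf (Sum.inl ⁻¹' U)).roof_count
    (Nat.add_le_add (hδ (Sum.inr 0)) (hδ (Sum.inr 1))) (hδ (Sum.inr 2)) (hδ (Sum.inr 3)) hU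
  refine le_trans (Nat.add_le_add_right (h1.trans ?_) 7) h4
  exact Nat.add_le_add_left (Nat.add_le_add h2 h3) _

/-- The cutting along the common hinge non-edge that separates the two roofs. -/
def hingeSide (a b : V) (e : Sym2 ((V ⊕ Fin 2) ⊕ Fin 4)) : Bool :=
  decide (Sum.inl (Sum.inl a) ∈ e ∨ Sum.inl (Sum.inl b) ∈ e ∨ Sum.inr 2 ∈ e)

/-- The roof on {a₁, b₁} keeps the first copies of u and v, the other roof takes the second copies,
and the roofs become vertex-disjoint. -/
theorem edgeSet_graphCut_roofAddition (hab : a ≠ b) :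
    (graphCut (roofAddition H a b side) (Sum.inr 0) (Sum.inr 1) (hingeSide a b)).edgeSet =
      Sym2.map (Sum.inl ∘ Sum.inl) '' (graphCut H a b side).edgeSet ∪
        (roofEdges (Sum.inl (Sum.inl (lift a b true a))) (Sum.inl (Sum.inl (lift a b true b)))
          (Sum.inl (Sum.inr 0)) (Sum.inl (Sum.inr 1)) (Sum.inl (Sum.inr 2)) ∪
        roofEdges (Sum.inl (Sum.inl (lift a b false a))) (Sum.inl (Sum.inl (lift a b false b)))
          (Sum.inr 0) (Sum.inr 1) (Sum.inl (Sum.inr 3))) := by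
  rw [edgeSet_graphCut, edgeSet_roofAddition H hab, Set.image_union, Set.image_union,
    Set.image_image]
  congr 1
  · refine Set.image_congr fun e _ => ?_
    induction e with | _ x y => simp [cutEdge, cutEnd]
  · rw [lift_true, lift_true, lift_false_left, lift_false_right hab]
    congr 1
    · simp [sideRoof, roofEdges, Set.image_insert_eq, cutEdge, cutEnd, hingeSide, lift_true]
    · simp [sideRoof, roofEdges, Set.image_insert_eq, cutEdge, cutEnd, hingeSide,
        lift_false_left, lift_false_right hab]

theorem isNucleationFree_graphCut_roofAddition [Finite V] (hH : IsIndependent H) (hab : a ≠ b)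
    (hnadj : ¬ H.Adj a b) (hnf : IsNucleationFree (graphCut H a b side)) :
    IsNucleationFree
      (graphCut (roofAddition H a b side) (Sum.inr 0) (Sum.inr 1) (hingeSide a b)) := by
  refine isNucleationFree_of_ncard fun U hU => ?_
  have h1 := ncard_edgesIn_le_of_roofs (edgeSet_graphCut_roofAddition (H := H) (side := side) hab) U
  have h2 := ncard_roofEdges_inter_le U (Sum.inl (Sum.inl (lift a b true a)))
    (Sum.inl (Sum.inl (lift a b true b))) (Sum.inl (Sum.inr 0)) (Sum.inl (Sum.inr 1))
    (Sum.inl (Sum.inr 2))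
  have h3 := ncard_roofEdges_inter_le U (Sum.inl (Sum.inl (lift a b false a)))
    (Sum.inl (Sum.inl (lift a b false b))) (Sum.inr 0) (Sum.inr 1) (Sum.inl (Sum.inr 3))
  have hn := ncard_sum_fin U
  have hn' := ncard_sum_fin (Sum.inl ⁻¹' U)
  have hδ (x : ((V ⊕ Fin 2) ⊕ Fin 4) ⊕ Fin 2) : (if x ∈ U then 1 else 0) ≤ 1 := by
    split_ifs <;> norm_num
  rw [Fin.sum_univ_four] at hn'
  rw [Fin.sum_univ_two, hn'] at hn
  rw [hn] at hU ⊢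
  have h4 := (cutBound hH hab hnadj hnf (Sum.inl ⁻¹' (Sum.inl ⁻¹' U))).cut_count
    (Nat.add_le_add (hδ (Sum.inl (Sum.inr 0))) (hδ (Sum.inl (Sum.inr 1))))
    (Nat.add_le_add (hδ (Sum.inr 0)) (hδ (Sum.inr 1)))
    (hδ (Sum.inl (Sum.inr 2))) (hδ (Sum.inl (Sum.inr 3))) hU
  refine le_trans (Nat.add_le_add_right (h1.trans ?_) 7) h4
  exact Nat.add_le_add_left (Nat.add_le_add h2 h3) _

end NucleationFree

/-! ### The tight cover after roof-addition -/

section RoofCover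
variable {V : Type*} {H : SimpleGraph V} {𝒳 : Finset (Finset V)} {a b : V}
  {side : Sym2 V → Bool} {σ : Finset V → Bool}

/-- The members of the cover that contain a shared non-edge. -/
def goodMembers (H : SimpleGraph V) (𝒳 : Finset (Finset V)) : Finset (Finset V) :=
  {X ∈ 𝒳 | ∃ x ∈ X, ∃ y ∈ X, IsSharedNonedge H 𝒳 x y}

/-- `σ` assigns the members with a shared non-edge to the sides of the cut. -/
def IsSideOf (H : SimpleGraph V) (𝒳 : Finset (Finset V)) (a b : V) (side : Sym2 V → Bool)
    (σ : Finset V → Bool) : Prop :=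
  ∀ X ∈ goodMembers H 𝒳, ∀ x ∈ X, ∀ y ∈ X, (starGraph H 𝒳).Adj x y → (x = a ∨ x = b) →
    s(x, y) ≠ s(a, b) → side s(x, y) = σ X

theorem RespectsCover.exists_isSideOf (h : RespectsCover H 𝒳 a b side) :
    ∃ σ, IsSideOf H 𝒳 a b side σ := by
  have h1 : ∀ X, ∃ i : Bool, X ∈ goodMembers H 𝒳 → ∀ x ∈ X, ∀ y ∈ X,
      (starGraph H 𝒳).Adj x y → (x = a ∨ x = b) → s(x, y) ≠ s(a, b) → side s(x, y) = i := by
    intro X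
    by_cases hX : X ∈ goodMembers H 𝒳
    · rw [goodMembers, Finset.mem_filter] at hX
      obtain ⟨i, hi⟩ := h X hX.1 hX.2
      exact ⟨i, fun _ => hi⟩
    · exact ⟨true, fun h => absurd h hX⟩
  choose σ hσ using h1
  exact ⟨σ, hσ⟩

/-- Because the edges and shared non-edges of a member other than {a, b} are not split, the cut acts
on the member as one injective relabelling, depending only on its side. -/
theorem IsSideOf.cutEdge_eq (hσ : IsSideOf H 𝒳 a b side σ) {X : Finset V}
    (hX : X ∈ goodMembers H 𝒳) {e : Sym2 V} (he : e ∈ edgesIn (starGraph H 𝒳) X)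
    (hne : e ≠ s(a, b)) : cutEdge a b side e = e.map (lift a b (σ X)) := by
  induction e with | _ x y =>
  rw [mk_mem_edgesIn] at he
  rw [_root_.cutEdge_eq]
  by_cases hx : x = a ∨ x = b
  · rw [hσ X hX x he.2.1 y he.2.2 he.1 hx hne]
  · by_cases hy : y = a ∨ y = b
    · rw [Sym2.eq_swap] at hne ⊢
      rw [hσ X hX y he.2.2 x he.2.1 he.1.symm hy hne]
    · rw [not_or] at hx hy
      rw [Sym2.map_mk, Sym2.map_mk, lift_of_ne _ hx.1 hx.2, lift_of_ne _ hx.1 hx.2,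
        lift_of_ne _ hy.1 hy.2, lift_of_ne _ hy.1 hy.2]

/-- The inclusion of `V` as the vertices on the side `i` after roof-addition. -/
def sideIncl (a b : V) (i : Bool) : V ↪ (V ⊕ Fin 2) ⊕ Fin 4 :=
  ⟨Sum.inl ∘ lift a b i, Sum.inl_injective.comp (lift_injective a b i)⟩

theorem sideIncl_apply (a b : V) (i : Bool) (x : V) :
    sideIncl a b i x = Sum.inl (lift a b i x) := rfl

theorem collapse_sideIncl (a b : V) (i : Bool) (x : V) :
    collapse a b (sideIncl a b i x) = Sum.inl x := congrArg Sum.inl (uncut_lift a b i x)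

theorem eq_of_sideIncl_eq {i j : Bool} {x y : V} (h : sideIncl a b i x = sideIncl a b j y) :
    x = y := by
  have := congrArg (collapse a b) h
  rw [collapse_sideIncl, collapse_sideIncl] at this
  exact Sum.inl_injective this

/-- The copy of the pair `e` after roof-addition. -/
def roofCopy (a b : V) (side : Sym2 V → Bool) (e : Sym2 V) : Sym2 ((V ⊕ Fin 2) ⊕ Fin 4) :=
  (cutEdge a b side e).map Sum.inl

theorem roofCopy_eq (a b : V) (side : Sym2 V → Bool) (e : Sym2 V) :
    roofCopy a b side e = e.map (sideIncl a b (side e)) := by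
  rw [roofCopy, cutEdge_eq, Sym2.map_map]
  rfl

theorem IsSideOf.roofCopy_eq (hσ : IsSideOf H 𝒳 a b side σ) {X : Finset V}
    (hX : X ∈ goodMembers H 𝒳) {e : Sym2 V} (he : e ∈ edgesIn (starGraph H 𝒳) X)
    (hne : e ≠ s(a, b)) : roofCopy a b side e = e.map (sideIncl a b (σ X)) := by
  rw [roofCopy, hσ.cutEdge_eq hX he hne, Sym2.map_map]
  rfl

theorem map_collapse_map_sideIncl (a b : V) (i : Bool) (e : Sym2 V) :
    (e.map (sideIncl a b i)).map (collapse a b) = e.map Sum.inl := by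
  rw [Sym2.map_map]
  exact congrArg (fun f => e.map f) (funext (collapse_sideIncl a b i))

theorem map_collapse_roofCopy (a b : V) (side : Sym2 V → Bool) (e : Sym2 V) :
    (roofCopy a b side e).map (collapse a b) = e.map Sum.inl := by
  rw [roofCopy_eq, map_collapse_map_sideIncl]

theorem roofCopy_injective (a b : V) (side : Sym2 V → Bool) :
    Function.Injective (roofCopy a b side) := by
  intro e e' h
  have := congrArg (Sym2.map (collapse a b)) h
  rw [map_collapse_roofCopy, map_collapse_roofCopy] at this
  exact Sym2.map.injective Sum.inl_injective this

theorem isDiag_roofCopy {a b : V} {side : Sym2 V → Bool} {e : Sym2 V} :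
    (roofCopy a b side e).IsDiag ↔ e.IsDiag := by
  rw [roofCopy_eq, Sym2.isDiag_map (sideIncl a b (side e)).injective]

theorem notMem_map_sideIncl {X : Finset V} {i : Bool} {j : Fin 4} :
    Sum.inr j ∉ X.map (sideIncl a b i) := by
  simp [sideIncl_apply]

theorem notMem_roofCopy {e : Sym2 V} {j : Fin 4} : Sum.inr j ∉ roofCopy a b side e := by
  simp [roofCopy]

/-- If the copy of `e` lies on the copy of `X` then `e` lies on `X`. -/
theorem mem_of_roofCopy_subset {e : Sym2 V} {X : Finset V} {i : Bool}
    (h : ∀ x ∈ roofCopy a b side e, x ∈ X.map (sideIncl a b i)) {z : V} (hz : z ∈ e) :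
    z ∈ X := by
  have h1 := h (sideIncl a b (side e) z) (by rw [roofCopy_eq]; exact Sym2.mem_map.2 ⟨z, hz, rfl⟩)
  obtain ⟨y, hy, h2⟩ := Finset.mem_map.1 h1
  rwa [← eq_of_sideIncl_eq h2]

/-- The vertices of the roof on the side `i` with apex `j`. -/
def roofSet (a b : V) (i : Bool) (j : Fin 4) : Finset ((V ⊕ Fin 2) ⊕ Fin 4) :=
  {sideIncl a b i a, sideIncl a b i b, Sum.inr 0, Sum.inr 1, Sum.inr j}

/-- The hinge on the side `i`. -/
def hinge (a b : V) (i : Bool) : Sym2 ((V ⊕ Fin 2) ⊕ Fin 4) := s(a, b).map (sideIncl a b i)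

/-- The common hinge of the two roofs. -/
def commonHinge (V : Type*) : Sym2 ((V ⊕ Fin 2) ⊕ Fin 4) := s(Sum.inr 0, Sum.inr 1)

theorem hinge_true_ne_false (hab : a ≠ b) : hinge a b true ≠ hinge a b false := by
  intro h
  rw [hinge, hinge, Sym2.map_mk, Sym2.map_mk, Sym2.eq_iff] at h
  simp [sideIncl_apply, lift_true, lift_false_left, lift_false_right hab] at h

theorem notMem_hinge {i : Bool} {j : Fin 4} : Sum.inr j ∉ hinge a b i := by
  simp [hinge, sideIncl_apply]

theorem hinge_ne_commonHinge {i : Bool} : hinge a b i ≠ commonHinge V := by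
  intro h
  have : Sum.inr 0 ∈ hinge a b i := by rw [h]; simp [commonHinge]
  exact notMem_hinge this

theorem roofCopy_ne_commonHinge {e : Sym2 V} : roofCopy a b side e ≠ commonHinge V := by
  intro h
  have : Sum.inr 0 ∈ roofCopy a b side e := by rw [h]; simp [commonHinge]
  exact notMem_roofCopy this

theorem roofCopy_ne_hinge {e : Sym2 V} (he : e ≠ s(a, b)) {i : Bool} :
    roofCopy a b side e ≠ hinge a b i := by
  intro h
  have := congrArg (Sym2.map (collapse a b)) h
  rw [map_collapse_roofCopy, hinge, map_collapse_map_sideIncl] at this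
  exact he (Sym2.map.injective Sum.inl_injective this)

theorem eq_hinge_of_subset {i : Bool} {j : Fin 4} {x y : (V ⊕ Fin 2) ⊕ Fin 4} (hxy : x ≠ y)
    (hx : x ∈ roofSet a b i j) (hy : y ∈ roofSet a b i j) (hx' : ∀ k, x ≠ Sum.inr k)
    (hy' : ∀ k, y ≠ Sum.inr k) : s(x, y) = hinge a b i := by
  simp only [roofSet, Finset.mem_insert, Finset.mem_singleton] at hx hy
  rw [hinge, Sym2.map_mk, Sym2.eq_iff]
  rcases hx with rfl | rfl | rfl | rfl | rfl
  · rcases hy with rfl | rfl | rfl | rfl | rfl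
    · exact absurd rfl hxy
    · exact Or.inl ⟨rfl, rfl⟩
    all_goals exact absurd rfl (hy' _)
  · rcases hy with rfl | rfl | rfl | rfl | rfl
    · exact Or.inr ⟨rfl, rfl⟩
    · exact absurd rfl hxy
    all_goals exact absurd rfl (hy' _)
  all_goals exact absurd rfl (hx' _)

theorem card_roofSet (hab : a ≠ b) {i : Bool} {j : Fin 4} (hj : j = 2 ∨ j = 3) :
    (roofSet a b i j).card = 5 := by
  have h : lift a b i a ≠ lift a b i b := fun h => hab (lift_injective a b i h)
  rcases hj with rfl | rfl <;> simp [roofSet, sideIncl_apply, h, Finset.card_insert_of_notMem]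

theorem mem_roofSet_inter (hab : a ≠ b) {x : (V ⊕ Fin 2) ⊕ Fin 4}
    (h1 : x ∈ roofSet a b true 2) (h2 : x ∈ roofSet a b false 3) :
    x = Sum.inr 0 ∨ x = Sum.inr 1 := by
  simp only [roofSet, Finset.mem_insert, Finset.mem_singleton] at h1 h2
  rcases h1 with rfl | rfl | rfl | rfl | rfl <;>
    simp_all [sideIncl_apply, lift_true, lift_false_left, lift_false_right hab]

theorem pairDegree_eq_zero_iff {α : Type*} {𝒴 : Finset (Finset α)} {e : Sym2 α} :
    pairDegree 𝒴 e = 0 ↔ ∀ X ∈ 𝒴, ¬ ∀ x ∈ e, x ∈ X := by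
  rw [pairDegree, Finset.card_eq_zero, Finset.filter_eq_empty_iff]

/-- The edges of `H` that lie in no member with a shared non-edge. -/
def freeEdges [Fintype V] (H : SimpleGraph V) (𝒳 : Finset (Finset V)) : Finset (Sym2 V) :=
  {e ∈ H.edgeSet.toFinset | pairDegree (goodMembers H 𝒳) e = 0}

/-- The cover of the roof-addition: the copies of the members with a shared non-edge, the
remaining edges, and the two roofs. -/
def roofCover [Fintype V] (H : SimpleGraph V) (𝒳 : Finset (Finset V)) (a b : V)
    (side : Sym2 V → Bool) (σ : Finset V → Bool) : Finset (Finset ((V ⊕ Fin 2) ⊕ Fin 4)) :=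
  (goodMembers H 𝒳).image (fun X => X.map (sideIncl a b (σ X))) ∪
    (freeEdges H 𝒳).image (fun e => (roofCopy a b side e).toFinset) ∪
    {roofSet a b true 2, roofSet a b false 3}

theorem mem_roofCover [Fintype V] {P : Finset ((V ⊕ Fin 2) ⊕ Fin 4)} :
    P ∈ roofCover H 𝒳 a b side σ ↔
      (∃ X ∈ goodMembers H 𝒳, X.map (sideIncl a b (σ X)) = P) ∨
      (∃ e ∈ freeEdges H 𝒳, (roofCopy a b side e).toFinset = P) ∨
      P = roofSet a b true 2 ∨ P = roofSet a b false 3 := by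
  simp only [roofCover, Finset.mem_union, Finset.mem_image, Finset.mem_insert,
    Finset.mem_singleton, or_assoc]

theorem mem_freeEdges [Fintype V] {e : Sym2 V} : e ∈ freeEdges H 𝒳 ↔
    e ∈ H.edgeSet ∧ ∀ X ∈ goodMembers H 𝒳, ¬ ∀ x ∈ e, x ∈ X := by
  rw [freeEdges, Finset.mem_filter, Set.mem_toFinset, pairDegree_eq_zero_iff]

theorem card_of_mem_freeEdges [Fintype V] {e : Sym2 V} (he : e ∈ freeEdges H 𝒳) :
    (roofCopy a b side e).toFinset.card = 2 :=
  Sym2.card_toFinset_of_not_isDiag _ fun h =>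
    H.not_isDiag_of_mem_edgeSet (mem_freeEdges.1 he).1 (isDiag_roofCopy.1 h)

theorem eq_of_map_sideIncl_subset {X Y : Finset V} {i j : Bool} (hc : IsCover H 𝒳)
    (hX : X ∈ goodMembers H 𝒳) (hY : Y ∈ goodMembers H 𝒳)
    (h : X.map (sideIncl a b i) ⊆ Y.map (sideIncl a b j)) : X = Y := by
  refine hc.incomparable X (Finset.mem_filter.1 hX).1 Y (Finset.mem_filter.1 hY).1 fun x hx => ?_
  obtain ⟨y, hy, h1⟩ := Finset.mem_map.1 (h (Finset.mem_map_of_mem _ hx))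
  rwa [← eq_of_sideIncl_eq h1]

theorem notMem_range_of_mem_map {X : Finset V} {i : Bool} {x : (V ⊕ Fin 2) ⊕ Fin 4}
    (h : x ∈ X.map (sideIncl a b i)) (k : Fin 4) : x ≠ Sum.inr k := by
  rintro rfl
  exact notMem_map_sideIncl h

theorem isCover_roofCover [Fintype V] (hab : a ≠ b) (ht : IsTightCover H 𝒳)
    (hS : IsSharedNonedge H 𝒳 a b) (hσ : IsSideOf H 𝒳 a b side σ) :
    IsCover (roofAddition H a b side) (roofCover H 𝒳 a b side σ) := by
  have hc := ht.cover
  have h2X : ∀ X ∈ goodMembers H 𝒳, 2 ≤ X.card := fun X hX =>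
    hc.two_le_card X (Finset.mem_filter.1 hX).1
  have hcX : ∀ e ∈ freeEdges H 𝒳, ∀ X ∈ goodMembers H 𝒳, ∀ i,
      ¬ (roofCopy a b side e).toFinset ⊆ X.map (sideIncl a b i) := by
    intro e he X hX i h
    refine (mem_freeEdges.1 he).2 X hX fun z hz => ?_
    exact mem_of_roofCopy_subset (fun x hx => h (Sym2.mem_toFinset.2 hx)) hz
  have hXR : ∀ X ∈ goodMembers H 𝒳, ∀ i i' j, ¬ X.map (sideIncl a b i) ⊆ roofSet a b i' j := by
    intro X hX i i' j h
    have h1 : X ⊆ {a, b} := by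
      intro x hx
      have hx' := Finset.mem_map_of_mem (sideIncl a b i) hx
      have h1 := h hx'
      simp only [roofSet, Finset.mem_insert, Finset.mem_singleton] at h1 ⊢
      rcases h1 with h1 | h1 | h1 | h1 | h1
      · exact Or.inl (eq_of_sideIncl_eq h1)
      · exact Or.inr (eq_of_sideIncl_eq h1)
      all_goals exact absurd h1 (notMem_range_of_mem_map hx' _)
    -- A member inside {a, b} would be contained in both of the distinct members that share this
    -- pair, against incomparability.
    obtain ⟨Y, hY, Z, hZ, hYZ, hY', hZ'⟩ :=
      exists_of_two_le_pairDegree ((sharedGraph_adj_iff ht.twoThin).1 hS.1).2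
    have hX' := (Finset.mem_filter.1 hX).1
    have h3 : ∀ Y ∈ 𝒳, (∀ x ∈ s(a, b), x ∈ Y) → X = Y := by
      intro Y hY hY'
      refine hc.incomparable X hX' Y hY (h1.trans ?_)
      simpa [Finset.insert_subset_iff] using hY'
    exact hYZ ((h3 Y hY hY').symm.trans (h3 Z hZ hZ'))
  have heR : ∀ e ∈ freeEdges H 𝒳, ∀ i j, ¬ (roofCopy a b side e).toFinset ⊆ roofSet a b i j := by
    intro e he i j h
    have heH := (mem_freeEdges.1 he).1
    have heab : e ≠ s(a, b) := by
      rintro rfl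
      exact hS.2 heH
    induction e with | _ x y =>
    refine roofCopy_ne_hinge (side := side) heab (i := i) ?_
    rw [roofCopy_eq, Sym2.map_mk]
    have hne : x ≠ y := H.ne_of_adj heH
    refine eq_hinge_of_subset (fun h => hne ((sideIncl a b _).injective h))
      (h ?_) (h ?_) (fun k => Sum.inl_ne_inr) (fun k => Sum.inl_ne_inr) <;>
      simp [roofCopy_eq]
  have hR (i : Bool) (j : Fin 4) : Sum.inr 0 ∈ roofSet a b i j := by simp [roofSet]
  have hRj (i : Bool) (j : Fin 4) : Sum.inr j ∈ roofSet a b i j := by simp [roofSet]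
  have hRX : ∀ (X : Finset V) i i' j, ¬ roofSet a b i' j ⊆ X.map (sideIncl a b i) :=
    fun X i i' j h => notMem_map_sideIncl (h (hR i' j))
  have hRe : ∀ (e : Sym2 V) i j, ¬ roofSet a b i j ⊆ (roofCopy a b side e).toFinset :=
    fun e i j h => notMem_roofCopy (Sym2.mem_toFinset.1 (h (hR i j)))
  refine ⟨fun P hP => ?_, fun P hP Q hQ hPQ => ?_, fun x y hxy => ?_⟩
  · rcases mem_roofCover.1 hP with ⟨X, hX, rfl⟩ | ⟨e, he, rfl⟩ | rfl | rfl
    · rw [Finset.card_map]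
      exact h2X X hX
    · exact (card_of_mem_freeEdges he).ge
    · rw [card_roofSet hab (Or.inl rfl)]; norm_num
    · rw [card_roofSet hab (Or.inr rfl)]; norm_num
  · rcases mem_roofCover.1 hP with ⟨X, hX, rfl⟩ | ⟨e, he, rfl⟩ | rfl | rfl
    · rcases mem_roofCover.1 hQ with ⟨Y, hY, rfl⟩ | ⟨e, he, rfl⟩ | rfl | rfl
      · rw [eq_of_map_sideIncl_subset hc hX hY hPQ]
      · refine Finset.eq_of_subset_of_card_le hPQ ?_
        rw [card_of_mem_freeEdges he, Finset.card_map]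
        exact h2X X hX
      · exact absurd hPQ (hXR X hX _ _ _)
      · exact absurd hPQ (hXR X hX _ _ _)
    · rcases mem_roofCover.1 hQ with ⟨Y, hY, rfl⟩ | ⟨e', he', rfl⟩ | rfl | rfl
      · exact absurd hPQ (hcX e he Y hY _)
      · refine Finset.eq_of_subset_of_card_le hPQ ?_
        rw [card_of_mem_freeEdges he, card_of_mem_freeEdges he']
      · exact absurd hPQ (heR e he _ _)
      · exact absurd hPQ (heR e he _ _)
    · rcases mem_roofCover.1 hQ with ⟨Y, hY, rfl⟩ | ⟨e', he', rfl⟩ | rfl | rfl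
      · exact absurd hPQ (hRX _ _ _ _)
      · exact absurd hPQ (hRe _ _ _)
      · rfl
      · have := hPQ (hRj true 2)
        simp [roofSet, sideIncl_apply] at this
    · rcases mem_roofCover.1 hQ with ⟨Y, hY, rfl⟩ | ⟨e', he', rfl⟩ | rfl | rfl
      · exact absurd hPQ (hRX _ _ _ _)
      · exact absurd hPQ (hRe _ _ _)
      · have := hPQ (hRj false 3)
        simp [roofSet, sideIncl_apply] at this
      · rfl
  · rw [← SimpleGraph.mem_edgeSet, edgeSet_roofAddition H hab, edgeSet_graphCut,
      Set.image_image] at hxy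
    have key : ∃ P ∈ roofCover H 𝒳 a b side σ, ∀ z ∈ s(x, y), z ∈ P := by
      rcases hxy with ⟨e, he, h1⟩ | h1 | h1
      · rw [← h1]
        by_cases hfree : e ∈ freeEdges H 𝒳
        · exact ⟨_, mem_roofCover.2 (Or.inr (Or.inl ⟨e, hfree, rfl⟩)),
            fun z hz => Sym2.mem_toFinset.2 hz⟩
        · rw [mem_freeEdges] at hfree
          push Not at hfree
          obtain ⟨X, hX, heX⟩ := hfree he
          refine ⟨_, mem_roofCover.2 (Or.inl ⟨X, hX, rfl⟩), fun z hz => ?_⟩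
          have h3 : roofCopy a b side e = _ := hσ.roofCopy_eq hX
            ⟨SimpleGraph.edgeSet_mono (le_starGraph H 𝒳) he, heX⟩ (by rintro rfl; exact hS.2 he)
          change z ∈ roofCopy a b side e at hz
          rw [h3] at hz
          obtain ⟨t, ht, rfl⟩ := Sym2.mem_map.1 hz
          exact Finset.mem_map_of_mem _ (heX t ht)
      · refine ⟨_, mem_roofCover.2 (Or.inr (Or.inr (Or.inl rfl))), ?_⟩
        generalize s(x, y) = e at h1
        simp only [sideRoof, roofEdges, Set.mem_insert_iff, Set.mem_singleton_iff] at h1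
        rcases h1 with rfl | rfl | rfl | rfl | rfl | rfl | rfl | rfl <;>
          simp [roofSet, sideIncl_apply]
      · refine ⟨_, mem_roofCover.2 (Or.inr (Or.inr (Or.inr rfl))), ?_⟩
        generalize s(x, y) = e at h1
        simp only [sideRoof, roofEdges, Set.mem_insert_iff, Set.mem_singleton_iff] at h1
        rcases h1 with rfl | rfl | rfl | rfl | rfl | rfl | rfl | rfl <;>
          simp [roofSet, sideIncl_apply]
    obtain ⟨P, hP, h⟩ := key
    exact ⟨P, hP, h x (by simp), h y (by simp)⟩

theorem isTwoThin_iff {α : Type*} {𝒴 : Finset (Finset α)} : IsTwoThin 𝒴 ↔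
    ∀ X ∈ 𝒴, ∀ Y ∈ 𝒴, X ≠ Y → ∃ T : Finset α, T.card ≤ 2 ∧ ∀ x ∈ X, x ∈ Y → x ∈ T := by
  refine forall₂_congr fun X _ => forall₂_congr fun Y _ => imp_congr_right fun _ => ?_
  refine ⟨fun h => ⟨_, h, fun x hx hy => Finset.mem_inter.2 ⟨hx, hy⟩⟩, ?_⟩
  rintro ⟨T, hT, h⟩
  refine (Finset.card_le_card fun x hx => ?_).trans hT
  rw [Finset.mem_inter] at hx
  exact h x hx.1 hx.2

theorem isTwoThin_roofCover [Fintype V] (hab : a ≠ b) (ht : IsTightCover H 𝒳) :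
    IsTwoThin (roofCover H 𝒳 a b side σ) := by
  let Q (P P' : Finset ((V ⊕ Fin 2) ⊕ Fin 4)) : Prop :=
    ∃ T : Finset ((V ⊕ Fin 2) ⊕ Fin 4), T.card ≤ 2 ∧ ∀ x ∈ P, x ∈ P' → x ∈ T
  have hsymm : ∀ P P', Q P P' → Q P' P := fun P P' ⟨T, hT, h⟩ =>
    ⟨T, hT, fun x hx hx' => h x hx' hx⟩
  have hsmall : ∀ (e : Sym2 V) P, e ∈ freeEdges H 𝒳 → Q (roofCopy a b side e).toFinset P :=
    fun e P he => ⟨_, (card_of_mem_freeEdges he).le, fun x hx _ => hx⟩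
  have hXR : ∀ (X : Finset V) i i' j, Q (X.map (sideIncl a b i)) (roofSet a b i' j) := by
    intro X i i' j
    refine ⟨{sideIncl a b i' a, sideIncl a b i' b}, Finset.card_le_two, fun x hx h1 => ?_⟩
    simp only [roofSet, Finset.mem_insert, Finset.mem_singleton] at h1 ⊢
    rcases h1 with h1 | h1 | h1 | h1 | h1
    · exact Or.inl h1
    · exact Or.inr h1
    all_goals exact absurd h1 (notMem_range_of_mem_map hx _)
  have hRR : Q (roofSet a b true 2) (roofSet a b false 3) :=
    ⟨{Sum.inr 0, Sum.inr 1}, Finset.card_le_two, fun x h1 h2 => by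
      simpa using mem_roofSet_inter hab h1 h2⟩
  rw [isTwoThin_iff]
  intro P hP P' hP' hne
  change Q P P'
  rcases mem_roofCover.1 hP with ⟨X, hX, rfl⟩ | ⟨e, he, rfl⟩ | rfl | rfl
  · rcases mem_roofCover.1 hP' with ⟨Y, hY, rfl⟩ | ⟨e, he, rfl⟩ | rfl | rfl
    · obtain ⟨T, hT, h⟩ := isTwoThin_iff.1 ht.twoThin X (Finset.mem_filter.1 hX).1 Y
        (Finset.mem_filter.1 hY).1 fun h => hne (h ▸ rfl)
      refine ⟨T.map (sideIncl a b (σ X)), by rwa [Finset.card_map], fun z hz hx' => ?_⟩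
      obtain ⟨x, hx, rfl⟩ := Finset.mem_map.1 hz
      obtain ⟨y, hy, h2⟩ := Finset.mem_map.1 hx'
      rw [eq_of_sideIncl_eq h2] at hy
      exact Finset.mem_map_of_mem _ (h x hx hy)
    · exact hsymm _ _ (hsmall e _ he)
    · exact hXR _ _ _ _
    · exact hXR _ _ _ _
  · exact hsmall e _ he
  · rcases mem_roofCover.1 hP' with ⟨Y, hY, rfl⟩ | ⟨e, he, rfl⟩ | rfl | rfl
    · exact hsymm _ _ (hXR _ _ _ _)
    · exact hsymm _ _ (hsmall e _ he)
    · exact absurd rfl hne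
    · exact hRR
  · rcases mem_roofCover.1 hP' with ⟨Y, hY, rfl⟩ | ⟨e, he, rfl⟩ | rfl | rfl
    · exact hsymm _ _ (hXR _ _ _ _)
    · exact hsymm _ _ (hsmall e _ he)
    · exact hsymm _ _ hRR
    · exact absurd rfl hne

/-- The pairs that can be shared after roof-addition. -/
def roofShared (𝒳 : Finset (Finset V)) (a b : V) (side : Sym2 V → Bool) :
    Set (Sym2 ((V ⊕ Fin 2) ⊕ Fin 4)) :=
  roofCopy a b side '' ((sharedGraph 𝒳).edgeSet \ {s(a, b)}) ∪
    ({hinge a b true} ∪ ({hinge a b false} ∪ {commonHinge V}))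

/-- Folding back sends a common pair of two copied members to a common pair of the originals; a roof
meets a copied member only in a hinge, and the two roofs meet in the common hinge. An inclusion
suffices for independence and for the upper bounds on ranks. -/
theorem edgeSet_sharedGraph_roofCover [Fintype V] (hab : a ≠ b) (ht : IsTightCover H 𝒳)
    (hS : IsSharedNonedge H 𝒳 a b) (hσ : IsSideOf H 𝒳 a b side σ) :
    (sharedGraph (roofCover H 𝒳 a b side σ)).edgeSet ⊆ roofShared 𝒳 a b side := by
  have h2 := isTwoThin_roofCover (side := side) (σ := σ) hab ht
  have hc := isCover_roofCover hab ht hS hσ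
  intro e
  induction e with | _ x y =>
  rw [SimpleGraph.mem_edgeSet, sharedGraph_adj_iff h2]
  rintro ⟨hxy, hd⟩
  obtain ⟨P, hP, Q, hQ, hne, hP', hQ'⟩ := exists_of_two_le_pairDegree hd
  have hxP := hP' x (by simp)
  have hyP := hP' y (by simp)
  have hxQ := hQ' x (by simp)
  have hyQ := hQ' y (by simp)
  clear hP' hQ' hd
  have key : ∀ e ∈ freeEdges H 𝒳, x ∈ (roofCopy a b side e).toFinset →
      y ∈ (roofCopy a b side e).toFinset → ∀ Q ∈ roofCover H 𝒳 a b side σ, x ∈ Q → y ∈ Q →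
      (roofCopy a b side e).toFinset = Q := by
    intro e he hx hy Q hQ hxQ hyQ
    rw [Sym2.mem_toFinset] at hx hy
    refine hc.incomparable _ (mem_roofCover.2 (Or.inr (Or.inl ⟨e, he, rfl⟩))) Q hQ fun z hz => ?_
    rw [Sym2.mem_toFinset, ← mk_eq_of_mem hxy hx hy, Sym2.mem_iff] at hz
    rcases hz with rfl | rfl <;> assumption
  have hh : ∀ i, hinge a b i ∈ roofShared 𝒳 a b side := by
    rintro (_ | _)
    · exact Or.inr (Or.inr (Or.inl rfl))
    · exact Or.inr (Or.inl rfl)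
  have hXR : ∀ (X : Finset V) i i' j, x ∈ X.map (sideIncl a b i) → y ∈ X.map (sideIncl a b i) →
      x ∈ roofSet a b i' j → y ∈ roofSet a b i' j → s(x, y) ∈ roofShared 𝒳 a b side := by
    intro X i i' j hx hy hx' hy'
    rw [eq_hinge_of_subset hxy hx' hy' (notMem_range_of_mem_map hx) (notMem_range_of_mem_map hy)]
    exact hh i'
  have hRR : x ∈ roofSet a b true 2 → y ∈ roofSet a b true 2 → x ∈ roofSet a b false 3 →
      y ∈ roofSet a b false 3 → s(x, y) ∈ roofShared 𝒳 a b side := by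
    intro hx hy hx' hy'
    have h4 : s(x, y) = commonHinge V := by
      rw [commonHinge, Sym2.eq_iff]
      rcases mem_roofSet_inter hab hx hx' with rfl | rfl <;>
        rcases mem_roofSet_inter hab hy hy' with rfl | rfl <;> simp_all
    exact Or.inr (Or.inr (Or.inr h4))
  rcases mem_roofCover.1 hP with ⟨X, hX, rfl⟩ | ⟨e, he, rfl⟩ | rfl | rfl
  · rcases mem_roofCover.1 hQ with ⟨Y, hY, rfl⟩ | ⟨e, he, rfl⟩ | rfl | rfl
    · obtain ⟨x, hx, rfl⟩ := Finset.mem_map.1 hxP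
      obtain ⟨y, hy, rfl⟩ := Finset.mem_map.1 hyP
      obtain ⟨x', hx', hxx⟩ := Finset.mem_map.1 hxQ
      obtain ⟨y', hy', hyy⟩ := Finset.mem_map.1 hyQ
      rw [eq_of_sideIncl_eq hxx] at hx'
      rw [eq_of_sideIncl_eq hyy] at hy'
      rw [← Sym2.map_mk]
      by_cases hxyab : s(x, y) = s(a, b)
      · rw [hxyab]
        exact hh _
      · have hsh : (sharedGraph 𝒳).Adj x y := by
          rw [sharedGraph_adj_iff ht.twoThin]
          refine ⟨fun h => hxy (h ▸ rfl), Finset.one_lt_card.2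
            ⟨X, ?_, Y, ?_, fun h => hne (h ▸ rfl)⟩⟩
          · simpa [hx, hy] using (Finset.mem_filter.1 hX).1
          · simpa [hx', hy'] using (Finset.mem_filter.1 hY).1
        refine Or.inl ⟨s(x, y), ⟨hsh, hxyab⟩, ?_⟩
        exact hσ.roofCopy_eq hX
          (mk_mem_edgesIn.2 ⟨sharedGraph_le_starGraph H 𝒳 hsh, hx, hy⟩) hxyab
    · exact absurd (key e he hxQ hyQ _ hP hxP hyP).symm hne
    · exact hXR X _ _ _ hxP hyP hxQ hyQ
    · exact hXR X _ _ _ hxP hyP hxQ hyQ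
  · exact absurd (key e he hxP hyP _ hQ hxQ hyQ) hne
  · rcases mem_roofCover.1 hQ with ⟨Y, hY, rfl⟩ | ⟨e, he, rfl⟩ | rfl | rfl
    · exact hXR Y _ _ _ hxQ hyQ hxP hyP
    · exact absurd (key e he hxQ hyQ _ hP hxP hyP).symm hne
    · exact absurd rfl hne
    · exact hRR hxP hyP hxQ hyQ
  · rcases mem_roofCover.1 hQ with ⟨Y, hY, rfl⟩ | ⟨e, he, rfl⟩ | rfl | rfl
    · exact hXR Y _ _ _ hxQ hyQ hxP hyP
    · exact absurd (key e he hxQ hyQ _ hP hxP hyP).symm hne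
    · exact hRR hxQ hyQ hxP hyP
    · exact absurd rfl hne

end RoofCover

/-! ### Tightness of the cover after roof-addition -/

section RoofTight
variable {V : Type*} {H : SimpleGraph V} {𝒳 : Finset (Finset V)} {a b : V}
  {side : Sym2 V → Bool} {σ : Finset V → Bool}

/-- Both hinges collapse to the pair {a, b}, so the collapse is not injective on these pairs. The
two hinges and the common hinge are handled by disjoint supports, the remaining pairs by folding
back. -/
theorem linearIndepOn_roofShared [Fintype V] (hS : IsIndependent (sharedGraph 𝒳))
    (hab : (sharedGraph 𝒳).Adj a b) {p : V ⊕ Fin 3 → Space} (hp : InGeneralPosition p) :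
    LinearIndepOn ℝ (rigidityRow (p ∘ collapse a b)) (roofShared 𝒳 a b side) := by
  have hbase : LinearIndepOn ℝ (rigidityRow p)
      (Sym2.map Sum.inl '' (sharedGraph 𝒳).edgeSet ∪ {s(Sum.inr 0, Sum.inr 1)}) := by
    refine LinearIndepOn.union
      ((linearIndepOn_map_iff Function.Embedding.inl _ _).1
        (hS.linearIndepOn (hp.comp Function.Embedding.inl)))
      ((hp.linearIndepOn_pairsIn (T := {Sum.inr 0, Sum.inr 1})
        (Finset.card_le_two.trans (by norm_num))).mono ?_) ?_
    · rintro _ rfl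
      exact mk_mem_pairsIn.2 ⟨by simp, by simp, by simp⟩
    · refine Submodule.disjoint_def.2 fun F hF hF' => ?_
      ext1 z
      rcases z with z | z
      · refine apply_eq_zero_of_mem_rowSpan hF' ?_
        rintro _ rfl
        simp
      · refine apply_eq_zero_of_mem_rowSpan hF ?_
        rintro _ ⟨e, -, rfl⟩
        simp
  have hsingle (e : Sym2 ((V ⊕ Fin 2) ⊕ Fin 4)) (he : e.map (collapse a b) ∈
      Sym2.map Sum.inl '' (sharedGraph 𝒳).edgeSet ∪ {s(Sum.inr 0, Sum.inr 1)}) :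
      LinearIndepOn ℝ (rigidityRow (p ∘ collapse a b)) {e} :=
    linearIndepOn_comp (Set.injOn_singleton _ _) (hbase.mono (by simpa using he))
  have hh (i : Bool) : (hinge a b i).map (collapse a b) = s(a, b).map Sum.inl :=
    map_collapse_map_sideIncl a b i s(a, b)
  have himg : Sym2.map (collapse a b) ''
      (roofCopy a b side '' ((sharedGraph 𝒳).edgeSet \ {s(a, b)})) =
      Sym2.map Sum.inl '' ((sharedGraph 𝒳).edgeSet \ {s(a, b)}) := by
    rw [Set.image_image]
    simp only [map_collapse_roofCopy]
  have hinj : Set.InjOn (Sym2.map (collapse a b))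
      (roofCopy a b side '' ((sharedGraph 𝒳).edgeSet \ {s(a, b)})) := by
    rintro _ ⟨e, -, rfl⟩ _ ⟨e', -, rfl⟩ h
    rw [map_collapse_roofCopy, map_collapse_roofCopy] at h
    rw [Sym2.map.injective Sum.inl_injective h]
  have hALI : LinearIndepOn ℝ (rigidityRow p) (Sym2.map (collapse a b) ''
      (roofCopy a b side '' ((sharedGraph 𝒳).edgeSet \ {s(a, b)}))) := by
    rw [himg]
    exact hbase.mono fun e he => Or.inl (Set.image_mono Set.sdiff_subset he)
  refine LinearIndepOn.union (linearIndepOn_comp hinj hALI) (LinearIndepOn.union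
    (hsingle _ (Or.inl ⟨_, hab, (hh _).symm⟩)) (LinearIndepOn.union
      (hsingle _ (Or.inl ⟨_, hab, (hh _).symm⟩)) (hsingle _ (Or.inr rfl)) ?_) ?_) ?_
  · refine Submodule.disjoint_def.2 fun F hF hF' => ?_
    ext1 z
    rcases z with z | z
    · refine apply_eq_zero_of_mem_rowSpan hF' ?_
      rintro _ rfl
      simp [commonHinge]
    · refine apply_eq_zero_of_mem_rowSpan hF ?_
      rintro _ rfl
      exact notMem_hinge
  · refine Submodule.disjoint_def.2 fun F hF hF' => ?_
    ext1 z
    by_cases hz : z ∈ hinge a b true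
    · refine apply_eq_zero_of_mem_rowSpan hF' ?_
      rw [hinge, Sym2.map_mk, Sym2.mem_iff] at hz
      rintro _ (rfl | rfl)
      · rcases hz with rfl | rfl <;>
          simp [hinge, sideIncl_apply, lift_true, lift_false_left, lift_false_right hab.ne]
      · rcases hz with rfl | rfl <;> simp [commonHinge, sideIncl_apply]
    · refine apply_eq_zero_of_mem_rowSpan hF ?_
      rintro _ rfl
      exact hz
  -- After the collapse, the load is resolved both by the old shared pairs other than {a, b} and by
  -- {a, b} with the common hinge. These belong to one independent set, so the collapsed load is
  -- zero.
  · refine Submodule.disjoint_def.2 fun F hF hF' => ?_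
    refine eq_zero_of_push_eq_zero hinj hALI hF ?_
    have h1 := push_mem_rowSpan (collapse a b) p hF
    have h2 := push_mem_rowSpan (collapse a b) p hF'
    rw [himg] at h1
    simp only [Set.image_union, Set.image_singleton, hh] at h2
    rw [← Set.union_assoc, Set.union_self] at h2
    have hsub : {s(a, b)} ⊆ (sharedGraph 𝒳).edgeSet := by
      rintro _ rfl
      exact hab
    have h3 : Sym2.map Sum.inl '' (sharedGraph 𝒳).edgeSet ∪
        {(s(Sum.inr 0, Sum.inr 1) : Sym2 (V ⊕ Fin 3))} =
        Sym2.map Sum.inl '' ((sharedGraph 𝒳).edgeSet \ {s(a, b)}) ∪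
        ({Sym2.map Sum.inl s(a, b)} ∪ {(commonHinge V).map (collapse a b)}) := by
      rw [← Set.union_assoc, ← Set.image_singleton (f := Sym2.map Sum.inl), ← Set.image_union, Set.sdiff_union_self,
        Set.union_eq_self_of_subset_right hsub]
      rfl
    rw [h3, linearIndepOn_union_iff] at hbase
    · exact Submodule.disjoint_def.1 hbase.2.2 _ h1 h2
    · rw [Set.disjoint_left]
      rintro _ ⟨e, he, rfl⟩ (h | h)
      · exact he.2 (Sym2.map.injective Sum.inl_injective h)
      · have : Sum.inr 0 ∈ Sym2.map (Sum.inl : V → V ⊕ Fin 3) e := by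
          rw [h]
          simp [commonHinge, collapse]
        simp at this

theorem mem_of_map_sideIncl_subset {e : Sym2 V} {X : Finset V} {i j : Bool}
    (h : ∀ x ∈ e.map (sideIncl a b j), x ∈ X.map (sideIncl a b i)) {z : V} (hz : z ∈ e) :
    z ∈ X := by
  obtain ⟨y, hy, h2⟩ := Finset.mem_map.1 (h _ (Sym2.mem_map.2 ⟨z, hz, rfl⟩))
  rwa [← eq_of_sideIncl_eq h2]

theorem exists_inr_mem_of_mem_sideRoof {i : Bool} {j : Fin 4}
    {e : Sym2 ((V ⊕ Fin 2) ⊕ Fin 4)} (h : e ∈ sideRoof a b i j) : ∃ k, Sum.inr k ∈ e := by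
  simp only [sideRoof, roofEdges, Set.mem_insert_iff, Set.mem_singleton_iff] at h
  rcases h with rfl | rfl | rfl | rfl | h
  · exact ⟨0, by simp⟩
  · exact ⟨1, by simp⟩
  · exact ⟨0, by simp⟩
  · exact ⟨1, by simp⟩
  · refine ⟨j, ?_⟩
    rcases h with rfl | rfl | rfl | rfl <;> simp

theorem edgeSet_roofAddition_eq (H : SimpleGraph V) (hab : a ≠ b) (side : Sym2 V → Bool) :
    (roofAddition H a b side).edgeSet =
      roofCopy a b side '' H.edgeSet ∪ (sideRoof a b true 2 ∪ sideRoof a b false 3) := by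
  rw [edgeSet_roofAddition H hab, edgeSet_graphCut, Set.image_image]
  rfl

/-- No new edge lies inside a copied member, so its induced star graph has at most the rank it had
before. A hinge inside the copy comes from {a, b} inside the original. -/
theorem edgesIn_starGraph_roofCover [Fintype V] (hab : a ≠ b) (ht : IsTightCover H 𝒳)
    (hS : IsSharedNonedge H 𝒳 a b) (hσ : IsSideOf H 𝒳 a b side σ) {X : Finset V}
    (hX : X ∈ goodMembers H 𝒳) :
    edgesIn (starGraph (roofAddition H a b side) (roofCover H 𝒳 a b side σ))
        (X.map (sideIncl a b (σ X)) : Finset ((V ⊕ Fin 2) ⊕ Fin 4)) ⊆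
      Sym2.map (sideIncl a b (σ X)) '' edgesIn (starGraph H 𝒳) X := by
  have hcopy : ∀ e ∈ (starGraph H 𝒳).edgeSet, e ≠ s(a, b) →
      (∀ x ∈ roofCopy a b side e, x ∈ X.map (sideIncl a b (σ X))) →
      roofCopy a b side e ∈ Sym2.map (sideIncl a b (σ X)) '' edgesIn (starGraph H 𝒳) X := by
    intro e he hne heX
    have h1 : e ∈ edgesIn (starGraph H 𝒳) X := ⟨he, fun z hz => mem_of_roofCopy_subset heX hz⟩
    exact ⟨e, h1, (hσ.roofCopy_eq hX h1 hne).symm⟩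
  have hhinge : ∀ i, (∀ x ∈ hinge a b i, x ∈ X.map (sideIncl a b (σ X))) →
      hinge a b i ∈ Sym2.map (sideIncl a b (σ X)) '' edgesIn (starGraph H 𝒳) X := by
    intro i h
    refine ⟨s(a, b), ⟨sharedGraph_le_starGraph H 𝒳 hS.1,
      fun z hz => mem_of_map_sideIncl_subset h hz⟩, ?_⟩
    have hz (z : V) (hz : z ∈ s(a, b)) : sideIncl a b (σ X) z = sideIncl a b i z := by
      obtain ⟨y, -, h2⟩ := Finset.mem_map.1 (h _ (Sym2.mem_map.2 ⟨z, hz, rfl⟩))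
      rw [← h2, eq_of_sideIncl_eq h2]
    rw [hinge, Sym2.map_mk, Sym2.map_mk, hz a (by simp), hz b (by simp)]
  rintro e ⟨he, heX⟩
  rw [edgeSet_starGraph, edgeSet_roofAddition_eq H hab] at he
  have hinr : ∀ k, Sum.inr k ∉ e := fun k hk => notMem_map_sideIncl (heX _ hk)
  rcases he with (⟨e, he, rfl⟩ | he | he) | he
  · refine hcopy e (SimpleGraph.edgeSet_mono (le_starGraph H 𝒳) he) ?_ heX
    rintro rfl
    exact hS.2 he
  · obtain ⟨k, hk⟩ := exists_inr_mem_of_mem_sideRoof he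
    exact absurd hk (hinr k)
  · obtain ⟨k, hk⟩ := exists_inr_mem_of_mem_sideRoof he
    exact absurd hk (hinr k)
  · rcases edgeSet_sharedGraph_roofCover hab ht hS hσ he with ⟨e, he', rfl⟩ | rfl | rfl | rfl
    · exact hcopy e (SimpleGraph.edgeSet_mono (sharedGraph_le_starGraph H 𝒳) he'.1) he'.2 heX
    · exact hhinge _ heX
    · exact hhinge _ heX
    · exact absurd (by simp [commonHinge]) (hinr 0)

theorem card_le_pairDegree {α : Type*} {𝒴 T : Finset (Finset α)} {e : Sym2 α}
    (h : ∀ P ∈ T, P ∈ 𝒴 ∧ ∀ x ∈ e, x ∈ P) : T.card ≤ pairDegree 𝒴 e :=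
  Finset.card_le_card fun P hP => Finset.mem_filter.2 (h P hP)

theorem exists_finset_pairDegree {α : Type*} (𝒴 : Finset (Finset α)) (e : Sym2 α) :
    ∃ T : Finset (Finset α), T.card = pairDegree 𝒴 e ∧
      ∀ P, P ∈ T ↔ P ∈ 𝒴 ∧ ∀ x ∈ e, x ∈ P :=
  ⟨_, rfl, fun _ => Finset.mem_filter⟩

theorem pairDegree_sdiff_add {α : Type*} {𝒴 𝒵 : Finset (Finset α)} (h : 𝒵 ⊆ 𝒴) (e : Sym2 α) :
    pairDegree (𝒴 \ 𝒵) e + pairDegree 𝒵 e = pairDegree 𝒴 e := by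
  simp only [pairDegree, Finset.card_filter]
  exact Finset.sum_sdiff h

theorem mem_goodMembers_of_mem {x y : V} (h : IsSharedNonedge H 𝒳 x y) {X : Finset V}
    (hX : X ∈ 𝒳) (hx : x ∈ X) (hy : y ∈ X) : X ∈ goodMembers H 𝒳 :=
  Finset.mem_filter.2 ⟨hX, x, hx, y, hy, h⟩

theorem goodMembers_subset : goodMembers H 𝒳 ⊆ 𝒳 := Finset.filter_subset _ _

theorem injOn_map_sideIncl (hc : IsCover H 𝒳) : Set.InjOn
    (fun X : Finset V => X.map (sideIncl a b (σ X))) (goodMembers H 𝒳 : Set (Finset V)) :=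
  fun _ hX _ hY h => eq_of_map_sideIncl_subset hc hX hY (Finset.subset_of_eq h)

/-- A pair in two good members is shared, so all their copies contain the same copy of it. For other
pairs the left side is zero. -/
theorem pairDegree_le_roofCopy [Fintype V] (ht : IsTightCover H 𝒳)
    (hσ : IsSideOf H 𝒳 a b side σ) {e : Sym2 V} (hdiag : ¬ e.IsDiag) (hne : e ≠ s(a, b)) :
    pairDegree (goodMembers H 𝒳) e - 1 ≤
      pairDegree (roofCover H 𝒳 a b side σ) (roofCopy a b side e) - 1 := by
  by_cases h2 : 2 ≤ pairDegree (goodMembers H 𝒳) e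
  · refine Nat.sub_le_sub_right ?_ 1
    have hsh : e ∈ (sharedGraph 𝒳).edgeSet := by
      induction e with | _ x y =>
      rw [SimpleGraph.mem_edgeSet, sharedGraph_adj_iff ht.twoThin]
      refine ⟨hdiag, h2.trans ?_⟩
      rw [← pairDegree_sdiff_add (goodMembers_subset (H := H) (𝒳 := 𝒳))]
      exact Nat.le_add_left _ _
    obtain ⟨T, hT, hT'⟩ := exists_finset_pairDegree (goodMembers H 𝒳) e
    rw [← hT, ← Finset.card_image_of_injOn ((injOn_map_sideIncl (a := a) (b := b) (σ := σ)
      ht.cover).mono fun X hX => ((hT' X).1 hX).1)]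
    refine card_le_pairDegree fun P hP => ?_
    obtain ⟨X, hX, rfl⟩ := Finset.mem_image.1 hP
    obtain ⟨hX1, hX2⟩ := (hT' X).1 hX
    refine ⟨mem_roofCover.2 (Or.inl ⟨X, hX1, rfl⟩), fun z hz => ?_⟩
    rw [hσ.roofCopy_eq hX1 ⟨SimpleGraph.edgeSet_mono (sharedGraph_le_starGraph H 𝒳) hsh, hX2⟩ hne]
      at hz
    obtain ⟨t, ht, rfl⟩ := Sym2.mem_map.1 hz
    exact Finset.mem_map_of_mem _ (hX2 t ht)
  · omega

/-- Every good member through a and b is copied to exactly one side and contains the hinge there; in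
addition, each hinge lies in its roof. -/
theorem pairDegree_hinge [Fintype V] (hc : IsCover H 𝒳) :
    pairDegree (goodMembers H 𝒳) s(a, b) + 2 ≤
      pairDegree (roofCover H 𝒳 a b side σ) (hinge a b true) +
        pairDegree (roofCover H 𝒳 a b side σ) (hinge a b false) := by
  obtain ⟨T, hT, hT'⟩ := exists_finset_pairDegree (goodMembers H 𝒳) s(a, b)
  have key (i : Bool) (j : Fin 4) (hR : roofSet a b i j ∈ roofCover H 𝒳 a b side σ) :
      {X ∈ T | σ X = i}.card + 1 ≤ pairDegree (roofCover H 𝒳 a b side σ) (hinge a b i) := by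
    rw [← Finset.card_image_of_injOn ((injOn_map_sideIncl (a := a) (b := b) (σ := σ)
      hc).mono fun X hX => ((hT' X).1 (Finset.mem_filter.1 hX).1).1)]
    rw [← Finset.card_insert_of_notMem (a := roofSet a b i j)]
    · refine card_le_pairDegree fun P hP => ?_
      rw [Finset.mem_insert, Finset.mem_image] at hP
      rcases hP with rfl | ⟨X, hX, rfl⟩
      · refine ⟨hR, fun x hx => ?_⟩
        rw [hinge, Sym2.map_mk, Sym2.mem_iff] at hx
        rcases hx with rfl | rfl <;> simp [roofSet]
      · obtain ⟨hX, hi⟩ := Finset.mem_filter.1 hX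
        obtain ⟨hX1, hX2⟩ := (hT' X).1 hX
        refine ⟨mem_roofCover.2 (Or.inl ⟨X, hX1, rfl⟩), fun x hx => ?_⟩
        obtain ⟨t, ht, rfl⟩ := Sym2.mem_map.1 hx
        rw [← hi]
        exact Finset.mem_map_of_mem _ (hX2 t ht)
    · intro h
      obtain ⟨X, -, hX⟩ := Finset.mem_image.1 h
      have h0 : Sum.inr 0 ∈ roofSet a b i j := by simp [roofSet]
      rw [← hX] at h0
      exact notMem_map_sideIncl h0
  have h1 := key true 2 (mem_roofCover.2 (Or.inr (Or.inr (Or.inl rfl))))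
  have h2 := key false 3 (mem_roofCover.2 (Or.inr (Or.inr (Or.inr rfl))))
  have h3 := Finset.card_filter_add_card_filter_not (s := T) (fun X => σ X = true)
  simp only [Bool.not_eq_true] at h3
  omega

theorem roofSet_true_ne_false : roofSet a b true 2 ≠ roofSet a b false 3 := by
  intro h
  have h2 : Sum.inr 2 ∈ roofSet a b true 2 := by simp [roofSet]
  rw [h] at h2
  simp [roofSet, sideIncl_apply] at h2

theorem two_le_pairDegree_commonHinge [Fintype V] :
    2 ≤ pairDegree (roofCover H 𝒳 a b side σ) (commonHinge V) := by
  refine (Finset.card_pair (roofSet_true_ne_false (a := a) (b := b))).symm.le.trans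
    (card_le_pairDegree fun P hP => ?_)
  rw [Finset.mem_insert, Finset.mem_singleton] at hP
  rcases hP with rfl | rfl
  · exact ⟨mem_roofCover.2 (Or.inr (Or.inr (Or.inl rfl))), by simp [commonHinge, roofSet]⟩
  · exact ⟨mem_roofCover.2 (Or.inr (Or.inr (Or.inr rfl))), by simp [commonHinge, roofSet]⟩

/-- The pairs of distinct vertices other than `{a, b}`. -/
def otherPairs [Fintype V] (a b : V) : Finset (Sym2 V) :=
  ({e | ¬ e.IsDiag} : Finset (Sym2 V)).erase s(a, b)

theorem mem_otherPairs [Fintype V] {e : Sym2 V} :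
    e ∈ otherPairs a b ↔ e ≠ s(a, b) ∧ ¬ e.IsDiag := by
  simp [otherPairs]

theorem excess_eq_otherPairs [Fintype V] (hab : a ≠ b) (𝒴 : Finset (Finset V)) :
    excess 𝒴 = ∑ e ∈ otherPairs a b, (pairDegree 𝒴 e - 1) + (pairDegree 𝒴 s(a, b) - 1) := by
  rw [excess, otherPairs, Finset.sum_erase_add]
  simpa using hab

/-- The two hinges together contribute the old degree of {a, b}, one more than before, and the
common hinge contributes at least one. -/
theorem le_excess_roofCover [Fintype V] (hab : a ≠ b) (ht : IsTightCover H 𝒳)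
    (hσ : IsSideOf H 𝒳 a b side σ) :
    ∑ e ∈ otherPairs a b, (pairDegree (goodMembers H 𝒳) e - 1) +
      pairDegree (goodMembers H 𝒳) s(a, b) + 1 ≤ excess (roofCover H 𝒳 a b side σ) := by
  let D (e : Sym2 ((V ⊕ Fin 2) ⊕ Fin 4)) : ℕ := pairDegree (roofCover H 𝒳 a b side σ) e - 1
  have h1 : ∑ e ∈ otherPairs a b, (pairDegree (goodMembers H 𝒳) e - 1) ≤
      ∑ e ∈ (otherPairs a b).image (roofCopy a b side), D e := by
    rw [Finset.sum_image (roofCopy_injective a b side).injOn]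
    refine Finset.sum_le_sum fun e he => ?_
    rw [mem_otherPairs] at he
    exact pairDegree_le_roofCopy ht hσ he.2 he.1
  have hcopy (i : Bool) : hinge a b i ∉ (otherPairs a b).image (roofCopy a b side) := by
    intro h
    obtain ⟨e, he, h⟩ := Finset.mem_image.1 h
    exact roofCopy_ne_hinge (mem_otherPairs.1 he).1 h
  have hcommon : commonHinge V ∉ (otherPairs a b).image (roofCopy a b side) := by
    intro h
    obtain ⟨e, -, h⟩ := Finset.mem_image.1 h
    exact roofCopy_ne_commonHinge h
  have h2 : ∑ e ∈ insert (hinge a b true) (insert (hinge a b false) (insert (commonHinge V)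
      ((otherPairs a b).image (roofCopy a b side)))), D e ≤
      excess (roofCover H 𝒳 a b side σ) := by
    refine sum_le_excess _ fun e he => ?_
    simp only [Finset.mem_insert, Finset.mem_image] at he
    have hh (i : Bool) : ¬ (hinge a b i).IsDiag := by
      rw [hinge, Sym2.isDiag_map (sideIncl a b i).injective]
      exact hab
    rcases he with rfl | rfl | rfl | ⟨e, he, rfl⟩
    · exact hh _
    · exact hh _
    · simp [commonHinge]
    · rw [isDiag_roofCopy]
      exact (mem_otherPairs.1 he).2
  rw [Finset.sum_insert, Finset.sum_insert, Finset.sum_insert hcommon] at h2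
  · have h3 := pairDegree_hinge (a := a) (b := b) (side := side) (σ := σ) ht.cover
    have h4 := two_le_pairDegree_commonHinge (H := H) (𝒳 := 𝒳) (a := a) (b := b) (side := side)
      (σ := σ)
    simp only [D] at h1 h2
    omega
  · rw [Finset.mem_insert, not_or]
    exact ⟨hinge_ne_commonHinge, hcopy _⟩
  · rw [Finset.mem_insert, Finset.mem_insert, not_or, not_or]
    exact ⟨hinge_true_ne_false hab, hinge_ne_commonHinge, hcopy _⟩

/-- Compare pair by pair. A shared non-edge lies only in good members. For an edge, the degree is
split between good and bad members; if no good member contains it, the unit lost by truncation is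
the one that counts it as free. -/
theorem excess_add_card_freeEdges_le [Fintype V] (hab : a ≠ b) (ht : IsTightCover H 𝒳)
    (hS : IsSharedNonedge H 𝒳 a b) :
    excess 𝒳 + (freeEdges H 𝒳).card + 1 ≤
      ∑ e ∈ otherPairs a b, (pairDegree (goodMembers H 𝒳) e - 1) +
      pairDegree (goodMembers H 𝒳) s(a, b) +
      ∑ e ∈ H.edgeSet.toFinset, pairDegree (𝒳 \ goodMembers H 𝒳) e := by
  have hH : H.edgeSet.toFinset ⊆ otherPairs a b := by
    intro e he
    rw [Set.mem_toFinset] at he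
    rw [mem_otherPairs]
    refine ⟨?_, H.not_isDiag_of_mem_edgeSet he⟩
    rintro rfl
    exact hS.2 he
  have hfree : freeEdges H 𝒳 ⊆ otherPairs a b := (Finset.filter_subset _ _).trans hH
  have hbad : ∀ x y, IsSharedNonedge H 𝒳 x y → pairDegree (𝒳 \ goodMembers H 𝒳) s(x, y) = 0 := by
    intro x y h
    refine pairDegree_eq_zero_iff.2 fun X hX hX' => ?_
    rw [Finset.mem_sdiff] at hX
    exact hX.2 (mem_goodMembers_of_mem h hX.1 (hX' x (by simp)) (hX' y (by simp)))
  have hsplit := pairDegree_sdiff_add (goodMembers_subset (H := H) (𝒳 := 𝒳))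
  have hdab := ((sharedGraph_adj_iff ht.twoThin).1 hS.1).2
  have h1 : (freeEdges H 𝒳).card = ∑ e ∈ otherPairs a b, if e ∈ freeEdges H 𝒳 then 1 else 0 := by
    rw [Finset.sum_ite_mem, Finset.inter_eq_right.2 hfree, Finset.card_eq_sum_ones]
  have h2 : ∑ e ∈ H.edgeSet.toFinset, pairDegree (𝒳 \ goodMembers H 𝒳) e =
      ∑ e ∈ otherPairs a b, if e ∈ H.edgeSet.toFinset then
        pairDegree (𝒳 \ goodMembers H 𝒳) e else 0 := by
    rw [Finset.sum_ite_mem, Finset.inter_eq_right.2 hH]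
  have h3 : ∑ e ∈ otherPairs a b, (pairDegree 𝒳 e - 1) + (freeEdges H 𝒳).card ≤
      ∑ e ∈ otherPairs a b, (pairDegree (goodMembers H 𝒳) e - 1) +
        ∑ e ∈ H.edgeSet.toFinset, pairDegree (𝒳 \ goodMembers H 𝒳) e := by
    rw [h1, h2, ← Finset.sum_add_distrib, ← Finset.sum_add_distrib]
    refine Finset.sum_le_sum fun e he => ?_
    have h4 := hsplit e
    by_cases heH : e ∈ H.edgeSet
    · rw [if_pos (Set.mem_toFinset.2 heH)]
      have h5 : pairDegree 𝒳 e ≠ 0 := by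
        rw [Ne, pairDegree_eq_zero_iff]
        intro h
        induction e with | _ x y =>
        obtain ⟨X, hX, hx, hy⟩ := ht.cover.covers x y heH
        exact h X hX (by simp [hx, hy])
      split_ifs with h
      · have h6 : pairDegree (goodMembers H 𝒳) e = 0 := (Finset.mem_filter.1 h).2
        omega
      · have h6 : pairDegree (goodMembers H 𝒳) e ≠ 0 := fun h0 =>
          h (Finset.mem_filter.2 ⟨Set.mem_toFinset.2 heH, h0⟩)
        omega
    · rw [if_neg fun h => heH (Set.mem_toFinset.1 h), if_neg fun h => heH (mem_freeEdges.1 h).1]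
      by_cases h2 : 2 ≤ pairDegree 𝒳 e
      · have h7 : pairDegree (𝒳 \ goodMembers H 𝒳) e = 0 := by
          induction e with | _ x y =>
          exact hbad x y ⟨(sharedGraph_adj_iff ht.twoThin).2 ⟨(mem_otherPairs.1 he).2, h2⟩, heH⟩
        omega
      · omega
  have h8 := hsplit s(a, b)
  rw [hbad a b hS] at h8
  rw [excess_eq_otherPairs hab]
  omega

theorem ncard_edgeSet_roofAddition [Finite V] (hab : a ≠ b) :
    (roofAddition H a b side).edgeSet.ncard = H.edgeSet.ncard + 16 := by
  rw [edgeSet_roofAddition_eq H hab, Set.ncard_union_eq, Set.ncard_union_eq,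
    Set.ncard_image_of_injective _ (roofCopy_injective a b side), sideRoof, sideRoof,
    ncard_roofEdges (nodup_side hab true (Or.inl rfl)),
    ncard_roofEdges (nodup_side hab false (Or.inr rfl))]
  · rw [Set.disjoint_left]
    intro e h h'
    simp only [sideRoof, roofEdges, Set.mem_insert_iff, Set.mem_singleton_iff, lift_true,
      lift_false_left, lift_false_right hab] at h h'
    rcases h with rfl | rfl | rfl | rfl | rfl | rfl | rfl | rfl <;>
      simp at h'
  · rw [Set.disjoint_left]
    rintro _ ⟨e, -, rfl⟩ (h | h) <;>
    · obtain ⟨k, hk⟩ := exists_inr_mem_of_mem_sideRoof h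
      exact notMem_roofCopy hk

theorem sum_union_le {α : Type*} [DecidableEq α] (s t : Finset α) (f : α → ℕ) :
    ∑ x ∈ s ∪ t, f x ≤ ∑ x ∈ s, f x + ∑ x ∈ t, f x := by
  rw [← Finset.sum_union_inter]
  exact Nat.le_add_right _ _

/-- The ranks of the copied members do not grow, each leftover edge costs at most one, and the roofs
cost at most 18. Bad members are traded for their edges. The total is balanced by the 16 new edges
and the two additional units of excess. -/
theorem isTightCover_roofCover [Fintype V] (hH : IsIndependent H) (ht : IsTightCover H 𝒳)
    (hS : IsSharedNonedge H 𝒳 a b) (hσ : IsSideOf H 𝒳 a b side σ) :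
    IsTightCover (roofAddition H a b side) (roofCover H 𝒳 a b side σ) := by
  have hab := hS.1.ne
  refine isTightCover_of_le (isCover_roofCover hab ht hS hσ) (isTwoThin_roofCover hab ht) ?_ ?_
  · obtain ⟨p, hp⟩ := exists_inGeneralPosition (V ⊕ Fin 3)
    exact isIndependent_iff_exists.2 ⟨_, (linearIndepOn_roofShared ht.shared_independent hS.1
      hp).mono (edgeSet_sharedGraph_roofCover hab ht hS hσ)⟩
  · let r (P : Finset ((V ⊕ Fin 2) ⊕ Fin 4)) : ℕ :=
      genRank (edgesIn (starGraph (roofAddition H a b side) (roofCover H 𝒳 a b side σ)) P)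
    let r₀ (X : Finset V) : ℕ := genRank (edgesIn (starGraph H 𝒳) X)
    have h1 : ∑ P ∈ (goodMembers H 𝒳).image (fun X => X.map (sideIncl a b (σ X))), r P ≤
        ∑ X ∈ goodMembers H 𝒳, r₀ X := by
      rw [Finset.sum_image (injOn_map_sideIncl ht.cover)]
      refine Finset.sum_le_sum fun X hX => ?_
      have := genRank_mono (edgesIn_starGraph_roofCover hab ht hS hσ hX)
      rwa [genRank_map] at this
    have h2 : ∑ P ∈ (freeEdges H 𝒳).image (fun e => (roofCopy a b side e).toFinset), r P ≤
        (freeEdges H 𝒳).card := by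
      rw [Finset.sum_image fun e _ e' _ h => roofCopy_injective a b side (toFinset_inj h)]
      rw [Finset.card_eq_sum_ones]
      refine Finset.sum_le_sum fun e he => ?_
      refine (genRank_le_ncard _).trans ((ncard_edgesIn_le_choose _ _).trans ?_)
      rw [Set.ncard_coe_finset, card_of_mem_freeEdges he]
      rfl
    -- Five vertices have rank at most 3 · 5 - 6 = 9.
    have hR (i : Bool) {j : Fin 4} (hj : j = 2 ∨ j = 3) : r (roofSet a b i j) ≤ 9 := by
      have hcard : ((roofSet a b i j : Finset _) : Set ((V ⊕ Fin 2) ⊕ Fin 4)).ncard = 5 := by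
        rw [Set.ncard_coe_finset, card_roofSet hab hj]
      have := genRank_edgesIn_add_six_le
        (starGraph (roofAddition H a b side) (roofCover H 𝒳 a b side σ))
        (U := (roofSet a b i j : Finset _)) (by omega)
      simp only [r]
      omega
    have h3 : ∑ P ∈ ({roofSet a b true 2, roofSet a b false 3} : Finset _), r P ≤ 18 := by
      rw [Finset.sum_pair roofSet_true_ne_false]
      have := hR true (j := 2) (Or.inl rfl)
      have := hR false (j := 3) (Or.inr rfl)
      omega
    have h4 : ∑ P ∈ roofCover H 𝒳 a b side σ, r P ≤
        ∑ X ∈ goodMembers H 𝒳, r₀ X + (freeEdges H 𝒳).card + 18 :=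
      (sum_union_le _ _ _).trans (Nat.add_le_add ((sum_union_le _ _ _).trans
        (Nat.add_le_add h1 h2)) h3)
    -- A bad member contains no shared non-edge, so its star graph is just an induced subgraph of
    -- the independent graph `H`; its rank is its number of edges.
    have h5 : ∑ X ∈ 𝒳 \ goodMembers H 𝒳, r₀ X =
        ∑ e ∈ H.edgeSet.toFinset, pairDegree (𝒳 \ goodMembers H 𝒳) e := by
      rw [← sum_ncard_edgesIn]
      refine Finset.sum_congr rfl fun X hX => ?_
      rw [Finset.mem_sdiff] at hX
      have h6 : edgesIn (starGraph H 𝒳) (X : Set V) = edgesIn H X := by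
        refine subset_antisymm ?_ (edgesIn_mono (le_starGraph H 𝒳) _)
        intro e
        induction e with | _ x y =>
        rw [mk_mem_edgesIn, mk_mem_edgesIn]
        rintro ⟨h | h, hx, hy⟩
        · exact ⟨h, hx, hy⟩
        · by_contra hne
          exact hX.2 (mem_goodMembers_of_mem ⟨h, fun h' => hne ⟨h', hx, hy⟩⟩ hX.1 hx hy)
      simp only [r₀]
      rw [h6, hH.genRank_edgesIn]
    have h6 : ∑ X ∈ 𝒳 \ goodMembers H 𝒳, r₀ X + ∑ X ∈ goodMembers H 𝒳, r₀ X = ∑ X ∈ 𝒳, r₀ X :=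
      Finset.sum_sdiff goodMembers_subset
    have h7 : ∑ X ∈ 𝒳, r₀ X = genRank H.edgeSet + excess 𝒳 := ht.sum_genRank
    rw [isIndependent_iff_genRank.1 hH] at h7
    have h8 := excess_add_card_freeEdges_le hab ht hS
    have h9 := le_excess_roofCover hab ht hσ
    rw [isIndependent_iff_genRank.1 (isIndependent_roofAddition hH hab side),
      ncard_edgeSet_roofAddition hab]
    change ∑ P ∈ roofCover H 𝒳 a b side σ, r P ≤ _
    omega

theorem isSharedNonedge_commonHinge [Fintype V] (ht : IsTightCover H 𝒳) (hab : a ≠ b) :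
    IsSharedNonedge (roofAddition H a b side) (roofCover H 𝒳 a b side σ)
      (Sum.inr 0) (Sum.inr 1) := by
  refine ⟨(sharedGraph_adj_iff (isTwoThin_roofCover hab ht)).2
    ⟨by simp, two_le_pairDegree_commonHinge⟩, fun h => ?_⟩
  rw [← SimpleGraph.mem_edgeSet, edgeSet_roofAddition_eq H hab] at h
  rcases h with ⟨e, -, h⟩ | h | h
  · exact roofCopy_ne_commonHinge h
  · simp [sideRoof, roofEdges] at h
  · simp [sideRoof, roofEdges] at h

/-- Only the two roofs contain u or v together with a shared non-edge, and each roof is assigned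
entirely to one side. -/
theorem respectsCover_hingeSide [Fintype V] (hab : a ≠ b) :
    RespectsCover (roofAddition H a b side) (roofCover H 𝒳 a b side σ) (Sum.inr 0) (Sum.inr 1)
      (hingeSide a b) := by
  intro P hP _
  rcases mem_roofCover.1 hP with ⟨X, hX, rfl⟩ | ⟨e, he, rfl⟩ | rfl | rfl
  · refine ⟨true, ?_⟩
    rintro x hx - - - (rfl | rfl) -
    · exact absurd hx notMem_map_sideIncl
    · exact absurd hx notMem_map_sideIncl
  · refine ⟨true, ?_⟩
    rintro x hx - - - (rfl | rfl) -
    · exact absurd (Sym2.mem_toFinset.1 hx) notMem_roofCopy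
    · exact absurd (Sym2.mem_toFinset.1 hx) notMem_roofCopy
  · refine ⟨true, fun x _ y hy hxy hx hne => ?_⟩
    have hxy := hxy.ne
    simp only [roofSet, Finset.mem_insert, Finset.mem_singleton, sideIncl_apply, lift_true] at hy
    rcases hy with rfl | rfl | rfl | rfl | rfl <;> rcases hx with rfl | rfl <;>
      simp_all [hingeSide, Sym2.eq_swap]
  · refine ⟨false, fun x _ y hy hxy hx hne => ?_⟩
    have hxy := hxy.ne
    simp only [roofSet, Finset.mem_insert, Finset.mem_singleton, sideIncl_apply, lift_false_left,
      lift_false_right hab] at hy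
    rcases hy with rfl | rfl | rfl | rfl | rfl <;> rcases hx with rfl | rfl <;>
      simp_all [hingeSide, Sym2.eq_swap]

/-- Roof-addition along an admissible cut gives a nucleation-free starting graph. -/
theorem isGoodStartingGraph_roofAddition [Finite V] (hH : IsIndependent H)
    (hcut : IsAdmissibleCut H 𝒳 a b side) : IsGoodStartingGraph (roofAddition H a b side) := by
  cases nonempty_fintype V
  have hab := hcut.shared_nonedge.1.ne
  obtain ⟨σ, hσ⟩ := hcut.respects.exists_isSideOf
  refine IsStartingGraph.isGoodStartingGraph ⟨isIndependent_roofAddition hH hab side,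
    roofCover H 𝒳 a b side σ, Sum.inr 0, Sum.inr 1, hingeSide a b,
    isTightCover_roofCover hH hcut.tight hcut.shared_nonedge hσ,
    isSharedNonedge_commonHinge hcut.tight hab, respectsCover_hingeSide hab,
    isNucleationFree_graphCut_roofAddition hH hab hcut.shared_nonedge.2 hcut.nucleationFree⟩
    (isNucleationFree_roofAddition hH hab hcut.shared_nonedge.2 hcut.nucleationFree)

end RoofTight

/-! ### The moves -/

section Small
variable {V : Type*} [Finite V]

theorem isIndependent_of_card_le_four (h : Nat.card V ≤ 4) (G : SimpleGraph V) :
    IsIndependent G := by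
  cases nonempty_fintype V
  obtain ⟨p, hp⟩ := exists_inGeneralPosition V
  refine isIndependent_iff_exists.2 ⟨p, (hp.linearIndepOn_pairsIn (T := Finset.univ) ?_).mono ?_⟩
  · rwa [Finset.card_univ, ← Nat.card_eq_fintype_card]
  · intro e he
    exact ⟨G.not_isDiag_of_mem_edgeSet he, fun x _ => by simp⟩

theorem isNucleationFree_of_card_le_four (h : Nat.card V ≤ 4) (G : SimpleGraph V) :
    IsNucleationFree G := by
  refine isNucleationFree_of_ncard fun U hU => ?_
  have := Set.ncard_le_card U
  omega

end Small

/-! ### Each move and finite sequences of moves. -/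

section Moves
variable {V : Type u} {W : Type u} {H : SimpleGraph V} {G : SimpleGraph W}

/-- An isomorphic copy is a pasting with the empty graph. -/
theorem IsGoodStartingGraph.of_iso {V : Type v} {W : Type w} {H : SimpleGraph V}
    {G : SimpleGraph W} [Finite V] (h : IsGoodStartingGraph H) (φ : H ≃g G) :
    IsGoodStartingGraph G := by
  have : Finite W := Finite.of_equiv V φ.toEquiv
  have hp : IsPasting H (⊥ : SimpleGraph (Fin 0)) G Fin.elim0 Fin.elim0
      φ.toEquiv.toEmbedding Function.Embedding.ofIsEmpty := by
    refine ⟨by norm_num, fun i => i.elim0, fun i => i.elim0, fun i => i.elim0,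
      fun _ i => i.elim0, fun z => Or.inl ⟨φ.symm z, φ.apply_symm_apply z⟩, ?_⟩
    rw [SimpleGraph.edgeSet_bot, Set.empty_sdiff, Set.image_empty, Set.union_empty]
    ext e
    induction e with | _ x y =>
    constructor
    · intro h
      refine ⟨s(φ.symm x, φ.symm y), φ.symm.map_adj_iff.2 h, ?_⟩
      rw [Sym2.map_mk]
      exact congrArg₂ (fun x y => s(x, y)) (φ.apply_symm_apply x) (φ.apply_symm_apply y)
    · rintro ⟨e, he, h⟩
      rw [← h]
      induction e with | _ x y =>
      exact φ.map_adj_iff.2 he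
  exact hp.isGoodStartingGraph h.starting h.nucleationFree
    (isIndependent_of_card_le_four (by simp) _) (isNucleationFree_of_card_le_four (by simp) _)
    (by norm_num)

theorem IsKSum.isPasting {V : Type u} {V₁ : Type v} {W : Type w} {k : ℕ} {H : SimpleGraph V}
    {G₁ : SimpleGraph V₁} {G : SimpleGraph W} {φ : (⊤ : SimpleGraph (Fin k)) ↪g H}
    {ψ : (⊤ : SimpleGraph (Fin k)) ↪g G₁} (hk : k ≤ 3) (h : IsKSum H G₁ G φ ψ) :
    ∃ (f : V ↪ W) (g : V₁ ↪ W), IsPasting H G₁ G φ ψ f g := by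
  obtain ⟨-, -, f, g, hglue, hunion, hinter, rfl⟩ := h
  refine ⟨f, g, hk, ψ.injective, fun i j hij => ψ.map_adj_iff.2 hij, hglue, fun x y hxy => ?_,
    fun z => ?_, ?_⟩
  · have h1 : f x ∈ Set.range f ∩ Set.range g := ⟨⟨x, rfl⟩, ⟨y, hxy.symm⟩⟩
    rw [hinter] at h1
    obtain ⟨i, hi⟩ := h1
    refine ⟨i, f.injective hi, g.injective ?_⟩
    rw [← hglue, ← hxy]
    exact hi
  · have h1 : z ∈ Set.range f ∪ Set.range g := hunion ▸ Set.mem_univ z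
    exact h1
  · rw [SimpleGraph.edgeSet_sup, edgeSet_map_of_injective f.injective,
      edgeSet_map_of_injective g.injective]
    refine subset_antisymm (Set.union_subset Set.subset_union_left ?_)
      (Set.union_subset_union_right _ (Set.image_mono Set.sdiff_subset))
    rintro _ ⟨e, he, rfl⟩
    by_cases he' : e ∈ pairsIn (Set.range ψ)
    · left
      induction e with | _ x y =>
      rw [mk_mem_pairsIn] at he'
      obtain ⟨hxy, ⟨i, rfl⟩, ⟨j, rfl⟩⟩ := he'
      refine ⟨s(φ i, φ j), φ.map_adj_iff.2 fun hij => hxy (hij ▸ rfl), ?_⟩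
      rw [Sym2.map_mk, Sym2.map_mk, hglue, hglue]
    · exact Or.inr ⟨e, ⟨he, he'⟩, rfl⟩

theorem IsPasting.finite {V V₁ W : Type*} {k : ℕ} [Finite V] [Finite V₁]
    {A : SimpleGraph V} {B : SimpleGraph V₁} {G : SimpleGraph W}
    {φ : Fin k → V} {ψ : Fin k → V₁} {f : V ↪ W} {g : V₁ ↪ W} (h : IsPasting A B G φ ψ f g) :
    Finite W := by
  refine Set.finite_univ_iff.1 (((Set.finite_range f).union (Set.finite_range g)).subset ?_)
  exact fun z _ => h.union z

theorem KSumMove.isGoodStartingGraph [Finite V] (hH : IsStartingGraph H)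
    (hnf : IsNucleationFree H) (h : KSumMove H G) : Finite W ∧ IsGoodStartingGraph G := by
  obtain ⟨V₁, _, G₁, k, φ, ψ, hnf₁, hind₁, -, hk, hK, hsum⟩ := h
  obtain ⟨f, g, hp⟩ := hsum.isPasting hk
  have := hp.finite
  exact ⟨this, hp.isGoodStartingGraph hH hnf hind₁ hnf₁ hK⟩

/-- The new vertex with its three neighbours is a K₄, pasted along the triangle of neighbours
without adding its edges. The neighbours need not be adjacent in `H`. -/
theorem HennebergMove.isPasting (h : HennebergMove H G) :
    ∃ (w : Fin 3 → V) (f : V ↪ W) (g : Fin 4 ↪ W), ¬ InK4 H w ∧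
      IsPasting H (⊤ : SimpleGraph (Fin 4)) G w Fin.succ f g := by
  obtain ⟨f, v, w, hv, hz, hK, rfl⟩ := h
  have hg : Function.Injective (Fin.cons v (f ∘ w) : Fin 4 → W) := by
    rw [Fin.cons_injective_iff]
    refine ⟨?_, f.injective.comp w.injective⟩
    rintro ⟨i, hi⟩
    exact hv ⟨_, hi⟩
  refine ⟨w, f, ⟨_, hg⟩, hK, le_rfl, Fin.succ_injective 3,
    fun i j hij => fun h => hij (Fin.succ_injective 3 h), fun i => rfl, fun x y hxy => ?_,
    fun z => ?_, ?_⟩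
  · induction y using Fin.cases with
    | zero => exact absurd ⟨x, hxy⟩ hv
    | succ i => exact ⟨i, f.injective hxy.symm, rfl⟩
  · rcases hz z with rfl | hz
    · exact Or.inr ⟨0, rfl⟩
    · exact Or.inl hz
  · rw [SimpleGraph.edgeSet_sup, edgeSet_map_of_injective f.injective,
      SimpleGraph.edgeSet_fromEdgeSet]
    congr 1
    ext e
    constructor
    · rintro ⟨⟨i, rfl⟩, -⟩
      refine ⟨s(0, i.succ), ⟨(Fin.succ_ne_zero i).symm, fun h => ?_⟩, rfl⟩
      obtain ⟨j, hj⟩ := h.2 0 (by simp)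
      exact Fin.succ_ne_zero j hj
    · rintro ⟨e, ⟨he, he'⟩, rfl⟩
      have key : ∃ i : Fin 3, e = s(0, i.succ) := by
        induction e with | _ x y =>
        have hxy : x ≠ y := he
        induction x using Fin.cases with
        | zero =>
          obtain ⟨i, rfl⟩ := Fin.exists_succ_eq.2 hxy.symm
          exact ⟨i, rfl⟩
        | succ i =>
          induction y using Fin.cases with
          | zero => exact ⟨i, Sym2.eq_swap⟩
          | succ j =>
            exact absurd (mk_mem_pairsIn.2 ⟨hxy, Set.mem_range_self i, Set.mem_range_self j⟩) he'
      obtain ⟨i, rfl⟩ := key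
      refine ⟨⟨i, rfl⟩, ?_⟩
      rw [Sym2.map_mk]
      exact fun h => hv ⟨w i, (Sym2.mk_isDiag_iff.1 h).symm⟩

theorem HennebergMove.isGoodStartingGraph [Finite V] (hH : IsStartingGraph H)
    (hnf : IsNucleationFree H) (h : HennebergMove H G) : Finite W ∧ IsGoodStartingGraph G := by
  obtain ⟨w, f, g, hK, hp⟩ := h.isPasting
  have := hp.finite
  exact ⟨this, hp.isGoodStartingGraph hH hnf (isIndependent_of_card_le_four (by simp) _)
    (isNucleationFree_of_card_le_four (by simp) _) fun _ => Or.inl hK⟩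

theorem RoofMove.isGoodStartingGraph [Finite V] (hH : IsIndependent H) (h : RoofMove H G) :
    Finite W ∧ IsGoodStartingGraph G := by
  obtain ⟨𝒳, a, b, side, hcut, ⟨φ⟩⟩ := h
  exact ⟨Finite.of_equiv _ φ.symm.toEquiv,
    (isGoodStartingGraph_roofAddition hH hcut).of_iso φ.symm⟩

theorem Generated.isGoodStartingGraph [Finite V] (hH : IsStartingGraph H)
    (hnf : IsNucleationFree H) (h : Generated H G) : Finite W ∧ IsGoodStartingGraph G := by
  induction h with
  | refl => exact ⟨inferInstance, hH.isGoodStartingGraph hnf⟩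
  | kSum _ hm ih =>
    have := ih.1
    exact hm.isGoodStartingGraph ih.2.starting ih.2.nucleationFree
  | henneberg _ hm ih =>
    have := ih.1
    exact hm.isGoodStartingGraph ih.2.starting ih.2.nucleationFree
  | roofAdd _ hm ih =>
    have := ih.1
    exact hm.isGoodStartingGraph ih.2.independent

/-- The admissible cut of a starting graph permits one more roof-addition, which adds six vertices:
two from the cut, u and v, and two apexes. -/
theorem Generated.exists_card_lt [Finite W] (h : Generated H G) (hG : IsStartingGraph G) :
    ∃ (W' : Type u) (G' : SimpleGraph W'), Generated H G' ∧ Finite W' ∧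
      Nat.card W < Nat.card W' ∧ IsGoodStartingGraph G' := by
  obtain ⟨hind, 𝒳, a, b, side, hcut⟩ := hG
  refine ⟨_, roofAddition G a b side, h.roofAdd ⟨𝒳, a, b, side, hcut, ⟨.refl⟩⟩, inferInstance, ?_,
    isGoodStartingGraph_roofAddition hind hcut⟩
  rw [Nat.card_sum, Nat.card_sum, Nat.card_fin, Nat.card_fin]
  omega

end Moves

end

theorem theorem4p3 {V : Type u} [Finite V] (H : SimpleGraph V) (hH : IsStartingGraph H) :
    (IsNucleationFree H → ∀ (W : Type u) (G : SimpleGraph W),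
      KSumMove H G → IsGoodStartingGraph G) ∧
    (IsNucleationFree H → ∀ (W : Type u) (G : SimpleGraph W),
      HennebergMove H G → IsGoodStartingGraph G) ∧
    (∀ (W : Type u) (G : SimpleGraph W), RoofMove H G → IsGoodStartingGraph G) ∧
    (IsNucleationFree H → ∀ (W : Type u) (G : SimpleGraph W),
      Generated H G → Finite W ∧ IsGoodStartingGraph G) ∧
    (∀ N : ℕ, ∃ (W : Type u) (G : SimpleGraph W),
      Generated H G ∧ Finite W ∧ N ≤ Nat.card W ∧ IsGoodStartingGraph G) := by
  refine ⟨fun hnf W G h => (h.isGoodStartingGraph hH hnf).2,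
    fun hnf W G h => (h.isGoodStartingGraph hH hnf).2,
    fun W G h => (h.isGoodStartingGraph hH.1).2,
    fun hnf W G h => h.isGoodStartingGraph hH hnf, fun N => ?_⟩
  induction N with
  | zero =>
    -- One roof-addition is made even here, since `H` itself need not be nucleation-free.
    obtain ⟨W, G, hG, hW, -, hgood⟩ := Generated.refl.exists_card_lt hH
    exact ⟨W, G, hG, hW, Nat.zero_le _, hgood⟩
  | succ N ih =>
    obtain ⟨W, G, hG, hW, hN, hgood⟩ := ih
    obtain ⟨W', G', hG', hW', hlt, hgood'⟩ := hG.exists_card_lt hgood.starting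
    exact ⟨W', G', hG', hW', hN.trans_lt hlt, hgood'⟩
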